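/- **Model of the graph.** Let $G$ be a connected finite simple graph on $n$ vertices. Its point set $P(G)$ consists of the vertices and of the points $p(u,v,\lambda)$ for $uv\in E(G)$, $\lambda\in[0,1]$, where $p(u,v,\lambda)=p(v,u,1-\lambda)$, $p(u,v,0)=u$ and $p(u,v,1)=v$ (each edge is a unit interval). A *walk* is a finite sequence of points $p_0p_1\dots p_z$ ($z\ge 0$) in which every two consecutive points are distinct and lie on a common edge. Its *length* is $\ell(T)=\sum_{i=1}^{z} d(p_{i-1},p_i)$, where $d(p(u,v,\lambda),p(u,v,\mu))=|\lambda-\mu|$. The distance $d(p,q)$ of any two points is the minimum length of a walk from $p$ to $q$. The points *passed* by $T$ are $p_0,\dots,p_z$ and all points between $p_{i-1}$ and $p_i$ on their common edge, for $1\le i\le z$. A *tour* is a walk with $p_0=p_z$. For a real $\delta>0$, a *$\delta$-tour* is a tour $T$ such that every $p\in P(G)$ satisfies $d(p,T)\le\delta$, where $d(p,T)$ is the infimum of $d(p,q)$ over the points $q$ passed by $T$. It is *shortest* if its length is minimum among all $\delta$-tours of $G$. **Theorem.** There are an algorithm, a computable function $f:\mathbb N\to\mathbb N$ and a constant $c$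 such that, given any connected $n$-vertex graph $G$ (by its adjacency matrix) and any real $\delta>0$, the algorithm computes a shortest $\delta$-tour of $G$, as a sequence of points each given by a triple $(u,v,\lambda)$, in at most $f(k)\cdot n^{ck}$ steps, where $k=\lceil n/\delta\rceil$. Here an algorithm is a program, independent of the input, for a random access machine with unit-cost steps that operates on natural numbers and on real numbers by addition, subtraction (truncated at $0$ on natural numbers), comparison and indirect addressing, with natural resp. rational constants. -/

import Mathlib

/-! ## The continuous graph model

The point `p(u, v, a)` at distance `a` from `u` on the edge `uv` is represented by its barycentric
coordinates `(1 - a) e_u + a e_v` in `V → ℝ`, and the vertex `u` by the unit vector `e_u`.  The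
lemmas below record that this gives exactly the identifications `p(u, v, a) = p(v, u, 1 - a)`,
`p(u, v, 0) = u`, `p(u, v, 1) = v`, and that the supremum distance of two points of one edge is
the difference of their positions on this edge. -/

namespace DeltaTour

section Model

variable {V : Type*} [DecidableEq V]

/-- The vertex `u`, as a point. -/
noncomputable def vertexPt (u : V) : V → ℝ := Pi.single u 1

/-- The point `p(u, v, a)`. -/
noncomputable def edgePt (u v : V) (a : ℝ) : V → ℝ := (1 - a) • vertexPt u + a • vertexPt v

theorem edgePt_swap {V : Type*} [DecidableEq V] (u v : V) (a : ℝ) :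
    edgePt v u (1 - a) = edgePt u v a := by
  simp [edgePt, add_comm]

theorem edgePt_zero {V : Type*} [DecidableEq V] (u v : V) : edgePt u v 0 = vertexPt u := by
  simp [edgePt]

theorem edgePt_one {V : Type*} [DecidableEq V] (u v : V) : edgePt u v 1 = vertexPt v := by
  simp [edgePt]

theorem dist_edgePt {V : Type*} [Fintype V] [DecidableEq V] {u v : V} (h : u ≠ v) (a b : ℝ) :
    dist (edgePt u v a) (edgePt u v b) = |b - a| := by
  apply le_antisymm
  · refine (dist_pi_le_iff (abs_nonneg _)).2 fun w => ?_
    rw [Real.dist_eq]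
    by_cases hu : w = u
    · subst hu
      simp [edgePt, vertexPt, h]
    · by_cases hv : w = v
      · subst hv
        simp [edgePt, vertexPt, hu, abs_sub_comm]
      · simp [edgePt, vertexPt, hu, hv]
  · have := dist_le_pi_dist (edgePt u v a) (edgePt u v b) v
    rw [Real.dist_eq] at this
    simpa [edgePt, vertexPt, Pi.single_apply, h.symm, abs_sub_comm] using this

/-- The point set `P(G)`: all vertices and all points of all edges. -/
def points (G : SimpleGraph V) : Set (V → ℝ) :=
  {x | (∃ u, x = vertexPt u) ∨
    ∃ u v a, G.Adj u v ∧ a ∈ Set.Icc (0 : ℝ) 1 ∧ x = edgePt u v a}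

/-- The points `p` and `q` lie on a common edge. -/
def SameEdge (G : SimpleGraph V) (p q : V → ℝ) : Prop :=
  ∃ u v a b, G.Adj u v ∧ a ∈ Set.Icc (0 : ℝ) 1 ∧ b ∈ Set.Icc (0 : ℝ) 1 ∧
    p = edgePt u v a ∧ q = edgePt u v b

/-- The edge segment between two points `p` and `q` of one edge. -/
def edgeSegment (G : SimpleGraph V) (p q : V → ℝ) : Set (V → ℝ) :=
  {x | ∃ u v a b m, G.Adj u v ∧ a ∈ Set.Icc (0 : ℝ) 1 ∧ b ∈ Set.Icc (0 : ℝ) 1 ∧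
    p = edgePt u v a ∧ q = edgePt u v b ∧ min a b ≤ m ∧ m ≤ max a b ∧ x = edgePt u v m}

/-- A walk `p₀ p₁ … p_z` (`z ≥ 0`): a nonempty finite sequence of points in which every two
consecutive points are distinct and lie on a common edge. -/
def IsWalk (G : SimpleGraph V) (T : List (V → ℝ)) : Prop :=
  T ≠ [] ∧ (∀ p ∈ T, p ∈ points G) ∧ T.IsChain (fun p q => p ≠ q ∧ SameEdge G p q)

/-- A `p`-`q`-walk. -/
def IsWalkFromTo (G : SimpleGraph V) (p q : V → ℝ) (T : List (V → ℝ)) : Prop :=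
  IsWalk G T ∧ T.head? = some p ∧ T.getLast? = some q

/-- The length of a walk: the sum of the distances of consecutive points, which lie on a common
edge; on an edge, `dist` is the difference of the positions (see `dist_edgePt`). -/
noncomputable def len {V : Type*} [Fintype V] : List (V → ℝ) → ℝ
  | [] => 0
  | [_] => 0
  | p :: q :: l => dist p q + len (q :: l)

/-- The points passed by a walk. -/
def passed (G : SimpleGraph V) : List (V → ℝ) → Set (V → ℝ)
  | [] => ∅
  | [p] => {p}
  | p :: q :: l => edgeSegment G p q ∪ passed G (q :: l)

/-- The distance of two points: the least length of a walk between them (`⊤` if there is none). -/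
noncomputable def ptDist [Fintype V] (G : SimpleGraph V) (p q : V → ℝ) : ENNReal :=
  ⨅ (T : List (V → ℝ)) (_ : IsWalkFromTo G p q T), ENNReal.ofReal (len T)

/-- The distance of a point to a set of points. -/
noncomputable def ptSetDist [Fintype V] (G : SimpleGraph V) (p : V → ℝ) (Q : Set (V → ℝ)) : ENNReal :=
  ⨅ q ∈ Q, ptDist G p q

/-- A tour is a walk that ends where it starts. -/
def IsTour (G : SimpleGraph V) (T : List (V → ℝ)) : Prop :=
  ∃ p, IsWalkFromTo G p p T

/-- A `δ`-tour is a tour such that every point of the graph has distance at most `δ` to it. -/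
def IsDeltaTour [Fintype V] (G : SimpleGraph V) (δ : ℝ) (T : List (V → ℝ)) : Prop :=
  IsTour G T ∧ ∀ p ∈ points G, ptSetDist G p (passed G T) ≤ ENNReal.ofReal δ

/-- A shortest `δ`-tour. -/
def IsShortestDeltaTour [Fintype V] (G : SimpleGraph V) (δ : ℝ) (T : List (V → ℝ)) : Prop :=
  IsDeltaTour G δ T ∧ ∀ T', IsDeltaTour G δ T' → len T ≤ len T'

end Model

/-! ## The machine model

A random access machine with structured control flow.  It has integer registers and an integer
memory (holding natural numbers), and real registers and a real memory.  Memory is addressed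
indirectly through integer registers.  The arithmetic is additive: addition and subtraction are
the only operations, on both sorts; in particular there is no rounding of reals.  Each
instruction and each evaluation of a test takes one step. -/

/-- A configuration of the machine. -/
structure State where
  natReg : ℕ → ℕ
  natMem : ℕ → ℕ
  realReg : ℕ → ℝ
  realMem : ℕ → ℝ

/-- Instructions; the arguments are register indices, except for the constants `c`. -/
inductive Instr where
  | natConst (i c : ℕ)
  | natAdd (i j l : ℕ)
  | natSub (i j l : ℕ)
  | natLoad (i j : ℕ)
  | natStore (i j : ℕ)
  | realConst (i : ℕ) (c : ℚ)
  | realAdd (i j l : ℕ)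
  | realSub (i j l : ℕ)
  | realLoad (i j : ℕ)
  | realStore (i j : ℕ)

/-- The effect of an instruction. -/
noncomputable def Instr.eval (s : State) : Instr → State
  | .natConst i c => { s with natReg := Function.update s.natReg i c }
  | .natAdd i j l => { s with natReg := Function.update s.natReg i (s.natReg j + s.natReg l) }
  | .natSub i j l => { s with natReg := Function.update s.natReg i (s.natReg j - s.natReg l) }
  | .natLoad i j => { s with natReg := Function.update s.natReg i (s.natMem (s.natReg j)) }
  | .natStore i j => { s with natMem := Function.update s.natMem (s.natReg i) (s.natReg j) }
  | .realConst i c => { s with realReg := Function.update s.realReg i (c : ℝ) }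
  | .realAdd i j l =>
      { s with realReg := Function.update s.realReg i (s.realReg j + s.realReg l) }
  | .realSub i j l =>
      { s with realReg := Function.update s.realReg i (s.realReg j - s.realReg l) }
  | .realLoad i j => { s with realReg := Function.update s.realReg i (s.realMem (s.natReg j)) }
  | .realStore i j => { s with realMem := Function.update s.realMem (s.natReg i) (s.realReg j) }

/-- Tests: comparisons of two registers. -/
inductive Test where
  | natLe (i j : ℕ)
  | natLt (i j : ℕ)
  | realLe (i j : ℕ)
  | realLt (i j : ℕ)

/-- The test succeeds in the configuration `s`. -/
def Test.Holds (s : State) : Test → Prop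
  | .natLe i j => s.natReg i ≤ s.natReg j
  | .natLt i j => s.natReg i < s.natReg j
  | .realLe i j => s.realReg i ≤ s.realReg j
  | .realLt i j => s.realReg i < s.realReg j

/-- Programs. -/
inductive Prog where
  | instr (a : Instr)
  | seq (A B : Prog)
  | cond (b : Test) (A B : Prog)
  | loop (b : Test) (A : Prog)

/-- `Exec A s s' t`: the program `A`, started in `s`, halts in `s'` after exactly `t` steps. -/
inductive Exec : Prog → State → State → ℕ → Prop
  | instr (a : Instr) (s : State) : Exec (.instr a) s (a.eval s) 1
  | seq {A B : Prog} {s₁ s₂ s₃ : State} {t₁ t₂ : ℕ} :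
      Exec A s₁ s₂ t₁ → Exec B s₂ s₃ t₂ → Exec (.seq A B) s₁ s₃ (t₁ + t₂)
  | condTrue {b : Test} {A B : Prog} {s s' : State} {t : ℕ} :
      b.Holds s → Exec A s s' t → Exec (.cond b A B) s s' (t + 1)
  | condFalse {b : Test} {A B : Prog} {s s' : State} {t : ℕ} :
      ¬ b.Holds s → Exec B s s' t → Exec (.cond b A B) s s' (t + 1)
  | loopDone {b : Test} {A : Prog} {s : State} :
      ¬ b.Holds s → Exec (.loop b A) s s 1
  | loopStep {b : Test} {A : Prog} {s₁ s₂ s₃ : State} {t₁ t₂ : ℕ} :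
      b.Holds s₁ → Exec A s₁ s₂ t₁ → Exec (.loop b A) s₂ s₃ t₂ →
        Exec (.loop b A) s₁ s₃ (t₁ + t₂ + 1)

/-- The machine is deterministic. -/
theorem Exec.det {A : Prog} {s s₁ s₂ : State} {t₁ t₂ : ℕ}
    (h₁ : Exec A s s₁ t₁) (h₂ : Exec A s s₂ t₂) : s₁ = s₂ ∧ t₁ = t₂ := by
  induction h₁ generalizing s₂ t₂ with
  | instr a s => cases h₂; exact ⟨rfl, rfl⟩
  | seq _ _ ihA ihB =>
    cases h₂ with
    | seq a b =>
      obtain ⟨rfl, rfl⟩ := ihA a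
      obtain ⟨rfl, rfl⟩ := ihB b
      exact ⟨rfl, rfl⟩
  | condTrue hb _ ih =>
    cases h₂ with
    | condTrue _ a => obtain ⟨rfl, rfl⟩ := ih a; exact ⟨rfl, rfl⟩
    | condFalse h _ => exact absurd hb h
  | condFalse hb _ ih =>
    cases h₂ with
    | condTrue h _ => exact absurd h hb
    | condFalse _ a => obtain ⟨rfl, rfl⟩ := ih a; exact ⟨rfl, rfl⟩
  | loopDone hb =>
    cases h₂ with
    | loopDone _ => exact ⟨rfl, rfl⟩
    | loopStep h _ _ => exact absurd h hb
  | loopStep hb _ _ ihA ihB =>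
    cases h₂ with
    | loopDone h => exact absurd hb h
    | loopStep _ a b =>
      obtain ⟨rfl, rfl⟩ := ihA a
      obtain ⟨rfl, rfl⟩ := ihB b
      exact ⟨rfl, rfl⟩

/-- The initial configuration on input `G`, `δ`: integer register `0` holds `n`, cell `u * n + v`
of the integer memory holds the entry `(u, v)` of the adjacency matrix, and real register `0`
holds `δ`.  Everything else is `0`. -/
noncomputable def inputState {n : ℕ} (G : SimpleGraph (Fin n)) (δ : ℝ) : State where
  natReg := fun i => if i = 0 then n else 0
  natMem := fun a =>
    open Classical in
    if ∃ u v : Fin n, G.Adj u v ∧ a = (u : ℕ) * n + (v : ℕ) then 1 else 0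
  realReg := fun i => if i = 0 then δ else 0
  realMem := fun _ => 0

/-- The configuration `s` outputs the sequence of points `T = p₀ p₁ … p_z`: integer register `0`
holds the number `z + 1` of its terms, and for each `i` the cells `2 * i` and `2 * i + 1` of the
integer memory and the cell `i` of the real memory hold `u`, `v`, `a` with `p_i = p(u, v, a)`,
where `uv` is an edge, or `u = v` and `p_i` is the vertex `u`. -/
def Outputs {n : ℕ} (G : SimpleGraph (Fin n)) (s : State) (T : List (Fin n → ℝ)) : Prop :=
  s.natReg 0 = T.length ∧
    ∀ (i : ℕ) (hi : i < T.length), ∃ u v : Fin n,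
      s.natMem (2 * i) = u ∧ s.natMem (2 * i + 1) = v ∧ (G.Adj u v ∨ u = v) ∧
        s.realMem i ∈ Set.Icc (0 : ℝ) 1 ∧ T[i] = edgePt u v (s.realMem i)

end DeltaTour

/-! ## A structured language with bounded loops on top of the machine -/

/-! The search for a shortest `δ`-tour among infinitely many walks is reduced to a finite search,
which a program then carries out by brute force. Write `k = ⌈n / δ⌉`.

Few points. Fix a `δ`-tour `T` and let `ν p` be a point of `T` nearest to `p`. Pick points greedily,
each farther than `δ` from `ν q` for all points `q` picked before. A packing argument
(`length_le_of_spread`) bounds their number: pieces of shortest walks around the picked points are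
disjoint, and each contains many marked points. If `n > 8 * k`, then `δ > 8`, the vertices serve as
marks, and the bound is linear in `k`. If `n ≤ 8 * k`, the edges are subdivided, and the bound is
cubic in `k`. When the greedy choice stops, every point of the graph is within `δ` of one of the
points `ν p`, and these, in the order of `T`, form a closed sequence whose consecutive distances add
up to at most `len T` (`exists_few_points`, `exists_fewPts`). Conversely, shortest walks between
consecutive points of such a covering closed sequence form a `δ`-tour. So it suffices to minimize
over cyclic `m`-tuples of points with `m = fewPts n k`.

Discrete positions. Fix the edges of the `m` points and let only their positions `x i` vary.
Distances are minima of expressions `± x i ± x j + c`, apart from the absolute value for two points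
of one edge, and the part of an edge within `δ` of a point is a union of intervals with ends `c` or
`± x i + c ± δ`, where `c` is an integer. Hence the covering property, and an affine upper bound on
the length that is exact at `x`, persist at every `y` that inherits from `x` the inequalities `± x i
± x j ≤ c` and `± x i ± x j ≤ c + 2 * δ`. Such `y` include a polytope, on which the linear part of
the bound is minimized at an extreme point of a face. There, tight inequalities must link `y i` to
`- y i`, for otherwise `y` could be moved in two opposite directions (`exists_direction`). Following
the links gives `2 * y i = c + 2 * δ * b` with `|b| ≤ 2 * m` (`exists_discrete_vector`,
`exists_discrete_tuple`).

Search. If `δ ≤ n`, a point is thus described by two vertices and two bounded integers, that is, by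
four digits in base `Q = 8 * (m + 1) * (n + 1)`, and a tuple by a number below `R = Q ^ (4 * m)`. If
`δ > n`, a single vertex is a `δ`-tour. The program runs through all codes, tests whether the tuple
covers each edge (by `cover_iff_germ` finitely many comparisons suffice), computes the length from
the distance matrix, keeps the best code and writes out its walk. Products, quotients and positions
are obtained by repeated addition and subtraction.

Time. Apart from the loop that finds `k`, everything is written in a language of bounded loops whose
bounds are registers with values at most `R`, so the time is at most a constant times `(R + 2)` to
the constant nesting depth (`exec_code`). Either `n ≤ 8 * k` and `R` is bounded in `k`, or `m = 700
* k` and `R` is at most a function of `k` times `n ^ (2800 * k)` (`space_fewPts_le`). -/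

namespace DeltaTour

/-- Expressions of natural-number type. -/
inductive NExp where
  | const (c : ℕ)
  | var (i : ℕ)
  | add (a b : NExp)
  | sub (a b : NExp)
  | load (a : NExp)

/-- Expressions of real type. -/
inductive RExp where
  | const (c : ℚ)
  | var (i : ℕ)
  | add (a b : RExp)
  | sub (a b : RExp)
  | load (a : NExp)

/-- Boolean expressions. -/
inductive BExp where
  | leN (a b : NExp)
  | leR (a b : RExp)
  | not (a : BExp)
  | and (a b : BExp)

/-- Statements; `loop i r A` runs `A` for all values of register `i` below the value of
register `r`. -/
inductive Stmt where
  | skip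
  | setN (x : ℕ) (e : NExp)
  | setR (x : ℕ) (e : RExp)
  | stN (a e : NExp)
  | stR (a : NExp) (e : RExp)
  | seq (A B : Stmt)
  | ite (b : BExp) (A B : Stmt)
  | loop (i r : ℕ) (A : Stmt)

def State.setN (s : State) (i v : ℕ) : State := { s with natReg := Function.update s.natReg i v }

def State.setR (s : State) (i : ℕ) (v : ℝ) : State :=
  { s with realReg := Function.update s.realReg i v }

/-- The configurations agree on the memory and on the registers below `w`. -/
structure Upto (w : ℕ) (s s' : State) : Prop where
  n : ∀ i < w, s.natReg i = s'.natReg i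
  r : ∀ i < w, s.realReg i = s'.realReg i
  mn : s.natMem = s'.natMem
  mr : s.realMem = s'.realMem

theorem Upto.refl (w : ℕ) (s : State) : Upto w s s := ⟨fun _ _ => rfl, fun _ _ => rfl, rfl, rfl⟩

theorem Upto.trans {w : ℕ} {s s' s'' : State} (h : Upto w s s') (h' : Upto w s' s'') :
    Upto w s s'' :=
  ⟨fun i hi => (h.n i hi).trans (h'.n i hi), fun i hi => (h.r i hi).trans (h'.r i hi),
    h.mn.trans h'.mn, h.mr.trans h'.mr⟩

theorem Upto.mono {w w' : ℕ} (hw : w' ≤ w) {s s' : State} (h : Upto w s s') : Upto w' s s' :=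
  ⟨fun i hi => h.n i (hi.trans_le hw), fun i hi => h.r i (hi.trans_le hw), h.mn, h.mr⟩

theorem Upto.setN_right {w i : ℕ} (hi : w ≤ i) (s : State) (v : ℕ) : Upto w s (s.setN i v) :=
  ⟨fun j hj => by simp [State.setN, Function.update_of_ne (show j ≠ i by omega)],
    fun _ _ => rfl, rfl, rfl⟩

theorem Upto.setR_right {w i : ℕ} (hi : w ≤ i) (s : State) (v : ℝ) : Upto w s (s.setR i v) :=
  ⟨fun _ _ => rfl, fun j hj => by simp [State.setR, Function.update_of_ne (show j ≠ i by omega)],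
    rfl, rfl⟩

theorem Upto.setN {w : ℕ} {s s' : State} (h : Upto w s s') (i v : ℕ) :
    Upto w (s.setN i v) (s'.setN i v) :=
  ⟨fun j hj => by
    by_cases hji : j = i
    · simp [State.setN, hji]
    · simp [State.setN, hji, h.n j hj], h.r, h.mn, h.mr⟩

theorem Upto.setR {w : ℕ} {s s' : State} (h : Upto w s s') (i : ℕ) (v : ℝ) :
    Upto w (s.setR i v) (s'.setR i v) :=
  ⟨h.n, fun j hj => by
    by_cases hji : j = i
    · simp [State.setR, hji]
    · simp [State.setR, hji, h.r j hj], h.mn, h.mr⟩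

/-! ### Compilation of expressions and tests. -/

namespace NExp

def eval (s : State) : NExp → ℕ
  | const c => c
  | var i => s.natReg i
  | add a b => a.eval s + b.eval s
  | sub a b => a.eval s - b.eval s
  | load a => s.natMem (a.eval s)

/-- All variables are registers below `100`; the others are for intermediate results. -/
def ok : NExp → Bool
  | const _ => true
  | var i => i < 100
  | add a b => a.ok && b.ok
  | sub a b => a.ok && b.ok
  | load a => a.ok

def size : NExp → ℕ
  | const _ => 1
  | var _ => 2
  | add a b => a.size + (b.size + 1)
  | sub a b => a.size + (b.size + 1)
  | load a => a.size + 1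

/-- The program that computes the value into register `w`. -/
def code (w : ℕ) : NExp → Prog
  | const c => .instr (.natConst w c)
  | var i => .seq (.instr (.natConst w 0)) (.instr (.natAdd w i w))
  | add a b => .seq (a.code w) (.seq (b.code (w + 1)) (.instr (.natAdd w w (w + 1))))
  | sub a b => .seq (a.code w) (.seq (b.code (w + 1)) (.instr (.natSub w w (w + 1))))
  | load a => .seq (a.code w) (.instr (.natLoad w w))

theorem eval_congr {s s' : State} (h : Upto 100 s s') (e : NExp) (he : e.ok = true) :
    e.eval s = e.eval s' := by
  induction e with
  | const c => rfl
  | var i => exact h.n i (by simpa [ok] using he)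
  | add a b iha ihb => simp only [ok, Bool.and_eq_true] at he; simp [eval, iha he.1, ihb he.2]
  | sub a b iha ihb => simp only [ok, Bool.and_eq_true] at he; simp [eval, iha he.1, ihb he.2]
  | load a iha => simp [eval, iha he, h.mn]

/-- The registers from `w` on act as a stack: the second operand is computed at `w + 1` and leaves
register `w` alone. Variables lie below `100`, so intermediate results never change them. -/
theorem exec (e : NExp) (he : e.ok = true) (w : ℕ) (hw : 100 ≤ w) (s : State) :
    ∃ s', Exec (e.code w) s s' e.size ∧ Upto w s s' ∧ s'.natReg w = e.eval s := by
  induction e generalizing w s with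
  | const c =>
    exact ⟨_, Exec.instr _ _, Upto.setN_right le_rfl s c, by simp [Instr.eval, eval]⟩
  | var i =>
    have hi : i < 100 := by simpa [ok] using he
    refine ⟨_, Exec.seq (Exec.instr _ _) (Exec.instr _ _),
      (Upto.setN_right le_rfl s 0).trans (Upto.setN_right le_rfl (s.setN w 0) _), ?_⟩
    simp [Instr.eval, eval, Function.update_of_ne (show i ≠ w by omega)]
  | add a b iha ihb =>
    simp only [ok, Bool.and_eq_true] at he
    obtain ⟨s₁, h₁, u₁, v₁⟩ := iha he.1 w hw s
    obtain ⟨s₂, h₂, u₂, v₂⟩ := ihb he.2 (w + 1) (by omega) s₁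
    refine ⟨_, Exec.seq h₁ (Exec.seq h₂ (Exec.instr _ _)),
      (u₁.trans (u₂.mono (by omega))).trans (Upto.setN_right le_rfl s₂ _), ?_⟩
    simp [Instr.eval, eval, v₂, ← u₂.n w (by omega), v₁, eval_congr (u₁.mono hw) b he.2]
  | sub a b iha ihb =>
    simp only [ok, Bool.and_eq_true] at he
    obtain ⟨s₁, h₁, u₁, v₁⟩ := iha he.1 w hw s
    obtain ⟨s₂, h₂, u₂, v₂⟩ := ihb he.2 (w + 1) (by omega) s₁
    refine ⟨_, Exec.seq h₁ (Exec.seq h₂ (Exec.instr _ _)),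
      (u₁.trans (u₂.mono (by omega))).trans (Upto.setN_right le_rfl s₂ _), ?_⟩
    simp [Instr.eval, eval, v₂, ← u₂.n w (by omega), v₁, eval_congr (u₁.mono hw) b he.2]
  | load a iha =>
    obtain ⟨s₁, h₁, u₁, v₁⟩ := iha he w hw s
    refine ⟨_, Exec.seq h₁ (Exec.instr _ _), u₁.trans (Upto.setN_right le_rfl s₁ _), ?_⟩
    simp [Instr.eval, eval, v₁, u₁.mn]

end NExp

namespace RExp

noncomputable def eval (s : State) : RExp → ℝ
  | const c => (c : ℝ)
  | var i => s.realReg i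
  | add a b => a.eval s + b.eval s
  | sub a b => a.eval s - b.eval s
  | load a => s.realMem (a.eval s)

def ok : RExp → Bool
  | const _ => true
  | var i => i < 100
  | add a b => a.ok && b.ok
  | sub a b => a.ok && b.ok
  | load a => a.ok

def size : RExp → ℕ
  | const _ => 1
  | var _ => 2
  | add a b => a.size + (b.size + 1)
  | sub a b => a.size + (b.size + 1)
  | load a => a.size + 1

/-- The program that computes the value into register `w`. -/
def code (w : ℕ) : RExp → Prog
  | const c => .instr (.realConst w c)
  | var i => .seq (.instr (.realConst w 0)) (.instr (.realAdd w i w))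
  | add a b => .seq (a.code w) (.seq (b.code (w + 1)) (.instr (.realAdd w w (w + 1))))
  | sub a b => .seq (a.code w) (.seq (b.code (w + 1)) (.instr (.realSub w w (w + 1))))
  | load a => .seq (a.code w) (.instr (.realLoad w w))

theorem eval_congr {s s' : State} (h : Upto 100 s s') (e : RExp) (he : e.ok = true) :
    e.eval s = e.eval s' := by
  induction e with
  | const c => rfl
  | var i => exact h.r i (by simpa [ok] using he)
  | add a b iha ihb => simp only [ok, Bool.and_eq_true] at he; simp [eval, iha he.1, ihb he.2]
  | sub a b iha ihb => simp only [ok, Bool.and_eq_true] at he; simp [eval, iha he.1, ihb he.2]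
  | load a => simp [eval, a.eval_congr h he, h.mr]

theorem exec (e : RExp) (he : e.ok = true) (w : ℕ) (hw : 100 ≤ w) (s : State) :
    ∃ s', Exec (e.code w) s s' e.size ∧ Upto w s s' ∧ s'.realReg w = e.eval s := by
  induction e generalizing w s with
  | const c =>
    exact ⟨_, Exec.instr _ _, Upto.setR_right le_rfl s c, by simp [Instr.eval, eval]⟩
  | var i =>
    have hi : i < 100 := by simpa [ok] using he
    refine ⟨_, Exec.seq (Exec.instr _ _) (Exec.instr _ _),
      (Upto.setR_right le_rfl s ((0 : ℚ) : ℝ)).trans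
        (Upto.setR_right le_rfl (s.setR w ((0 : ℚ) : ℝ)) _), ?_⟩
    simp [Instr.eval, eval, Function.update_of_ne (show i ≠ w by omega)]
  | add a b iha ihb =>
    simp only [ok, Bool.and_eq_true] at he
    obtain ⟨s₁, h₁, u₁, v₁⟩ := iha he.1 w hw s
    obtain ⟨s₂, h₂, u₂, v₂⟩ := ihb he.2 (w + 1) (by omega) s₁
    refine ⟨_, Exec.seq h₁ (Exec.seq h₂ (Exec.instr _ _)),
      (u₁.trans (u₂.mono (by omega))).trans (Upto.setR_right le_rfl s₂ _), ?_⟩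
    simp [Instr.eval, eval, v₂, ← u₂.r w (by omega), v₁, eval_congr (u₁.mono hw) b he.2]
  | sub a b iha ihb =>
    simp only [ok, Bool.and_eq_true] at he
    obtain ⟨s₁, h₁, u₁, v₁⟩ := iha he.1 w hw s
    obtain ⟨s₂, h₂, u₂, v₂⟩ := ihb he.2 (w + 1) (by omega) s₁
    refine ⟨_, Exec.seq h₁ (Exec.seq h₂ (Exec.instr _ _)),
      (u₁.trans (u₂.mono (by omega))).trans (Upto.setR_right le_rfl s₂ _), ?_⟩
    simp [Instr.eval, eval, v₂, ← u₂.r w (by omega), v₁, eval_congr (u₁.mono hw) b he.2]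
  | load a =>
    obtain ⟨s₁, h₁, u₁, v₁⟩ := a.exec he w hw s
    refine ⟨_, Exec.seq h₁ (Exec.instr _ _), u₁.trans (Upto.setR_right le_rfl s₁ _), ?_⟩
    simp [Instr.eval, eval, v₁, u₁.mr]

end RExp

namespace BExp

def Holds (s : State) : BExp → Prop
  | leN a b => a.eval s ≤ b.eval s
  | leR a b => a.eval s ≤ b.eval s
  | not a => ¬ a.Holds s
  | and a b => a.Holds s ∧ b.Holds s

def ok : BExp → Bool
  | leN a b => a.ok && b.ok
  | leR a b => a.ok && b.ok
  | not a => a.ok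
  | and a b => a.ok && b.ok

def size : BExp → ℕ
  | leN a b => a.size + (b.size + 1)
  | leR a b => a.size + (b.size + 1)
  | not a => a.size
  | and a b => a.size + b.size

/-- The program that branches to `A` or to `B`. -/
def code : BExp → Prog → Prog → Prog
  | leN a b, A, B => .seq (a.code 100) (.seq (b.code 101) (.cond (.natLe 100 101) A B))
  | leR a b, A, B => .seq (a.code 100) (.seq (b.code 101) (.cond (.realLe 100 101) A B))
  | not a, A, B => a.code B A
  | and a b, A, B => a.code (b.code A B) B

theorem holds_congr {s s' : State} (h : Upto 100 s s') (b : BExp) (hb : b.ok = true) :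
    b.Holds s ↔ b.Holds s' := by
  induction b with
  | leN a b =>
    simp only [ok, Bool.and_eq_true] at hb
    simp [Holds, a.eval_congr h hb.1, b.eval_congr h hb.2]
  | leR a b =>
    simp only [ok, Bool.and_eq_true] at hb
    simp [Holds, a.eval_congr h hb.1, b.eval_congr h hb.2]
  | not a ih => simp [Holds, ih hb]
  | and a b iha ihb =>
    simp only [ok, Bool.and_eq_true] at hb
    simp [Holds, iha hb.1, ihb hb.2]

/-- The code of a conjunction nests one test inside a branch of the other, so the claim has to hold
for arbitrary continuations `A` and `B`. The configuration `s₁` reached by the tests and their cost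
`t₀` do not depend on what the branches do afterwards. -/
theorem exec (b : BExp) (hb : b.ok = true) (A B : Prog) (s : State) :
    ∃ s₁, Upto 100 s s₁ ∧ ∃ t₀ ≤ b.size, ∀ s' t,
      (b.Holds s → Exec A s₁ s' t) → (¬ b.Holds s → Exec B s₁ s' t) →
        Exec (b.code A B) s s' (t₀ + t) := by
  induction b generalizing A B s with
  | leN a b =>
    simp only [ok, Bool.and_eq_true] at hb
    obtain ⟨s₁, h₁, u₁, v₁⟩ := a.exec hb.1 100 le_rfl s
    obtain ⟨s₂, h₂, u₂, v₂⟩ := b.exec hb.2 101 (by omega) s₁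
    refine ⟨s₂, u₁.trans (u₂.mono (by omega)), _, le_rfl, fun s' t hA hB => ?_⟩
    have key : Test.Holds s₂ (.natLe 100 101) ↔ (leN a b).Holds s := by
      simp [Test.Holds, Holds, v₂, ← u₂.n 100 (by omega), v₁, NExp.eval_congr u₁ b hb.2]
    have : (leN a b).size + t = a.size + (b.size + (t + 1)) := by simp only [size]; omega
    rw [this]
    refine Exec.seq h₁ (Exec.seq h₂ ?_)
    by_cases h : (leN a b).Holds s
    · exact Exec.condTrue (key.2 h) (hA h)
    · exact Exec.condFalse (fun hk => h (key.1 hk)) (hB h)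
  | leR a b =>
    simp only [ok, Bool.and_eq_true] at hb
    obtain ⟨s₁, h₁, u₁, v₁⟩ := a.exec hb.1 100 le_rfl s
    obtain ⟨s₂, h₂, u₂, v₂⟩ := b.exec hb.2 101 (by omega) s₁
    refine ⟨s₂, u₁.trans (u₂.mono (by omega)), _, le_rfl, fun s' t hA hB => ?_⟩
    have key : Test.Holds s₂ (.realLe 100 101) ↔ (leR a b).Holds s := by
      simp [Test.Holds, Holds, v₂, ← u₂.r 100 (by omega), v₁, RExp.eval_congr u₁ b hb.2]
    have : (leR a b).size + t = a.size + (b.size + (t + 1)) := by simp only [size]; omega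
    rw [this]
    refine Exec.seq h₁ (Exec.seq h₂ ?_)
    by_cases h : (leR a b).Holds s
    · exact Exec.condTrue (key.2 h) (hA h)
    · exact Exec.condFalse (fun hk => h (key.1 hk)) (hB h)
  | not a ih =>
    obtain ⟨s₁, u, t₀, ht, h⟩ := ih hb B A s
    exact ⟨s₁, u, t₀, ht, fun s' t hA hB =>
      h s' t (fun ha => hB fun hn => hn ha) fun hn => hA hn⟩
  | and a b iha ihb =>
    simp only [ok, Bool.and_eq_true] at hb
    obtain ⟨s₁, u₁, t₁, ht₁, h₁⟩ := iha hb.1 (b.code A B) B s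
    obtain ⟨s₂, u₂, t₂, ht₂, h₂⟩ := ihb hb.2 A B s₁
    have hc := holds_congr u₁ b hb.2
    by_cases ha : a.Holds s
    · refine ⟨s₂, u₁.trans u₂, t₁ + t₂, by simp only [size]; omega, fun s' t hA hB => ?_⟩
      rw [add_assoc]
      refine h₁ _ _ (fun _ => h₂ _ _ (fun hb' => hA ⟨ha, hc.2 hb'⟩) fun hb' => hB fun h => ?_)
        fun h => absurd ha h
      exact hb' (hc.1 h.2)
    · refine ⟨s₁, u₁, t₁, by simp only [size]; omega, fun s' t hA hB => ?_⟩
      exact h₁ _ _ (fun h => absurd h ha) fun _ => hB fun h => ha h.1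

end BExp

/-! ### Semantics and compilation of statements. -/

namespace Stmt

open Classical in
/-- The effect of a statement. -/
noncomputable def run : Stmt → State → State
  | skip, s => s
  | setN x e, s => s.setN x (e.eval s)
  | setR x e, s => s.setR x (e.eval s)
  | stN a e, s => { s with natMem := Function.update s.natMem (a.eval s) (e.eval s) }
  | stR a e, s => { s with realMem := Function.update s.realMem (a.eval s) (e.eval s) }
  | seq A B, s => B.run (A.run s)
  | ite b A B, s => if b.Holds s then A.run s else B.run s
  | loop i r A, s =>
      Nat.rec (motive := fun _ => State) (s.setN i 0) (fun j st => (A.run st).setN i (j + 1))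
        (s.natReg r)

/-- The integer registers written by a statement. -/
def writesN : Stmt → List ℕ
  | setN x _ => [x]
  | seq A B => A.writesN ++ B.writesN
  | ite _ A B => A.writesN ++ B.writesN
  | loop i _ A => i :: A.writesN
  | _ => []

/-- The real registers written by a statement. -/
def writesR : Stmt → List ℕ
  | setR x _ => [x]
  | seq A B => A.writesR ++ B.writesR
  | ite _ A B => A.writesR ++ B.writesR
  | loop _ _ A => A.writesR
  | _ => []

/-- No integer memory cell is written. -/
def pureN : Stmt → Bool
  | stN _ _ => false
  | seq A B => A.pureN && B.pureN
  | ite _ A B => A.pureN && B.pureN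
  | loop _ _ A => A.pureN
  | _ => true

/-- No real memory cell is written. -/
def pureR : Stmt → Bool
  | stR _ _ => false
  | seq A B => A.pureR && B.pureR
  | ite _ A B => A.pureR && B.pureR
  | loop _ _ A => A.pureR
  | _ => true

/-- The registers that bound loops. -/
def bounds : Stmt → List ℕ
  | seq A B => A.bounds ++ B.bounds
  | ite _ A B => A.bounds ++ B.bounds
  | loop _ r A => r :: A.bounds
  | _ => []

/-- All registers are below `100`, and loop counters are written only by their loops. -/
def ok : Stmt → Bool
  | skip => true
  | setN x e => x < 100 && e.ok
  | setR x e => x < 100 && e.ok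
  | stN a e => a.ok && e.ok
  | stR a e => a.ok && e.ok
  | seq A B => A.ok && B.ok
  | ite b A B => b.ok && (A.ok && B.ok)
  | loop i r A => i < 100 && (r < 100 && (i ≠ r && (!A.writesN.contains i && A.ok)))

/-- A bound on the number of steps, apart from the iterations of loops. -/
def size : Stmt → ℕ
  | skip => 1
  | setN _ e => e.size + 2
  | setR _ e => e.size + 2
  | stN a e => a.size + (e.size + 1)
  | stR a e => a.size + (e.size + 1)
  | seq A B => A.size + B.size
  | ite b A B => b.size + (A.size + B.size)
  | loop _ _ A => A.size + 3

/-- The number of nested loops. -/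
def depth : Stmt → ℕ
  | seq A B => max A.depth B.depth
  | ite _ A B => max A.depth B.depth
  | loop _ _ A => A.depth + 1
  | _ => 0

/-- The program that carries out a statement. -/
def code : Stmt → Prog
  | skip => .instr (.natConst 100 0)
  | setN x e => .seq (e.code 100) (.seq (.instr (.natConst 101 0)) (.instr (.natAdd x 100 101)))
  | setR x e => .seq (e.code 100) (.seq (.instr (.realConst 101 0)) (.instr (.realAdd x 100 101)))
  | stN a e => .seq (a.code 100) (.seq (e.code 101) (.instr (.natStore 100 101)))
  | stR a e => .seq (a.code 100) (.seq (e.code 101) (.instr (.realStore 100 101)))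
  | seq A B => .seq A.code B.code
  | ite b A B => b.code A.code B.code
  | loop i r A => .seq (.instr (.natConst i 0)) (.loop (.natLt i r)
      (.seq A.code (.seq (.instr (.natConst 100 1)) (.instr (.natAdd i i 100)))))

/-- The configuration `s'` differs from `s` only in what `S` writes. -/
structure Frame (S : Stmt) (s s' : State) : Prop where
  n : ∀ x, x ∉ S.writesN → s'.natReg x = s.natReg x
  r : ∀ x, x ∉ S.writesR → s'.realReg x = s.realReg x
  mn : S.pureN = true → s'.natMem = s.natMem
  mr : S.pureR = true → s'.realMem = s.realMem

/-- This weak rule is what the frame lemma `run_frame` rests on. Afterwards `run_loop_inv` adds the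
loop counter and the frame to every invariant. -/
theorem run_loop_induct {i r : ℕ} {A : Stmt} {s : State} (P : ℕ → State → Prop)
    (h0 : P 0 (s.setN i 0))
    (hs : ∀ j st, j < s.natReg r → P j st → P (j + 1) ((A.run st).setN i (j + 1))) :
    P (s.natReg r) ((loop i r A).run s) := by
  have : ∀ j ≤ s.natReg r, P j (Nat.rec (motive := fun _ => State) (s.setN i 0)
      (fun j st => (A.run st).setN i (j + 1)) j) := by
    intro j
    induction j with
    | zero => intro _; exact h0
    | succ j ih => intro hj; exact hs j _ hj (ih (by omega))
  exact this _ le_rfl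

theorem run_frame (S : Stmt) (s : State) : S.Frame s (S.run s) := by
  induction S generalizing s with
  | skip => exact ⟨fun _ _ => rfl, fun _ _ => rfl, fun _ => rfl, fun _ => rfl⟩
  | setN x e =>
    refine ⟨fun y hy => ?_, fun _ _ => rfl, fun _ => rfl, fun _ => rfl⟩
    simp [writesN] at hy
    simp [run, State.setN, hy]
  | setR x e =>
    refine ⟨fun _ _ => rfl, fun y hy => ?_, fun _ => rfl, fun _ => rfl⟩
    simp [writesR] at hy
    simp [run, State.setR, hy]
  | stN a e => exact ⟨fun _ _ => rfl, fun _ _ => rfl, fun h => by simp [pureN] at h, fun _ => rfl⟩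
  | stR a e => exact ⟨fun _ _ => rfl, fun _ _ => rfl, fun _ => rfl, fun h => by simp [pureR] at h⟩
  | seq A B ihA ihB =>
    have hA := ihA s
    have hB := ihB (A.run s)
    refine ⟨fun x hx => ?_, fun x hx => ?_, fun h => ?_, fun h => ?_⟩
    · simp only [writesN, List.mem_append, not_or] at hx
      exact (hB.n x hx.2).trans (hA.n x hx.1)
    · simp only [writesR, List.mem_append, not_or] at hx
      exact (hB.r x hx.2).trans (hA.r x hx.1)
    · simp only [pureN, Bool.and_eq_true] at h
      exact (hB.mn h.2).trans (hA.mn h.1)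
    · simp only [pureR, Bool.and_eq_true] at h
      exact (hB.mr h.2).trans (hA.mr h.1)
  | ite b A B ihA ihB =>
    have hA := ihA s
    have hB := ihB s
    simp only [run]
    refine ⟨fun x hx => ?_, fun x hx => ?_, fun h => ?_, fun h => ?_⟩
    · simp only [writesN, List.mem_append, not_or] at hx
      split_ifs
      exacts [hA.n x hx.1, hB.n x hx.2]
    · simp only [writesR, List.mem_append, not_or] at hx
      split_ifs
      exacts [hA.r x hx.1, hB.r x hx.2]
    · simp only [pureN, Bool.and_eq_true] at h
      split_ifs
      exacts [hA.mn h.1, hB.mn h.2]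
    · simp only [pureR, Bool.and_eq_true] at h
      split_ifs
      exacts [hA.mr h.1, hB.mr h.2]
  | loop i r A ih =>
    refine run_loop_induct (fun _ st => (loop i r A).Frame s st) ?_ ?_
    · refine ⟨fun x hx => ?_, fun _ _ => rfl, fun _ => rfl, fun _ => rfl⟩
      simp only [writesN, List.mem_cons, not_or] at hx
      simp [State.setN, hx.1]
    · intro j st _ hst
      have h := ih st
      refine ⟨fun x hx => ?_, fun x hx => ?_, fun hp => ?_, fun hp => ?_⟩
      · have hx' := hx
        simp only [writesN, List.mem_cons, not_or] at hx'
        simp only [State.setN, Function.update_of_ne hx'.1]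
        exact (h.n x hx'.2).trans (hst.n x hx)
      · exact (h.r x hx).trans (hst.r x hx)
      · exact (h.mn hp).trans (hst.mn hp)
      · exact (h.mr hp).trans (hst.mr hp)

theorem Frame.trans_setN {i r : ℕ} {A : Stmt} {s st : State} (hst : (loop i r A).Frame s st)
    (v : ℕ) : (loop i r A).Frame s ((A.run st).setN i v) := by
  have h := A.run_frame st
  refine ⟨fun x hx => ?_, fun x hx => ?_, fun hp => ?_, fun hp => ?_⟩
  · have hx' := hx
    simp only [writesN, List.mem_cons, not_or] at hx'
    simp only [State.setN, Function.update_of_ne hx'.1]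
    exact (h.n x hx'.2).trans (hst.n x hx)
  · exact (h.r x hx).trans (hst.r x hx)
  · exact (h.mn hp).trans (hst.mn hp)
  · exact (h.mr hp).trans (hst.mr hp)

/-- Loop invariants: the invariant may use the value of the loop variable and the frame. -/
theorem run_loop_inv {i r : ℕ} {A : Stmt} {s : State} (P : ℕ → State → Prop)
    (h0 : P 0 (s.setN i 0))
    (hs : ∀ j st, j < s.natReg r → st.natReg i = j → (loop i r A).Frame s st → P j st →
      P (j + 1) ((A.run st).setN i (j + 1))) :
    P (s.natReg r) ((loop i r A).run s) := by
  refine (run_loop_induct (fun j st => st.natReg i = j ∧ (loop i r A).Frame s st ∧ P j st)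
    ⟨by simp [State.setN], ⟨fun x hx => ?_, fun _ _ => rfl, fun _ => rfl, fun _ => rfl⟩, h0⟩
    ?_).2.2
  · simp only [writesN, List.mem_cons, not_or] at hx
    simp [State.setN, hx.1]
  · rintro j st hj ⟨h1, h2, h3⟩
    exact ⟨by simp [State.setN], h2.trans_setN _, hs j st hj h1 h2 h3⟩

/-- In `run` the bound of a loop is read once, while the machine compares the counter with it in
every round; they agree because no bound is written anywhere in `S`. For the same reason `M`, which
bounds these registers at the start, bounds them in all nested loops, and each level of nesting
costs a factor of at most `M + 2`. A program that computes a register and later uses it as a bound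
must therefore be cut into several statements. -/
theorem exec_code (S : Stmt) (hok : S.ok = true) (M : ℕ) (s₀ s : State) (hs : Upto 100 s₀ s)
    (hst : ∀ r ∈ S.bounds, r ∉ S.writesN) (hM : ∀ r ∈ S.bounds, s₀.natReg r ≤ M) :
    ∃ s' t, Exec S.code s s' t ∧ Upto 100 (S.run s₀) s' ∧ t ≤ S.size * (M + 2) ^ S.depth := by
  induction S generalizing s₀ s with
  | skip =>
    exact ⟨_, _, Exec.instr _ _, hs.trans (Upto.setN_right le_rfl s 0), by simp [size, depth]⟩
  | setN x e =>
    simp only [ok, Bool.and_eq_true, decide_eq_true_eq] at hok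
    obtain ⟨s₁, h₁, u₁, v₁⟩ := e.exec hok.2 100 le_rfl s
    refine ⟨_, _, Exec.seq h₁ (Exec.seq (Exec.instr _ _) (Exec.instr _ _)), ?_,
      by simp [size, depth]⟩
    have := ((hs.trans u₁).trans
      (Upto.setN_right (show 100 ≤ 101 by omega) s₁ 0)).setN x (e.eval s₀)
    simpa [run, Instr.eval, State.setN, v₁, NExp.eval_congr hs e hok.2] using this
  | setR x e =>
    simp only [ok, Bool.and_eq_true, decide_eq_true_eq] at hok
    obtain ⟨s₁, h₁, u₁, v₁⟩ := e.exec hok.2 100 le_rfl s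
    refine ⟨_, _, Exec.seq h₁ (Exec.seq (Exec.instr _ _) (Exec.instr _ _)), ?_,
      by simp [size, depth]⟩
    have := ((hs.trans u₁).trans
      (Upto.setR_right (show 100 ≤ 101 by omega) s₁ ((0 : ℚ) : ℝ))).setR x (e.eval s₀)
    simpa [run, Instr.eval, State.setR, v₁, RExp.eval_congr hs e hok.2] using this
  | stN a e =>
    simp only [ok, Bool.and_eq_true] at hok
    obtain ⟨s₁, h₁, u₁, v₁⟩ := a.exec hok.1 100 le_rfl s
    obtain ⟨s₂, h₂, u₂, v₂⟩ := e.exec hok.2 101 (by omega) s₁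
    refine ⟨_, _, Exec.seq h₁ (Exec.seq h₂ (Exec.instr _ _)), ?_, by simp [size, depth]⟩
    have u := (hs.trans u₁).trans (u₂.mono (by omega))
    refine ⟨u.n, u.r, ?_, u.mr⟩
    simp [run, Instr.eval, v₂, ← u₂.n 100 (by omega), v₁, NExp.eval_congr hs a hok.1,
      NExp.eval_congr (hs.trans u₁) e hok.2, u.mn]
  | stR a e =>
    simp only [ok, Bool.and_eq_true] at hok
    obtain ⟨s₁, h₁, u₁, v₁⟩ := a.exec hok.1 100 le_rfl s
    obtain ⟨s₂, h₂, u₂, v₂⟩ := e.exec hok.2 101 (by omega) s₁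
    refine ⟨_, _, Exec.seq h₁ (Exec.seq h₂ (Exec.instr _ _)), ?_, by simp [size, depth]⟩
    have u := (hs.trans u₁).trans (u₂.mono (by omega))
    refine ⟨u.n, u.r, u.mn, ?_⟩
    simp [run, Instr.eval, v₂, ← u₂.n 100 (by omega), v₁, NExp.eval_congr hs a hok.1,
      RExp.eval_congr (hs.trans u₁) e hok.2, u.mr]
  | seq A B ihA ihB =>
    simp only [ok, Bool.and_eq_true] at hok
    simp only [bounds, writesN, List.mem_append, not_or] at hst hM
    obtain ⟨s₁, t₁, h₁, u₁, b₁⟩ := ihA hok.1 s₀ s hs (fun r hr => (hst r (.inl hr)).1)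
      fun r hr => hM r (.inl hr)
    obtain ⟨s₂, t₂, h₂, u₂, b₂⟩ := ihB hok.2 (A.run s₀) s₁ u₁ (fun r hr => (hst r (.inr hr)).2)
      fun r hr => by
        rw [(A.run_frame s₀).n r (hst r (.inr hr)).1]
        exact hM r (.inr hr)
    refine ⟨s₂, _, Exec.seq h₁ h₂, u₂, ?_⟩
    have e₁ := Nat.pow_le_pow_right (show 0 < M + 2 by omega) (le_max_left A.depth B.depth)
    have e₂ := Nat.pow_le_pow_right (show 0 < M + 2 by omega) (le_max_right A.depth B.depth)
    simp only [size, depth, add_mul]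
    exact add_le_add (b₁.trans (Nat.mul_le_mul_left _ e₁)) (b₂.trans (Nat.mul_le_mul_left _ e₂))
  | ite b A B ihA ihB =>
    simp only [ok, Bool.and_eq_true] at hok
    simp only [bounds, writesN, List.mem_append, not_or] at hst hM
    obtain ⟨s₁, u, t₀, ht₀, h⟩ := b.exec hok.1 A.code B.code s
    have e₁ := Nat.pow_le_pow_right (show 0 < M + 2 by omega) (le_max_left A.depth B.depth)
    have e₂ := Nat.pow_le_pow_right (show 0 < M + 2 by omega) (le_max_right A.depth B.depth)
    have e₃ : 1 ≤ (M + 2) ^ max A.depth B.depth := Nat.one_le_pow _ _ (by omega)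
    have e₄ : b.size ≤ b.size * (M + 2) ^ max A.depth B.depth := Nat.le_mul_of_pos_right _ e₃
    by_cases hb : b.Holds s₀
    · obtain ⟨s₂, t₂, h₂, u₂, b₂⟩ := ihA hok.2.1 s₀ s₁ (hs.trans u)
        (fun r hr => (hst r (.inl hr)).1) fun r hr => hM r (.inl hr)
      refine ⟨s₂, _, h s₂ t₂ (fun _ => h₂) fun hn => absurd ((b.holds_congr hs hok.1).1 hb) hn,
        by simpa [run, hb] using u₂, ?_⟩
      simp only [size, depth, add_mul]
      have := b₂.trans (Nat.mul_le_mul_left _ e₁)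
      omega
    · obtain ⟨s₂, t₂, h₂, u₂, b₂⟩ := ihB hok.2.2 s₀ s₁ (hs.trans u)
        (fun r hr => (hst r (.inr hr)).2) fun r hr => hM r (.inr hr)
      refine ⟨s₂, _, h s₂ t₂ (fun hn => absurd ((b.holds_congr hs hok.1).2 hn) hb) fun _ => h₂,
        by simpa [run, hb] using u₂, ?_⟩
      simp only [size, depth, add_mul]
      have := b₂.trans (Nat.mul_le_mul_left _ e₂)
      omega
  | loop i r A ih =>
    simp only [ok, Bool.and_eq_true, decide_eq_true_eq, Bool.not_eq_true', List.contains_eq_mem,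
      decide_eq_false_iff_not] at hok
    obtain ⟨hi, hr, hir, hiA, hA⟩ := hok
    simp only [bounds, writesN, List.mem_cons, not_or] at hst hM
    have hrA := (hst r (.inl rfl)).2
    have hrM := hM r (.inl rfl)
    set N := s₀.natReg r with hN
    set T := A.size * (M + 2) ^ A.depth with hT
    let it : ℕ → State := fun j => Nat.rec (motive := fun _ => State) (s₀.setN i 0)
      (fun j st => (A.run st).setN i (j + 1)) j
    have hit : ∀ j, (loop i r A).Frame s₀ (it j) := by
      intro j
      induction j with
      | zero =>
        refine ⟨fun x hx => ?_, fun _ _ => rfl, fun _ => rfl, fun _ => rfl⟩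
        simp only [writesN, List.mem_cons, not_or] at hx
        simp [it, State.setN, hx.1]
      | succ j ihj => exact ihj.trans_setN _
    have hitr : ∀ j, (it j).natReg r = N := fun j => (hit j).n r (by
      simp only [writesN, List.mem_cons, not_or]; exact ⟨Ne.symm hir, hrA⟩)
    have hiti : ∀ j, (it j).natReg i = j := by
      intro j
      cases j <;> simp [it, State.setN]
    -- Induction on the number `d` of remaining rounds. A round costs at most `T` for the body, one
    -- step for the test and two for the increment; the failing test at the end costs one more.
    have main : ∀ d j s, j + d = N → Upto 100 (it j) s → ∃ s' t, Exec (.loop (.natLt i r)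
        (.seq A.code (.seq (.instr (.natConst 100 1)) (.instr (.natAdd i i 100))))) s s' t ∧
        Upto 100 (it N) s' ∧ t ≤ d * (T + 3) + 1 := by
      intro d
      induction d with
      | zero =>
        intro j s hj hs
        obtain rfl : j = N := by omega
        refine ⟨s, 1, Exec.loopDone ?_, hs, by omega⟩
        simp [Test.Holds, ← hs.n i hi, ← hs.n r hr, hitr, hiti]
      | succ d ihd =>
        intro j s hj hs
        obtain ⟨s₁, t₁, h₁, u₁, b₁⟩ := ih hA (it j) s hs (fun r hr => (hst r (.inr hr)).2)
          fun r' hr' => by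
            rw [(hit j).n r' (by simp only [writesN, List.mem_cons, not_or]; exact hst r' (.inr hr'))]
            exact hM r' (.inr hr')
        have u₂ : Upto 100 (it (j + 1)) ((s₁.setN 100 1).setN i (j + 1)) :=
          (u₁.trans (Upto.setN_right le_rfl s₁ 1)).setN i (j + 1)
        obtain ⟨s₃, t₃, h₃, u₃, b₃⟩ := ihd (j + 1) _ (by omega) u₂
        refine ⟨s₃, t₁ + (1 + 1) + t₃ + 1, Exec.loopStep ?_
          (Exec.seq h₁ (Exec.seq (Exec.instr _ _) (Exec.instr _ _))) ?_, u₃, ?_⟩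
        · simp [Test.Holds, ← hs.n i hi, ← hs.n r hr, hitr, hiti]
          omega
        · convert h₃ using 1
          have hv : s₁.natReg i = j := by
            rw [← u₁.n i hi, (A.run_frame (it j)).n i hiA, hiti]
          simp [Instr.eval, State.setN, hv, Function.update_of_ne (show i ≠ 100 by omega)]
        · rw [add_mul]
          omega
    obtain ⟨s', t, h, u, b⟩ := main N 0 (s.setN i 0) (by omega) (hs.setN i 0)
    refine ⟨s', _, Exec.seq (Exec.instr _ _) h, u, ?_⟩
    simp only [size, depth, pow_succ]
    have e₁ : 1 ≤ (M + 2) ^ A.depth := Nat.one_le_pow _ _ (by omega)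
    have e₂ : N * (T + 3) ≤ M * (T + 3) := Nat.mul_le_mul_right _ hrM
    have e₃ : M * (T + 3) + 2 ≤ (T + 3 * (M + 2) ^ A.depth) * (M + 2) := by nlinarith
    have e₄ : (A.size + 3) * ((M + 2) ^ A.depth * (M + 2)) =
        (T + 3 * (M + 2) ^ A.depth) * (M + 2) := by rw [hT]; ring
    rw [e₄]
    omega

end Stmt

end DeltaTour

/-! ## The metric of the graph -/

namespace DeltaTour

section Metric

variable {V : Type*} [DecidableEq V]

theorem edgePt_left {u v : V} (h : u ≠ v) (a : ℝ) : edgePt u v a u = 1 - a := by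
  simp [edgePt, vertexPt, h]

theorem edgePt_right {u v : V} (h : u ≠ v) (a : ℝ) : edgePt u v a v = a := by
  simp [edgePt, vertexPt, h.symm]

theorem edgePt_other {u v w : V} (hu : w ≠ u) (hv : w ≠ v) (a : ℝ) : edgePt u v a w = 0 := by
  simp [edgePt, vertexPt, hu, hv]

theorem edgePt_self (u : V) (a : ℝ) : edgePt u u a = vertexPt u := by
  rw [edgePt, ← add_smul]; simp

theorem vertexPt_self (u : V) : vertexPt u u = 1 := by simp [vertexPt]

theorem vertexPt_ne_zero {u w : V} (h : vertexPt u w ≠ 0) : w = u := by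
  by_contra hne
  exact h (by simp [vertexPt, hne])

theorem vertexPt_mem (G : SimpleGraph V) (u : V) : vertexPt u ∈ points G := .inl ⟨u, rfl⟩

theorem edgePt_mem {G : SimpleGraph V} {u v : V} (h : G.Adj u v) {a : ℝ}
    (ha : a ∈ Set.Icc (0 : ℝ) 1) : edgePt u v a ∈ points G := .inr ⟨u, v, a, h, ha, rfl⟩

theorem SameEdge.symm {G : SimpleGraph V} {p q : V → ℝ} (h : SameEdge G p q) :
    SameEdge G q p := by
  obtain ⟨u, v, a, b, h, ha, hb, rfl, rfl⟩ := h
  exact ⟨u, v, b, a, h, hb, ha, rfl, rfl⟩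

theorem SameEdge.left_mem {G : SimpleGraph V} {p q : V → ℝ} (h : SameEdge G p q) :
    p ∈ points G := by
  obtain ⟨u, v, a, b, h, ha, hb, rfl, rfl⟩ := h
  exact edgePt_mem h ha

/-- A point near a vertex `u` is `u` or lies on an edge at `u`. -/
theorem eq_or_edgePt_of_ne_zero {G : SimpleGraph V} {p : V → ℝ} (hp : p ∈ points G) {u : V}
    (hu : p u ≠ 0) : p = vertexPt u ∨
      ∃ v a, G.Adj u v ∧ a ∈ Set.Icc (0 : ℝ) 1 ∧ p = edgePt u v a := by
  obtain ⟨w, rfl⟩ | ⟨w, z, a, h, ha, rfl⟩ := hp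
  · exact .inl (by rw [vertexPt_ne_zero hu])
  · right
    by_cases huw : u = w
    · exact ⟨z, a, huw ▸ h, ha, by rw [huw]⟩
    · have huz : u = z := by
        by_contra hne
        exact hu (edgePt_other huw hne a)
      subst huz
      exact ⟨w, 1 - a, h.symm, ⟨by linarith [ha.2], by linarith [ha.1]⟩, (edgePt_swap w u a).symm⟩

/-- An edge that contains an interior point of `uv` is `uv`. -/
theorem SameEdge.exists_of_ne_zero {G : SimpleGraph V} {p q : V → ℝ} (h : SameEdge G p q)
    {u v : V} (huv : u ≠ v) (hu : q u ≠ 0) (hv : q v ≠ 0) :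
    G.Adj u v ∧ ∃ a ∈ Set.Icc (0 : ℝ) 1, p = edgePt u v a := by
  obtain ⟨w, z, a, b, h, ha, hb, rfl, rfl⟩ := h
  have key : ∀ x, edgePt w z b x ≠ 0 → x = w ∨ x = z := by
    intro x hx
    by_contra! hne
    exact hx (edgePt_other hne.1 hne.2 b)
  rcases key u hu with rfl | rfl <;> rcases key v hv with rfl | rfl
  · exact absurd rfl huv
  · exact ⟨h, a, ha, rfl⟩
  · exact ⟨h.symm, 1 - a, ⟨by linarith [ha.2], by linarith [ha.1]⟩, (edgePt_swap _ _ a).symm⟩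
  · exact absurd rfl huv

theorem exists_ne_zero {G : SimpleGraph V} {p : V → ℝ} (hp : p ∈ points G) : ∃ u, p u ≠ 0 := by
  obtain ⟨u, rfl⟩ | ⟨u, v, a, h, ha, rfl⟩ := hp
  · exact ⟨u, by simp [vertexPt_self]⟩
  · by_cases h0 : a = 0
    · exact ⟨u, by simp [edgePt_left h.ne, h0]⟩
    · exact ⟨v, by simpa [edgePt_right h.ne] using h0⟩

variable [Fintype V]

/-- There is a walk from `p` to `q` of the given length; here consecutive points may be equal. -/
inductive Conn (G : SimpleGraph V) : (V → ℝ) → (V → ℝ) → ℝ → Prop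
  | refl {p : V → ℝ} : p ∈ points G → Conn G p p 0
  | step {p q r : V → ℝ} {l : ℝ} : SameEdge G p q → Conn G q r l → Conn G p r (dist p q + l)

namespace Conn

variable {G : SimpleGraph V} {p q r : V → ℝ} {l l' : ℝ}

theorem nonneg (h : Conn G p q l) : 0 ≤ l := by
  induction h with
  | refl => exact le_rfl
  | step _ _ ih => positivity

theorem single (h : SameEdge G p q) : Conn G p q (dist p q) := by
  simpa using Conn.step h (Conn.refl h.symm.left_mem)

theorem trans (h : Conn G p q l) (h' : Conn G q r l') : Conn G p r (l + l') := by
  induction h with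
  | refl => simpa using h'
  | step hs _ ih => rw [add_assoc]; exact Conn.step hs (ih h')

theorem symm (h : Conn G p q l) : Conn G q p l := by
  induction h with
  | refl h => exact Conn.refl h
  | step hs _ ih => rw [add_comm, dist_comm]; exact ih.trans (single hs.symm)

theorem of_walk {T : List (V → ℝ)} (h : IsWalkFromTo G p q T) : Conn G p q (len T) := by
  induction T generalizing p with
  | nil => exact absurd rfl h.1.1
  | cons x T ih =>
    obtain ⟨⟨_, hm, hc⟩, hh, hl⟩ := h
    obtain rfl : x = p := by simpa using hh
    cases T with
    | nil =>
      obtain rfl : x = q := by simpa using hl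
      exact Conn.refl (hm x (by simp))
    | cons y T =>
      rw [List.isChain_cons_cons] at hc
      exact Conn.step hc.1.2 (ih ⟨⟨by simp, fun p hp => hm p (List.mem_cons_of_mem _ hp), hc.2⟩,
        by simp, by simpa using hl⟩)

/-- Steps between equal points have length `0` and are dropped. -/
theorem exists_walk (h : Conn G p q l) : ∃ T, IsWalkFromTo G p q T ∧ len T = l := by
  induction h with
  | refl h => exact ⟨[_], ⟨⟨by simp, by simpa using h, by simp⟩, by simp, by simp⟩, rfl⟩
  | @step p q r l hs _ ih =>
    obtain ⟨T, hT, hl⟩ := ih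
    by_cases hpq : p = q
    · subst hpq
      exact ⟨T, hT, by simp [hl]⟩
    · cases T with
      | nil => exact absurd rfl hT.1.1
      | cons y T =>
        obtain ⟨⟨_, hm, hc⟩, hh, hr⟩ := hT
        obtain rfl : y = q := by simpa using hh
        refine ⟨p :: y :: T, ⟨⟨by simp, ?_, ?_⟩, by simp, by simpa using hr⟩, by simp [len, hl]⟩
        · intro x hx
          rcases List.mem_cons.1 hx with rfl | hx
          exacts [hs.left_mem, hm x hx]
        · exact List.isChain_cons_cons.2 ⟨⟨hpq, hs⟩, hc⟩

theorem of_vertex_walk {u v : V} (w : G.Walk u v) :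
    Conn G (vertexPt u) (vertexPt v) (w.length : ℝ) := by
  induction w with
  | nil => simpa using Conn.refl (vertexPt_mem G _)
  | @cons u v w h _ ih =>
    have hs : SameEdge G (vertexPt u) (vertexPt v) :=
      ⟨u, v, 0, 1, h, by simp, by simp, (edgePt_zero u v).symm, (edgePt_one u v).symm⟩
    have hd : dist (vertexPt u) (vertexPt v) = 1 := by
      rw [← edgePt_zero u v, ← edgePt_one u v, dist_edgePt h.ne]; simp
    have := Conn.step hs ih
    rw [hd] at this
    simpa [add_comm] using this

theorem vertex (hG : G.Connected) (u v : V) :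
    Conn G (vertexPt u) (vertexPt v) (G.dist u v : ℝ) := by
  obtain ⟨w, hw⟩ := hG.exists_walk_length_eq_dist u v
  exact hw ▸ of_vertex_walk w

theorem to_vertex (hp : p ∈ points G) {u : V} (hu : p u ≠ 0) :
    Conn G p (vertexPt u) (1 - p u) := by
  obtain rfl | ⟨v, a, h, ha, rfl⟩ := eq_or_edgePt_of_ne_zero hp hu
  · simpa [vertexPt_self] using Conn.refl hp
  · have hs : SameEdge G (edgePt u v a) (vertexPt u) :=
      ⟨u, v, a, 0, h, ha, by simp, rfl, (edgePt_zero u v).symm⟩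
    have := single hs
    rw [← edgePt_zero u v, dist_edgePt h.ne] at this
    simpa [edgePt_left h.ne, abs_of_nonneg ha.1, edgePt_zero] using this

end Conn

/-- The value `t` is the length of a direct route from `p` to `q`, or of one via vertices. -/
def Route (G : SimpleGraph V) (p q : V → ℝ) (t : ℝ) : Prop :=
  (∃ u u', p u ≠ 0 ∧ q u' ≠ 0 ∧ t = (1 - p u) + G.dist u u' + (1 - q u')) ∨
    (SameEdge G p q ∧ t = dist p q)

theorem Route.conn {G : SimpleGraph V} (hG : G.Connected) {p q : V → ℝ} (hp : p ∈ points G)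
    (hq : q ∈ points G) {t : ℝ} (h : Route G p q t) : Conn G p q t := by
  obtain ⟨u, u', hu, hu', rfl⟩ | ⟨h, rfl⟩ := h
  · exact ((Conn.to_vertex hp hu).trans (Conn.vertex hG u u')).trans (Conn.to_vertex hq hu').symm
  · exact Conn.single h

/-- If `p` has a nonzero coordinate at `u`, then `u` itself serves, since a single coordinate
changes by at most the supremum distance. Otherwise `p` is the opposite end of the edge, and both
sides are equal to `1`. -/
theorem SameEdge.exists_vertex_le {G : SimpleGraph V} {p q : V → ℝ} (hpq : SameEdge G p q) {u : V}
    (hu : q u ≠ 0) : ∃ u', p u' ≠ 0 ∧ (1 - p u') + G.dist u' u ≤ dist p q + (1 - q u) := by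
  by_cases hp : p u = 0
  · obtain ⟨v, a, b, h, ha, hb, rfl, rfl⟩ :
        ∃ v a b, G.Adj u v ∧ a ∈ Set.Icc (0 : ℝ) 1 ∧ b ∈ Set.Icc (0 : ℝ) 1 ∧
          p = edgePt u v a ∧ q = edgePt u v b := by
      obtain ⟨w, z, a, b, h, ha, hb, rfl, rfl⟩ := hpq
      by_cases huw : u = w
      · subst huw
        exact ⟨z, a, b, h, ha, hb, rfl, rfl⟩
      · have huz : u = z := by
          by_contra hne
          exact hu (edgePt_other huw hne b)
        subst huz
        exact ⟨w, 1 - a, 1 - b, h.symm, ⟨by linarith [ha.2], by linarith [ha.1]⟩,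
          ⟨by linarith [hb.2], by linarith [hb.1]⟩, (edgePt_swap _ _ a).symm,
          (edgePt_swap _ _ b).symm⟩
    rw [edgePt_left h.ne] at hp
    obtain rfl : a = 1 := by linarith
    refine ⟨v, by simp [edgePt_right h.ne], ?_⟩
    rw [edgePt_right h.ne, edgePt_left h.ne, dist_edgePt h.ne, SimpleGraph.dist_comm,
      SimpleGraph.dist_eq_one_iff_adj.2 h, abs_of_nonpos (by linarith [hb.2])]
    simp
  · refine ⟨u, hp, ?_⟩
    have := dist_le_pi_dist p q u
    rw [Real.dist_eq] at this
    have := neg_abs_le (p u - q u)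
    simp only [SimpleGraph.dist_self, Nat.cast_zero]
    linarith

/-- Routes are a normal form for walks, and this is the induction step that reaches it. A route via
vertices absorbs the new step by the preceding lemma. For a direct route from `q`, either `q` is a
vertex, and both pieces are rerouted via vertices, or `q` is interior to an edge, which then
contains all three points, and the triangle inequality on this edge suffices. -/
theorem Route.prepend {G : SimpleGraph V} (hG : G.Connected) {p q r : V → ℝ} {t : ℝ}
    (hpq : SameEdge G p q) (h : Route G q r t) : ∃ t', Route G p r t' ∧ t' ≤ dist p q + t := by
  obtain ⟨u, u', hu, hu', rfl⟩ | ⟨hqr, rfl⟩ := h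
  · obtain ⟨w, hw, hle⟩ := hpq.exists_vertex_le hu
    refine ⟨_, .inl ⟨w, u', hw, hu', rfl⟩, ?_⟩
    have : (G.dist w u' : ℝ) ≤ G.dist w u + G.dist u u' := by exact_mod_cast hG.dist_triangle
    linarith
  · by_cases hv : ∃ u, q = vertexPt u
    · obtain ⟨u, rfl⟩ := hv
      obtain ⟨w, hw, hle⟩ := hpq.exists_vertex_le (u := u) (by simp [vertexPt_self])
      obtain ⟨z, hz, hle'⟩ := hqr.symm.exists_vertex_le (u := u) (by simp [vertexPt_self])
      refine ⟨_, .inl ⟨w, z, hw, hz, rfl⟩, ?_⟩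
      have : (G.dist w z : ℝ) ≤ G.dist w u + G.dist z u := by
        rw [G.dist_comm (u := z)]
        exact_mod_cast hG.dist_triangle
      rw [vertexPt_self] at hle hle'
      rw [dist_comm (vertexPt u) r]
      linarith
    · obtain ⟨u, v, b, c, h, hb, hc, hqe, hre⟩ := hqr
      have hb0 : b ≠ 0 := fun h0 => hv ⟨u, by rw [hqe, h0, edgePt_zero]⟩
      have hb1 : 1 - b ≠ 0 := fun h0 => hv ⟨v, by
        rw [hqe, show b = 1 by linarith, edgePt_one]⟩
      obtain ⟨_, a, ha, rfl⟩ := hpq.exists_of_ne_zero h.ne (by rwa [hqe, edgePt_left h.ne])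
        (by rwa [hqe, edgePt_right h.ne])
      refine ⟨_, .inr ⟨⟨u, v, a, c, h, ha, hc, rfl, hre⟩, rfl⟩, dist_triangle _ _ _⟩

theorem Conn.exists_route {G : SimpleGraph V} (hG : G.Connected) {p q : V → ℝ} {l : ℝ}
    (h : Conn G p q l) : ∃ t, Route G p q t ∧ t ≤ l := by
  induction h with
  | @refl p hp =>
    obtain ⟨u, rfl⟩ | ⟨u, v, a, h, ha, rfl⟩ := hp
    · refine ⟨_, .inl ⟨u, u, ?_, ?_, rfl⟩, ?_⟩ <;> simp [vertexPt_self]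
    · exact ⟨_, .inr ⟨⟨u, v, a, a, h, ha, ha, rfl, rfl⟩, rfl⟩, by simp⟩
  | step hs _ ih =>
    obtain ⟨t, ht, hle⟩ := ih
    obtain ⟨t', ht', hle'⟩ := ht.prepend hG hs
    exact ⟨t', ht', by linarith⟩

/-- The distance of two points, as a real number. -/
noncomputable def pd (G : SimpleGraph V) (p q : V → ℝ) : ℝ := sInf {l | Conn G p q l}

theorem pd_le {G : SimpleGraph V} {p q : V → ℝ} {l : ℝ} (h : Conn G p q l) : pd G p q ≤ l :=
  csInf_le ⟨0, fun _ h => h.nonneg⟩ h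

/-- Routes between two given points have only finitely many lengths. The least one bounds all walks
from below by `Conn.exists_route`, so the infimum is attained by a route. -/
theorem route_pd {G : SimpleGraph V} (hG : G.Connected) {p q : V → ℝ} (hp : p ∈ points G)
    (hq : q ∈ points G) : Route G p q (pd G p q) := by
  have hfin : {t | Route G p q t}.Finite := by
    refine ((Set.finite_range fun x : V × V =>
      (1 - p x.1) + G.dist x.1 x.2 + (1 - q x.2)).union (Set.finite_singleton (dist p q))).subset ?_
    rintro t (⟨u, u', _, _, rfl⟩ | ⟨_, rfl⟩)
    · exact .inl ⟨(u, u'), rfl⟩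
    · exact .inr rfl
  have hne : {t | Route G p q t}.Nonempty := by
    obtain ⟨u, hu⟩ := exists_ne_zero hp
    obtain ⟨v, hv⟩ := exists_ne_zero hq
    exact ⟨_, .inl ⟨u, v, hu, hv, rfl⟩⟩
  obtain ⟨t, ht, hmin⟩ := Set.exists_min_image _ id hfin hne
  have : IsLeast {l | Conn G p q l} t := by
    refine ⟨Route.conn hG hp hq ht, fun l hl => ?_⟩
    obtain ⟨t', ht', hle⟩ := hl.exists_route hG
    exact (hmin t' ht').trans hle
  rw [pd, this.csInf_eq]
  exact ht

theorem conn_pd {G : SimpleGraph V} (hG : G.Connected) {p q : V → ℝ} (hp : p ∈ points G)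
    (hq : q ∈ points G) : Conn G p q (pd G p q) := Route.conn hG hp hq (route_pd hG hp hq)

theorem pd_nonneg {G : SimpleGraph V} (p q : V → ℝ) : 0 ≤ pd G p q :=
  Real.sInf_nonneg fun _ h => h.nonneg

theorem pd_comm (G : SimpleGraph V) (p q : V → ℝ) : pd G p q = pd G q p := by
  have : {l | Conn G p q l} = {l | Conn G q p l} := Set.ext fun _ => ⟨Conn.symm, Conn.symm⟩
  rw [pd, this, pd]

theorem pd_self {G : SimpleGraph V} {p : V → ℝ} (hp : p ∈ points G) : pd G p p = 0 :=
  le_antisymm (pd_le (Conn.refl hp)) (pd_nonneg p p)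

theorem pd_triangle {G : SimpleGraph V} (hG : G.Connected) {p q r : V → ℝ} (hp : p ∈ points G)
    (hq : q ∈ points G) (hr : r ∈ points G) : pd G p r ≤ pd G p q + pd G q r :=
  pd_le ((conn_pd hG hp hq).trans (conn_pd hG hq hr))

theorem pd_le_dist {G : SimpleGraph V} {p q : V → ℝ} (h : SameEdge G p q) :
    pd G p q ≤ dist p q := pd_le (Conn.single h)

theorem ptDist_eq {G : SimpleGraph V} (hG : G.Connected) {p q : V → ℝ} (hp : p ∈ points G)
    (hq : q ∈ points G) : ptDist G p q = ENNReal.ofReal (pd G p q) := by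
  apply le_antisymm
  · obtain ⟨T, hT, hl⟩ := (conn_pd hG hp hq).exists_walk
    rw [← hl]
    exact iInf₂_le T hT
  · exact le_iInf₂ fun T hT => ENNReal.ofReal_le_ofReal (pd_le (Conn.of_walk hT))

end Metric

/-- A triple `(u, v, a)` describing a point. -/
structure Tri (n : ℕ) where
  u : Fin n
  v : Fin n
  a : ℝ

namespace Tri

variable {n : ℕ} (G : SimpleGraph (Fin n))

/-- The point described by a triple. -/
noncomputable def pt (t : Tri n) : Fin n → ℝ := edgePt t.u t.v t.a

/-- The triple describes a vertex as `(u, u, 0)`, or a point of an edge `uv` with `u < v`. -/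
def Weak (t : Tri n) : Prop :=
  (G.Adj t.u t.v ∧ t.u < t.v ∧ 0 ≤ t.a ∧ t.a ≤ 1) ∨ (t.u = t.v ∧ t.a = 0)

/-- The triple describes a vertex as `(u, u, 0)`, or an interior point of an edge `uv`
with `u < v`. -/
def Canon (t : Tri n) : Prop :=
  (G.Adj t.u t.v ∧ t.u < t.v ∧ 0 < t.a ∧ t.a < 1) ∨ (t.u = t.v ∧ t.a = 0)

variable {G}

theorem Canon.weak {t : Tri n} (h : t.Canon G) : t.Weak G :=
  h.imp (fun h => ⟨h.1, h.2.1, h.2.2.1.le, h.2.2.2.le⟩) id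

theorem Weak.pt_mem {t : Tri n} (h : t.Weak G) : t.pt ∈ points G := by
  rcases h with h | h
  · exact edgePt_mem h.1 h.2.2
  · rw [pt, h.1, edgePt_self]
    exact vertexPt_mem G _

theorem Weak.nonneg {t : Tri n} (h : t.Weak G) : 0 ≤ t.a := by
  rcases h with h | h
  exacts [h.2.2.1, h.2.ge]

theorem Weak.le_one {t : Tri n} (h : t.Weak G) : t.a ≤ 1 := by
  rcases h with h | h
  exacts [h.2.2.2, by rw [h.2]; exact zero_le_one]

theorem Weak.coord {t : Tri n} (h : t.Weak G) {u : Fin n} (hu : t.pt u ≠ 0) :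
    (u = t.u ∧ 1 - t.pt u = t.a) ∨ (u = t.v ∧ 1 - t.pt u = 1 - t.a) := by
  rcases h with h | h
  · by_cases h1 : u = t.u
    · left
      subst h1
      simp [pt, edgePt_left h.1.ne]
    · by_cases h2 : u = t.v
      · right
        subst h2
        simp [pt, edgePt_right h.1.ne]
      · exact absurd (edgePt_other h1 h2 _) hu
  · rw [pt, ← h.1, edgePt_self] at hu ⊢
    obtain rfl := vertexPt_ne_zero hu
    simp [vertexPt_self, h.2]

theorem Weak.conn_u {t : Tri n} (h : t.Weak G) : pd G t.pt (vertexPt t.u) ≤ t.a := by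
  rcases h with h | h
  · have := pd_le_dist (G := G) (p := t.pt) (q := vertexPt t.u)
      ⟨t.u, t.v, t.a, 0, h.1, h.2.2, by simp, rfl, (edgePt_zero _ _).symm⟩
    rw [pt, ← edgePt_zero t.u t.v, dist_edgePt h.1.ne] at this
    simpa [abs_of_nonneg h.2.2.1, pt, edgePt_zero] using this
  · rw [pt, ← h.1, edgePt_self, h.2, pd_self (vertexPt_mem G _)]

theorem Weak.conn_v {t : Tri n} (h : t.Weak G) : pd G t.pt (vertexPt t.v) ≤ 1 - t.a := by
  rcases h with h | h
  · have := pd_le_dist (G := G) (p := t.pt) (q := vertexPt t.v)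
      ⟨t.u, t.v, t.a, 1, h.1, h.2.2, by simp, rfl, (edgePt_one _ _).symm⟩
    rw [pt, ← edgePt_one t.u t.v, dist_edgePt h.1.ne, abs_of_nonneg (by linarith [h.2.2.2])] at this
    simpa [pt, edgePt_one] using this
  · rw [pt, ← h.1, edgePt_self, h.2, pd_self (vertexPt_mem G _)]
    simp

/-- A weak triple with a vertex as its point, or an interior one. -/
theorem Weak.vertex_or {t : Tri n} (h : t.Weak G) : (∃ w, t.pt = vertexPt w) ∨
    (G.Adj t.u t.v ∧ t.u < t.v ∧ t.pt t.u ≠ 0 ∧ t.pt t.v ≠ 0) := by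
  rcases h with h | h
  · by_cases h0 : t.a = 0
    · exact .inl ⟨t.u, by rw [pt, h0, edgePt_zero]⟩
    · by_cases h1 : t.a = 1
      · exact .inl ⟨t.v, by rw [pt, h1, edgePt_one]⟩
      · refine .inr ⟨h.1, h.2.1, ?_, ?_⟩
        · rw [pt, edgePt_left h.1.ne]
          exact fun h => h1 (by linarith)
        · rwa [pt, edgePt_right h.1.ne]
  · exact .inl ⟨t.u, by rw [pt, ← h.1, edgePt_self]⟩

end Tri

/-! ### An explicit formula for the distance of two points. -/

variable {n : ℕ}

/-- The distance of a vertex and a point. -/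
noncomputable def vd (G : SimpleGraph (Fin n)) (x : Fin n) (t : Tri n) : ℝ :=
  min (t.a + G.dist t.u x) (1 - t.a + G.dist t.v x)

/-- The least length of a route between two points via vertices. -/
noncomputable def rd (G : SimpleGraph (Fin n)) (s t : Tri n) : ℝ :=
  min (s.a + vd G s.u t) (1 - s.a + vd G s.v t)

open Classical in
/-- The distance of two points. -/
noncomputable def td (G : SimpleGraph (Fin n)) (s t : Tri n) : ℝ :=
  if s.u = t.u ∧ s.v = t.v then min (rd G s t) |t.a - s.a| else rd G s t

theorem td_le_rd (G : SimpleGraph (Fin n)) (s t : Tri n) : td G s t ≤ rd G s t := by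
  unfold td
  split_ifs
  exacts [min_le_left _ _, le_rfl]

theorem pd_pt_le_vd {G : SimpleGraph (Fin n)} (hG : G.Connected) (x : Fin n) {t : Tri n}
    (ht : t.Weak G) : pd G (vertexPt x) t.pt ≤ vd G x t := by
  have hx := vertexPt_mem G x
  refine le_min ?_ ?_
  · have h1 := pd_triangle hG ht.pt_mem (vertexPt_mem G t.u) hx
    have h2 := pd_le (Conn.vertex hG t.u x)
    rw [pd_comm]
    linarith [ht.conn_u]
  · have h1 := pd_triangle hG ht.pt_mem (vertexPt_mem G t.v) hx
    have h2 := pd_le (Conn.vertex hG t.v x)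
    rw [pd_comm]
    linarith [ht.conn_v]

theorem pd_pt_le_rd {G : SimpleGraph (Fin n)} (hG : G.Connected) {s t : Tri n}
    (hs : s.Weak G) (ht : t.Weak G) : pd G s.pt t.pt ≤ rd G s t := by
  refine le_min ?_ ?_
  · have h1 := pd_triangle hG hs.pt_mem (vertexPt_mem G s.u) ht.pt_mem
    linarith [hs.conn_u, pd_pt_le_vd hG s.u ht]
  · have h1 := pd_triangle hG hs.pt_mem (vertexPt_mem G s.v) ht.pt_mem
    linarith [hs.conn_v, pd_pt_le_vd hG s.v ht]

theorem rd_le_route {G : SimpleGraph (Fin n)} {s t : Tri n} (hs : s.Weak G) (ht : t.Weak G)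
    {u u' : Fin n} (hu : s.pt u ≠ 0) (hu' : t.pt u' ≠ 0) :
    rd G s t ≤ (1 - s.pt u) + G.dist u u' + (1 - t.pt u') := by
  have h1 : vd G u t ≤ G.dist u u' + (1 - t.pt u') := by
    rw [G.dist_comm]
    rcases ht.coord hu' with ⟨h, e⟩ | ⟨h, e⟩
    · rw [e, h, add_comm]; exact min_le_left _ _
    · rw [e, h, add_comm]; exact min_le_right _ _
  rcases hs.coord hu with ⟨h, e⟩ | ⟨h, e⟩
  · have : rd G s t ≤ s.a + vd G s.u t := min_le_left _ _
    rw [← h] at this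
    linarith
  · have : rd G s t ≤ 1 - s.a + vd G s.v t := min_le_right _ _
    rw [← h] at this
    linarith

theorem dist_pt_of_same {G : SimpleGraph (Fin n)} {s t : Tri n} (hs : s.Weak G) (ht : t.Weak G)
    (h : s.u = t.u ∧ s.v = t.v) :
    dist s.pt t.pt = |t.a - s.a| ∧ (s.pt = t.pt ∨ SameEdge G s.pt t.pt) := by
  rcases hs with hs' | hs'
  · have ht' : G.Adj t.u t.v ∧ t.u < t.v ∧ 0 ≤ t.a ∧ t.a ≤ 1 := by
      rcases ht with ht | ht
      · exact ht
      · exact absurd (h.1.trans (ht.1.trans h.2.symm)) hs'.1.ne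
    refine ⟨?_, .inr ⟨s.u, s.v, s.a, t.a, hs'.1, hs'.2.2, ht'.2.2, rfl, ?_⟩⟩
    · rw [Tri.pt, Tri.pt, h.1, h.2, dist_edgePt ht'.1.ne]
    · rw [Tri.pt, h.1, h.2]
  · have hta : t.a = 0 := by
      rcases ht with ht | ht
      · exact absurd (h.1.symm.trans (hs'.1.trans h.2)) ht.1.ne
      · exact ht.2
    have e : s.pt = t.pt := by rw [Tri.pt, Tri.pt, h.1, h.2, hta, hs'.2]
    exact ⟨by simp [e, hta, hs'.2], .inl e⟩

/-- This is the formula that the program evaluates. A direct step matters only between interior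
points of one edge: if one of the two points is a vertex, a route via this vertex is no longer. -/
theorem pd_pt {G : SimpleGraph (Fin n)} (hG : G.Connected) {s t : Tri n} (hs : s.Weak G)
    (ht : t.Weak G) : pd G s.pt t.pt = td G s t := by
  apply le_antisymm
  · have h1 := pd_pt_le_rd hG hs ht
    unfold td
    split_ifs with h
    · obtain ⟨h2, h3⟩ := dist_pt_of_same hs ht h
      refine le_min h1 ?_
      rw [← h2]
      rcases h3 with h3 | h3
      · rw [h3, pd_self ht.pt_mem, dist_self]
      · exact pd_le_dist h3
    · exact h1
  · obtain ⟨u, u', hu, hu', h⟩ | ⟨h, he⟩ := route_pd hG hs.pt_mem ht.pt_mem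
    · rw [h]
      exact (td_le_rd G s t).trans (rd_le_route hs ht hu hu')
    · rw [he]
      rcases ht.vertex_or with ⟨w, hw⟩ | ⟨h1, h2, h3, h4⟩
      · have hw' : t.pt w = 1 := by rw [hw, vertexPt_self]
        obtain ⟨u, hu, hle⟩ := h.exists_vertex_le (u := w) (by simp [hw'])
        have := rd_le_route hs ht hu (u' := w) (by simp [hw'])
        linarith [td_le_rd G s t]
      · rcases hs.vertex_or with ⟨w, hw⟩ | ⟨h1', h2', h3', h4'⟩
        · have hw' : s.pt w = 1 := by rw [hw, vertexPt_self]
          obtain ⟨u, hu, hle⟩ := h.symm.exists_vertex_le (u := w) (by simp [hw'])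
          have := rd_le_route hs ht (u := w) (by simp [hw']) hu
          rw [dist_comm]
          rw [G.dist_comm] at this
          linarith [td_le_rd G s t]
        · have hsame : s.u = t.u ∧ s.v = t.v := by
            obtain ⟨_, a, ha, he⟩ := h.exists_of_ne_zero h1.ne h3 h4
            have key : ∀ x, s.pt x ≠ 0 → x = t.u ∨ x = t.v := by
              intro x hx
              by_contra! hne
              exact hx (by rw [he]; exact edgePt_other hne.1 hne.2 a)
            rcases key _ h3' with e1 | e1 <;> rcases key _ h4' with e2 | e2
            · exact absurd (e1.trans e2.symm) h1'.ne
            · exact ⟨e1, e2⟩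
            -- The crossed matching of ends is excluded because both edges are written with the
            -- smaller end as the first one.
            · rw [e1, e2] at h2'
              exact absurd h2 (lt_asymm h2')
            · exact absurd (e1.trans e2.symm) h1'.ne
          rw [td, if_pos hsame, (dist_pt_of_same hs ht hsame).1]
          exact min_le_right _ _

end DeltaTour

/-! ## Replacing a tour by few of its points -/

namespace DeltaTour

section Passed

set_option linter.unusedSectionVars false

variable {V : Type*} [DecidableEq V]

theorem segment_edgePt (u v : V) (a b : ℝ) :
    segment ℝ (edgePt u v a) (edgePt u v b) = edgePt u v '' Set.uIcc a b := by
  have h : ∀ c, edgePt u v c = AffineMap.lineMap (k := ℝ) (vertexPt u) (vertexPt v) c := fun c => by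
    rw [edgePt, AffineMap.lineMap_apply_module]
  rw [h, h, ← image_segment, segment_eq_uIcc]
  exact Set.image_congr fun c _ => (h c).symm

/-- As a convex segment, the piece of an edge no longer depends on the choice of the edge and its
orientation, and convexity and compactness become available. -/
theorem edgeSegment_eq {G : SimpleGraph V} {p q : V → ℝ} (h : SameEdge G p q) :
    edgeSegment G p q = segment ℝ p q := by
  ext x
  constructor
  · rintro ⟨u, v, a, b, m, -, -, -, rfl, rfl, h1, h2, rfl⟩
    rw [segment_edgePt]
    exact ⟨m, ⟨h1, h2⟩, rfl⟩
  · obtain ⟨u, v, a, b, h, ha, hb, rfl, rfl⟩ := h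
    rw [segment_edgePt]
    rintro ⟨m, ⟨h1, h2⟩, rfl⟩
    exact ⟨u, v, a, b, m, h, ha, hb, rfl, rfl, h1, h2, rfl⟩

theorem SameEdge.of_mem_segment {G : SimpleGraph V} {p q x y : V → ℝ} (h : SameEdge G p q)
    (hx : x ∈ segment ℝ p q) (hy : y ∈ segment ℝ p q) : SameEdge G x y := by
  obtain ⟨u, v, a, b, h, ha, hb, rfl, rfl⟩ := h
  rw [segment_edgePt] at hx hy
  obtain ⟨c, hc, rfl⟩ := hx
  obtain ⟨d, hd, rfl⟩ := hy
  have hI : Set.uIcc a b ⊆ Set.Icc 0 1 := Set.OrdConnected.uIcc_subset Set.ordConnected_Icc ha hb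
  exact ⟨u, v, c, d, h, hI hc, hI hd, rfl, rfl⟩

theorem segment_subset_union {p q x : V → ℝ} (hx : x ∈ segment ℝ p q) :
    segment ℝ p q ⊆ segment ℝ p x ∪ segment ℝ x q := by
  rw [segment_eq_image_lineMap] at hx
  obtain ⟨t, ht, rfl⟩ := hx
  intro y hy
  rw [segment_eq_image_lineMap] at hy
  obtain ⟨r, hr, rfl⟩ := hy
  have e0 : segment ℝ p (AffineMap.lineMap p q t) =
      segment ℝ (AffineMap.lineMap (k := ℝ) p q (0 : ℝ)) (AffineMap.lineMap p q t) := by simp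
  have e1 : segment ℝ (AffineMap.lineMap p q t) q =
      segment ℝ (AffineMap.lineMap (k := ℝ) p q t) (AffineMap.lineMap p q (1 : ℝ)) := by simp
  rw [e0, e1, ← image_segment, ← image_segment, segment_eq_uIcc, segment_eq_uIcc]
  rcases le_total r t with hrt | hrt
  · exact .inl ⟨r, ⟨by simp [hr.1, ht.1], by simp [hrt]⟩, rfl⟩
  · exact .inr ⟨r, ⟨by simp [hrt], by simp [hr.2]⟩, rfl⟩

/-- The union of the segments between consecutive points. -/
def segments : List (V → ℝ) → Set (V → ℝ)
  | [] => ∅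
  | [p] => {p}
  | p :: q :: l => segment ℝ p q ∪ segments (q :: l)

theorem passed_eq {G : SimpleGraph V} {T : List (V → ℝ)}
    (h : T.IsChain fun p q => p ≠ q ∧ SameEdge G p q) : passed G T = segments T := by
  induction T with
  | nil => rfl
  | cons p T ih =>
    cases T with
    | nil => rfl
    | cons q T =>
      rw [List.isChain_cons_cons] at h
      rw [passed, segments, edgeSegment_eq h.1.2, ih h.2]

theorem mem_segments_of_mem {p : V → ℝ} {T : List (V → ℝ)} (h : p ∈ T) : p ∈ segments T := by
  induction T with
  | nil => simp at h
  | cons q T ih =>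
    cases T with
    | nil => simpa [segments] using h
    | cons r T =>
      rcases List.mem_cons.1 h with rfl | h
      · exact .inl (left_mem_segment ℝ p r)
      · exact .inr (ih h)

theorem segments_subset {G : SimpleGraph V} {T : List (V → ℝ)} (hT : IsWalk G T) :
    segments T ⊆ points G := by
  obtain ⟨-, hm, hc⟩ := hT
  induction T with
  | nil => simp [segments]
  | cons p T ih =>
    cases T with
    | nil => simpa [segments] using hm
    | cons q T =>
      rw [List.isChain_cons_cons] at hc
      rw [segments, Set.union_subset_iff]
      refine ⟨fun x hx => (hc.1.2.of_mem_segment hx hx).left_mem, ih ?_ hc.2⟩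
      exact fun p hp => hm p (List.mem_cons_of_mem _ hp)

variable [Fintype V]

/-- On each of the finitely many segments, the distance to `p` is 1-Lipschitz and the segment is
compact, so the minimum is attained. -/
theorem exists_nearest {G : SimpleGraph V} (hG : G.Connected) {T : List (V → ℝ)}
    (hT : IsWalk G T) {p : V → ℝ} (hp : p ∈ points G) :
    ∃ q ∈ segments T, ∀ q' ∈ segments T, pd G p q ≤ pd G p q' := by
  obtain ⟨hne, hm, hc⟩ := hT
  induction T with
  | nil => exact absurd rfl hne
  | cons x T ih =>
    cases T with
    | nil => exact ⟨x, by simp [segments], by simp [segments]⟩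
    | cons y T =>
      rw [List.isChain_cons_cons] at hc
      obtain ⟨q₁, hq₁, h₁⟩ := ih (by simp) (fun p hp => hm p (List.mem_cons_of_mem _ hp)) hc.2
      have hcomp : IsCompact (segment ℝ x y) := by
        obtain ⟨u, v, a, b, h, ha, hb, rfl, rfl⟩ := hc.1.2
        rw [segment_edgePt]
        refine isCompact_uIcc.image ?_
        unfold edgePt
        fun_prop
      have hcont : ContinuousOn (pd G p) (segment ℝ x y) := by
        refine (LipschitzOnWith.of_le_add fun z hz w hw => ?_).continuousOn (K := 1)
        have hs := hc.1.2.of_mem_segment hw hz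
        have := pd_triangle hG hp hs.left_mem hs.symm.left_mem
        linarith [pd_le_dist hs, dist_comm z w]
      obtain ⟨q₂, hq₂, h₂⟩ := hcomp.exists_isMinOn ⟨x, left_mem_segment ℝ x y⟩ hcont
      rcases le_total (pd G p q₁) (pd G p q₂) with hle | hle
      · refine ⟨q₁, .inr hq₁, ?_⟩
        rintro q' (hq' | hq')
        · exact hle.trans (h₂ hq')
        · exact h₁ q' hq'
      · refine ⟨q₂, .inl hq₂, ?_⟩
        rintro q' (hq' | hq')
        · exact h₂ hq'
        · exact hle.trans (h₁ q' hq')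

theorem exists_nearest_le {G : SimpleGraph V} (hG : G.Connected) {δ : ℝ} (hδ : 0 < δ)
    {T : List (V → ℝ)} (hT : IsDeltaTour G δ T) {p : V → ℝ} (hp : p ∈ points G) :
    ∃ q ∈ segments T, (∀ q' ∈ segments T, pd G p q ≤ pd G p q') ∧ pd G p q ≤ δ := by
  obtain ⟨⟨p₀, hw, -⟩, hd⟩ := hT
  obtain ⟨q, hq, hmin⟩ := exists_nearest hG hw hp
  refine ⟨q, hq, hmin, ?_⟩
  have h1 : ENNReal.ofReal (pd G p q) ≤ ptSetDist G p (passed G T) := by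
    rw [passed_eq hw.2.2]
    refine le_iInf₂ fun q' hq' => ?_
    rw [ptDist_eq hG hp (segments_subset hw hq')]
    exact ENNReal.ofReal_le_ofReal (hmin q' hq')
  exact (ENNReal.ofReal_le_ofReal_iff hδ.le).1 (h1.trans (hd p hp))

/-- A walk where consecutive points may be equal. -/
structure LazyWalk (G : SimpleGraph V) (L : List (V → ℝ)) : Prop where
  mem : ∀ p ∈ L, p ∈ points G
  chain : L.IsChain fun p q => p = q ∨ SameEdge G p q

theorem LazyWalk.tail {G : SimpleGraph V} {p : V → ℝ} {L : List (V → ℝ)}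
    (h : LazyWalk G (p :: L)) : LazyWalk G L :=
  ⟨fun q hq => h.mem q (List.mem_cons_of_mem _ hq), h.chain.tail⟩

/-- Subdividing a segment at one of its points keeps the length because the distance is additive
along a segment. Repeated points are allowed, so `x` may also be an end of the segment. -/
theorem LazyWalk.exists_insert {G : SimpleGraph V} {L : List (V → ℝ)} (h : LazyWalk G L)
    {x : V → ℝ} (hx : x ∈ segments L) : ∃ L', LazyWalk G L' ∧ L'.head? = L.head? ∧
      L'.getLast? = L.getLast? ∧ x ∈ L' ∧ (∀ y ∈ L, y ∈ L') ∧ segments L ⊆ segments L' ∧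
      len L' = len L := by
  induction L with
  | nil => simp [segments] at hx
  | cons p L ih =>
    cases L with
    | nil => exact ⟨[p], h, rfl, rfl, by simpa [segments] using hx, fun _ => id, subset_rfl, rfl⟩
    | cons q L =>
      have hc := (List.isChain_cons_cons.1 h.chain)
      rcases hx with hx | hx
      · have hs : (p = x ∨ SameEdge G p x) ∧ (x = q ∨ SameEdge G x q) := by
          rcases hc.1 with rfl | hs
          · rw [segment_same] at hx
            exact ⟨.inl hx.symm, .inl hx⟩
          · exact ⟨.inr (hs.of_mem_segment (left_mem_segment ℝ p q) hx),
              .inr (hs.of_mem_segment hx (right_mem_segment ℝ p q))⟩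
        have hxm : x ∈ points G := by
          rcases hs.1 with rfl | hs
          exacts [h.mem p (by simp), hs.symm.left_mem]
        refine ⟨p :: x :: q :: L, ⟨?_, ?_⟩, rfl, by simp, by simp, ?_, ?_, ?_⟩
        · intro y hy
          simp only [List.mem_cons] at hy
          rcases hy with rfl | rfl | hy
          · exact h.mem y (by simp)
          · exact hxm
          · exact h.mem y (List.mem_cons_of_mem _ (List.mem_cons.2 hy))
        · exact List.isChain_cons_cons.2 ⟨hs.1, List.isChain_cons_cons.2 ⟨hs.2, hc.2⟩⟩
        · intro y hy
          simp only [List.mem_cons] at hy ⊢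
          tauto
        · simp only [segments]
          rw [← Set.union_assoc]
          refine Set.union_subset_union_left _ ?_
          exact segment_subset_union hx
        · simp only [len]
          rw [← dist_add_dist_of_mem_segment hx, add_assoc]
      · obtain ⟨L', h1, h2, h3, h4, h5, h6, h7⟩ := ih h.tail hx
        cases L' with
        | nil => simp at h4
        | cons q' L' =>
          obtain rfl : q' = q := by simpa using h2
          refine ⟨p :: q' :: L', ⟨?_, List.isChain_cons_cons.2 ⟨hc.1, h1.chain⟩⟩, rfl, ?_,
            List.mem_cons_of_mem _ h4, ?_, ?_, ?_⟩
          · intro y hy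
            rcases List.mem_cons.1 hy with rfl | hy
            exacts [h.mem y (by simp), h1.mem y hy]
          · simpa using h3
          · intro y hy
            rcases List.mem_cons.1 hy with rfl | hy
            exacts [by simp, List.mem_cons_of_mem _ (h5 y hy)]
          · exact Set.union_subset_union_right _ h6
          · simp only [len] at h7 ⊢
            rw [h7]

theorem LazyWalk.exists_insert_all {G : SimpleGraph V} {L : List (V → ℝ)} (h : LazyWalk G L)
    (Q : List (V → ℝ)) (hQ : ∀ x ∈ Q, x ∈ segments L) : ∃ L', LazyWalk G L' ∧
      L'.head? = L.head? ∧ L'.getLast? = L.getLast? ∧ (∀ x ∈ Q, x ∈ L') ∧ (∀ x ∈ L, x ∈ L') ∧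
      len L' = len L := by
  induction Q generalizing L with
  | nil => exact ⟨L, h, rfl, rfl, by simp, fun _ => id, rfl⟩
  | cons x Q ih =>
    obtain ⟨L₁, h1, h2, h3, h4, h5, h6, h7⟩ := h.exists_insert (hQ x (by simp))
    obtain ⟨L₂, g1, g2, g3, g4, g5, g6⟩ := ih h1 fun y hy =>
      h6 (hQ y (List.mem_cons_of_mem _ hy))
    refine ⟨L₂, g1, g2.trans h2, g3.trans h3, ?_, fun y hy => g5 y (h5 y hy), g6.trans h7⟩
    intro y hy
    rcases List.mem_cons.1 hy with rfl | hy
    exacts [g5 y h4, g4 y hy]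

/-- The sum of the distances of consecutive points. -/
noncomputable def pdLen (G : SimpleGraph V) : List (V → ℝ) → ℝ
  | [] => 0
  | [_] => 0
  | p :: q :: l => pd G p q + pdLen G (q :: l)

theorem LazyWalk.pdLen_le {G : SimpleGraph V} {L : List (V → ℝ)} (h : LazyWalk G L) :
    pdLen G L ≤ len L := by
  induction L with
  | nil => exact le_rfl
  | cons p L ih =>
    cases L with
    | nil => exact le_rfl
    | cons q L =>
      have h1 : pd G p q ≤ dist p q := by
        rcases (List.isChain_cons_cons.1 h.chain).1 with rfl | hs
        · rw [pd_self (h.mem p (by simp)), dist_self]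
        · exact pd_le_dist hs
      simp only [pdLen, len]
      linarith [ih h.tail]

theorem pdLen_cons_le {G : SimpleGraph V} (hG : G.Connected) {a x y : V → ℝ} {L : List (V → ℝ)}
    (ha : a ∈ points G) (hx : x ∈ points G) (hy : y ∈ points G) :
    pdLen G (a :: y :: L) ≤ pd G a x + pdLen G (x :: y :: L) := by
  simp only [pdLen]
  linarith [pd_triangle hG ha hx hy]

/-- Deleting a point does not lengthen the sequence, by the triangle inequality. The fixed ends `a`
and `b` make every deleted point an inner one. -/
theorem pdLen_sublist {G : SimpleGraph V} (hG : G.Connected) {l L : List (V → ℝ)}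
    (h : l.Sublist L) (hL : ∀ p ∈ L, p ∈ points G) {a b : V → ℝ} (ha : a ∈ points G)
    (hb : b ∈ points G) : pdLen G (a :: (l ++ [b])) ≤ pdLen G (a :: (L ++ [b])) := by
  induction h generalizing a with
  | slnil => exact le_rfl
  | @cons l L x h ih =>
    have hx := hL x (by simp)
    have h1 := ih (fun p hp => hL p (List.mem_cons_of_mem _ hp)) hx
    have h2 : pdLen G (a :: (l ++ [b])) ≤ pd G a x + pdLen G (x :: (l ++ [b])) := by
      cases l with
      | nil => exact pdLen_cons_le hG ha hx hb
      | cons y l =>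
        exact pdLen_cons_le hG ha hx (hL y (List.mem_cons_of_mem _ (h.subset (by simp))))
    simp only [List.cons_append, pdLen]
    linarith
  | @cons_cons l L x h ih =>
    have h1 := ih (fun p hp => hL p (List.mem_cons_of_mem _ hp)) (hL x (by simp))
    simp only [List.cons_append, pdLen]
    linarith

theorem pdLen_append_replace {G : SimpleGraph V} (hG : G.Connected) {M : List (V → ℝ)}
    {x y z : V → ℝ} (hM : ∀ p ∈ x :: M, p ∈ points G) (hy : y ∈ points G) (hz : z ∈ points G) :
    pdLen G (x :: M ++ [z]) ≤ pdLen G (x :: M ++ [y]) + pd G y z := by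
  induction M generalizing x with
  | nil =>
    simp only [List.cons_append, List.nil_append, pdLen]
    linarith [pd_triangle hG (hM x (by simp)) hy hz]
  | cons w M ih =>
    have := ih (x := w) fun p hp => hM p (List.mem_cons_of_mem _ hp)
    simp only [List.cons_append, pdLen] at this ⊢
    linarith

/-- Beyond the end of `l` the default value `x` is repeated at cost `0`. So the sum over any `m ≥
l.length` describes the sequence `l` followed by `x`; with `x` the head of `l` it is a closed one.
-/
theorem sum_getD {G : SimpleGraph V} {x : V → ℝ} (hx : x ∈ points G) (l : List (V → ℝ)) (m : ℕ)
    (hm : l.length ≤ m) :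
    ∑ i ∈ Finset.range m, pd G (l.getD i x) (l.getD (i + 1) x) = pdLen G (l ++ [x]) := by
  induction l generalizing m with
  | nil => simp [pd_self hx, pdLen]
  | cons y l ih =>
    obtain ⟨m, rfl⟩ : ∃ m', m = m' + 1 := ⟨m - 1, by simp at hm; omega⟩
    rw [Finset.sum_range_succ']
    have := ih m (by simpa using hm)
    simp only [List.getD_cons_succ, List.getD_cons_zero, this]
    cases l with
    | nil => simp [pdLen]
    | cons z l => simp [pdLen, add_comm]

/-- Finitely many points of a tour, in the order of the tour, form no longer a closed walk. -/
theorem exists_cyclic_order {G : SimpleGraph V} (hG : G.Connected) {T : List (V → ℝ)}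
    (hT : IsTour G T) {Q : List (V → ℝ)} (hne : Q ≠ []) (hQ : ∀ x ∈ Q, x ∈ segments T) {m : ℕ}
    (hm : Q.length ≤ m) : ∃ g : ℕ → V → ℝ, (∀ i, g i ∈ points G) ∧ g m = g 0 ∧
      (∀ x ∈ Q, ∃ i < m, g i = x) ∧
      ∑ i ∈ Finset.range m, pd G (g i) (g (i + 1)) ≤ len T := by
  classical
  obtain ⟨p, ⟨hw, hh, hl⟩⟩ := hT
  have hlw : LazyWalk G T := ⟨hw.2.1, hw.2.2.imp fun _ _ h => .inr h.2⟩
  obtain ⟨L, hL, hLh, hLl, hQL, -, hlen⟩ := hlw.exists_insert_all Q hQ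
  have hp : p ∈ points G := hw.2.1 p (List.mem_of_mem_head? (by simp [hh]))
  -- The points of `Q`, each once and in the order of the tour. Without repetitions there are at
  -- most `Q.length ≤ m` of them.
  set l := L.dedup.filter fun x => x ∈ Q with hldef
  have hsub : l.Sublist L := List.filter_sublist.trans (List.dedup_sublist L)
  have hmem : ∀ x, x ∈ l ↔ x ∈ Q := fun x => by
    simp only [hldef, List.mem_filter, List.mem_dedup, decide_eq_true_eq]
    exact ⟨fun h => h.2, fun h => ⟨hQL x h, h⟩⟩
  have hlm : l.length ≤ m := by
    refine le_trans ?_ hm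
    have hnd : l.Nodup := (List.nodup_dedup L).filter _
    exact (hnd.subperm fun x hx => (hmem x).1 hx).length_le
  have hlG : ∀ x ∈ l, x ∈ points G := fun x hx => hL.mem x (hsub.subset hx)
  obtain ⟨x, l', hxl⟩ : ∃ x l', l = x :: l' := by
    cases hcase : l with
    | nil =>
      obtain ⟨y, hy⟩ := List.exists_mem_of_ne_nil Q hne
      have := (hmem y).2 hy
      rw [hcase] at this
      simp at this
    | cons x l' => exact ⟨x, l', rfl⟩
  have hx : x ∈ points G := hlG x (by simp [hxl])
  refine ⟨fun i => l.getD i x, fun i => ?_, ?_, fun y hy => ?_, ?_⟩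
  · by_cases hi : i < l.length
    · simp only [List.getD_eq_getElem _ _ hi]
      exact hlG _ (List.getElem_mem hi)
    · simp only [List.getD_eq_default _ _ (not_lt.1 hi)]
      exact hx
  · change l.getD m x = l.getD 0 x
    rw [List.getD_eq_default _ _ hlm, hxl]
    rfl
  · obtain ⟨i, hi, he⟩ := List.mem_iff_getElem.1 ((hmem y).2 hy)
    exact ⟨i, by omega, (List.getD_eq_getElem _ _ hi).trans he⟩
  · rw [sum_getD hx l m hlm]
    have hLp : ∃ L₀, L = L₀ ++ [p] := List.getLast?_eq_some_iff.1 (hLl.trans hl)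
    obtain ⟨L₀, hL₀⟩ := hLp
    have hL1 : ∃ L₁, L = p :: L₁ := List.head?_eq_some_iff.1 (hLh.trans hh)
    obtain ⟨L₁, hL₁⟩ := hL1
    -- The tour starts at `p`, which need not belong to `Q`. By the triangle inequality at `p`,
    -- closing the sequence at its own first point `x` is no longer than starting and ending at `p`.
    have h1 : pdLen G (l ++ [x]) ≤ pdLen G (p :: (l ++ [p])) := by
      have := pdLen_append_replace hG (M := l') (x := x) (y := p) (z := x)
        (fun y hy => hlG y (by rwa [hxl])) hp hx
      rw [hxl]
      simp only [List.cons_append, pdLen] at this ⊢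
      linarith
    have h2 := pdLen_sublist hG hsub hL.mem hp hp
    -- The walk `L` already begins and ends with `p`, so the additional copies cost nothing.
    have h3 : pdLen G (p :: (L ++ [p])) = pdLen G L := by
      have : ∀ M : List (V → ℝ), pdLen G (M ++ [p] ++ [p]) = pdLen G (M ++ [p]) := by
        intro M
        induction M with
        | nil => simp [pdLen, pd_self hp]
        | cons y M ih =>
          cases M with
          | nil => simp [pdLen, pd_self hp]
          | cons z M =>
            simp only [List.cons_append, pdLen] at ih ⊢
            rw [ih]
      have h4 := this L₀
      rw [← hL₀] at h4
      rw [← h4, hL₁]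
      simp [pdLen, pd_self hp]
    linarith [hL.pdLen_le]

/-! ### Few points suffice -/

theorem length_mul_le_card {α β : Type*} [DecidableEq β] (l : List α) (W : α → Finset β)
    (K : Finset β) {w : ℝ} (hd : l.Pairwise fun a b => Disjoint (W a) (W b))
    (hw : ∀ a ∈ l, w ≤ (W a).card) (hK : ∀ a ∈ l, W a ⊆ K) : l.length * w ≤ K.card := by
  induction l generalizing K with
  | nil => simp
  | cons a l ih =>
    rw [List.pairwise_cons] at hd
    have h1 := ih (K \ W a) hd.2 (fun b hb => hw b (List.mem_cons_of_mem _ hb)) fun b hb =>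
      Finset.subset_sdiff.2 ⟨hK b (List.mem_cons_of_mem _ hb), (hd.1 b hb).symm⟩
    have h2 := Finset.card_sdiff_add_card_eq_card (hK a (by simp))
    have h3 : ((K \ W a).card : ℝ) + (W a).card = K.card := by exact_mod_cast h2
    have h4 := hw a (by simp)
    rw [List.length_cons]
    push_cast
    linarith

open Classical in
/-- The points of `K` between `p` and `q` at distance at most `r` from `p`. -/
noncomputable def between (G : SimpleGraph V) (K : Finset (V → ℝ)) (r : ℝ) (p q : V → ℝ) :
    Finset (V → ℝ) :=
  K.filter fun x => pd G p x + pd G x q = pd G p q ∧ pd G p x ≤ r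

-- Split the list at distance `δ / 2` from `ν`. For the far points, shortest walks from `p` to `ν p`
-- are disjoint: let `x` be common to those of `p` and a later `q`. As `ν q` is nearest to `q`, it
-- is no farther from `x` than `ν p` is, whence `ν q` has distance at most `pd G p (ν p) ≤ δ` from
-- `p`, a contradiction. For the near points, the `ν p` are more than `δ / 2` apart, so the balls of
-- radius `δ / 4` around them are disjoint. Each set contains at least `w` points of `K`. In the
-- near case this needs a point at distance more than `δ / 4`, which two near points provide; the
-- extra `w` in the bound pays for a single one.
open Classical in
theorem length_le_of_spread {G : SimpleGraph V} (hG : G.Connected) {δ : ℝ} (hδ : 0 < δ)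
    {S : Set (V → ℝ)} (hS : S ⊆ points G) {ν : (V → ℝ) → V → ℝ} (hν : ∀ p ∈ points G, ν p ∈ S)
    (hmin : ∀ p ∈ points G, ∀ q ∈ S, pd G p (ν p) ≤ pd G p q)
    (hle : ∀ p ∈ points G, pd G p (ν p) ≤ δ) {K : Finset (V → ℝ)} (hK : ∀ x ∈ K, x ∈ points G)
    {w : ℝ} (hw : 0 ≤ w) (hbw : ∀ p ∈ points G, ∀ q ∈ points G, δ / 4 < pd G p q →
      w ≤ (between G K (δ / 4) p q).card) {l : List (V → ℝ)} (hl : ∀ p ∈ l, p ∈ points G)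
    (hlp : l.Pairwise fun p q => δ < pd G p (ν q)) : l.length * w ≤ 2 * K.card + w := by
  set far : (V → ℝ) → Bool := fun p => decide (δ / 2 < pd G p (ν p)) with hfar
  have hfarlen : (l.filter far).length * w ≤ K.card := by
    refine length_mul_le_card _
      (fun p => K.filter fun x => pd G p x + pd G x (ν p) = pd G p (ν p)) K ?_ ?_
      fun _ _ => Finset.filter_subset _ _
    · refine (hlp.filter far).imp_of_mem fun {p q} hp hq h => ?_
      have hp := hl p (List.mem_of_mem_filter hp)
      have hq := hl q (List.mem_of_mem_filter hq)
      have hνp := hS (hν p hp)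
      have hνq := hS (hν q hq)
      rw [Finset.disjoint_left]
      intro x hx hx'
      rw [Finset.mem_filter] at hx hx'
      have hxG := hK x hx.1
      have h1 := hmin q hq _ (hν p hp)
      have h2 := pd_triangle hG hq hxG hνp
      have h3 := pd_triangle hG hp hxG hνq
      linarith [hle p hp, hx.2, hx'.2]
    · intro p hp
      have hfp : δ / 2 < pd G p (ν p) := by simpa [hfar] using List.of_mem_filter hp
      have hp := hl p (List.mem_of_mem_filter hp)
      refine (hbw p hp _ (hS (hν p hp)) (by linarith)).trans ?_
      refine Nat.cast_le.2 (Finset.card_le_card fun x hx => ?_)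
      simp only [between, Finset.mem_filter] at hx ⊢
      exact ⟨hx.1, hx.2.1⟩
  have hnearlen : (l.filter fun p => !far p).length * w ≤ K.card + w := by
    set l₂ := l.filter fun p => !far p with hl₂
    have hnear : ∀ p ∈ l₂, p ∈ points G ∧ pd G p (ν p) ≤ δ / 2 := fun p hp => by
      refine ⟨hl p (List.mem_of_mem_filter hp), ?_⟩
      simpa [hfar] using List.of_mem_filter hp
    have hsep : l₂.Pairwise fun p q => δ / 2 < pd G (ν p) (ν q) := by
      refine (hlp.filter _).imp_of_mem fun {p q} hp hq h => ?_
      have h1 := hnear p hp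
      have h2 := hnear q hq
      have := pd_triangle hG h1.1 (hS (hν p h1.1)) (hS (hν q h2.1))
      linarith
    by_cases h2 : l₂.length ≤ 1
    · have h3 : (l₂.length : ℝ) ≤ 1 := by exact_mod_cast h2
      have : (0 : ℝ) ≤ K.card := by positivity
      nlinarith
    · refine le_trans (length_mul_le_card _
        (fun p => K.filter fun x => pd G (ν p) x ≤ δ / 4) K ?_ ?_
        fun _ _ => Finset.filter_subset _ _) (le_add_of_nonneg_right hw)
      · refine hsep.imp_of_mem fun {p q} hp hq h => ?_
        rw [Finset.disjoint_left]
        intro x hx hx'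
        rw [Finset.mem_filter] at hx hx'
        have := pd_triangle hG (hS (hν p (hnear p hp).1)) (hK x hx.1) (hS (hν q (hnear q hq).1))
        rw [pd_comm G x (ν q)] at this
        linarith [hx.2, hx'.2]
      · intro p hp
        have hother : ∃ q ∈ points G, δ / 4 < pd G (ν p) q := by
          obtain ⟨a, b, l₃, he⟩ : ∃ a b l₃, l₂ = a :: b :: l₃ := by
            match l₂, h2 with
            | [], h2 => simp at h2
            | [_], h2 => simp at h2
            | a :: b :: l₃, _ => exact ⟨a, b, l₃, rfl⟩
          have hab : δ / 2 < pd G (ν a) (ν b) := by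
            rw [he, List.pairwise_cons] at hsep
            exact hsep.1 b (by simp)
          have ha := hS (hν a (hnear a (by simp [he])).1)
          have hb := hS (hν b (hnear b (by simp [he])).1)
          have hp := hS (hν p (hnear p hp).1)
          by_contra! hno
          have h1 := hno _ ha
          have h2 := hno _ hb
          have := pd_triangle hG ha hp hb
          rw [pd_comm G (ν a) (ν p)] at this
          linarith
        obtain ⟨q, hq, hpq⟩ := hother
        refine (hbw _ (hS (hν p (hnear p hp).1)) q hq hpq).trans ?_
        refine Nat.cast_le.2 (Finset.card_le_card fun x hx => ?_)
        simp only [between, Finset.mem_filter] at hx ⊢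
        exact ⟨hx.1, hx.2.2⟩
  have hsum : l.length = (l.filter far).length + (l.filter fun p => !far p).length := by
    simpa using List.length_eq_length_filter_add (l := l) far
  rw [hsum]
  push_cast
  linarith

/-- A `δ`-tour can be replaced by `m` of its points, if greedily chosen points are at most `m`
in number. -/
theorem exists_few_points {G : SimpleGraph V} (hG : G.Connected) {δ : ℝ} (hδ : 0 < δ)
    {K : Finset (V → ℝ)} (hK : ∀ x ∈ K, x ∈ points G)
    {w : ℝ} (hw : 0 < w) (hbw : ∀ p ∈ points G, ∀ q ∈ points G, δ / 4 < pd G p q →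
      w ≤ (between G K (δ / 4) p q).card) {m : ℕ} (hm : 2 * K.card + w ≤ m * w)
    {T : List (V → ℝ)} (hT : IsDeltaTour G δ T) : ∃ g : ℕ → V → ℝ,
      (∀ i, g i ∈ points G) ∧ g m = g 0 ∧ (∀ p ∈ points G, ∃ i < m, pd G p (g i) ≤ δ) ∧
      ∑ i ∈ Finset.range m, pd G (g i) (g (i + 1)) ≤ len T := by
  choose! ν hν hmin hle using fun (p : V → ℝ) (hp : p ∈ points G) => exists_nearest_le hG hδ hT hp
  obtain ⟨p₀, hw₀⟩ := hT.1
  have hS := segments_subset hw₀.1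
  have hbound : ∀ l : List (V → ℝ), (∀ p ∈ l, p ∈ points G) →
      l.Pairwise (fun p q => δ < pd G p (ν q)) → l.length ≤ m := by
    intro l hl hlp
    have := length_le_of_spread hG hδ hS hν hmin hle hK hw.le hbw hl hlp
    have : (l.length : ℝ) * w ≤ m * w := by linarith
    exact_mod_cast le_of_mul_le_mul_right this hw
  obtain ⟨l, hl, hlp, hcov⟩ : ∃ l : List (V → ℝ), (∀ p ∈ l, p ∈ points G) ∧
      l.Pairwise (fun p q => δ < pd G p (ν q)) ∧
      ∀ p ∈ points G, ∃ q ∈ l, pd G p (ν q) ≤ δ := by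
    -- If every admissible list left some point uncovered, that point could be added, and there
    -- would be admissible lists of all lengths, against `hbound`.
    by_contra! hno
    have : ∀ j : ℕ, ∃ l : List (V → ℝ), l.length = j ∧ (∀ p ∈ l, p ∈ points G) ∧
        l.Pairwise (fun p q => δ < pd G p (ν q)) := by
      intro j
      induction j with
      | zero => exact ⟨[], rfl, by simp, by simp⟩
      | succ j ih =>
        obtain ⟨l, h1, h2, h3⟩ := ih
        obtain ⟨p, hp, hpl⟩ := hno l h2 h3
        exact ⟨p :: l, by simp [h1], by simpa [hp] using h2, List.pairwise_cons.2 ⟨hpl, h3⟩⟩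
    obtain ⟨l, h1, h2, h3⟩ := this (m + 1)
    have := hbound l h2 h3
    omega
  have hne : l ≠ [] := by
    rintro rfl
    obtain ⟨q, hq, -⟩ := hcov p₀ (hw₀.1.2.1 p₀ (List.mem_of_mem_head? (by simp [hw₀.2.1])))
    simp at hq
  obtain ⟨g, h1, h2, h3, h4⟩ := exists_cyclic_order hG hT.1 (Q := l.map ν) (by simpa using hne)
    (fun x hx => by
      obtain ⟨p, hp, rfl⟩ := List.mem_map.1 hx
      exact hν p (hl p hp)) (m := m) (by simpa using hbound l hl hlp)
  refine ⟨g, h1, h2, fun p hp => ?_, h4⟩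
  obtain ⟨q, hq, hle⟩ := hcov p hp
  obtain ⟨i, hi, he⟩ := h3 (ν q) (List.mem_map_of_mem hq)
  exact ⟨i, hi, he ▸ hle⟩

end Passed

end DeltaTour

/-! ## Covering an interval by intervals -/

namespace DeltaTour

theorem exists_mem_Icc_between (lo hi : Finset ℝ) (h : ∀ x ∈ lo, ∀ y ∈ hi, x < y)
    (hlo : ∀ x ∈ lo, x < 1) (hhi : ∀ y ∈ hi, 0 < y) :
    ∃ m ∈ Set.Icc (0 : ℝ) 1, (∀ x ∈ lo, x < m) ∧ ∀ y ∈ hi, m < y := by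
  obtain ⟨m, h1, h2⟩ := Order.exists_between_finsets lo hi h
  refine ⟨max 0 (min m 1), ⟨le_max_left _ _, max_le zero_le_one (min_le_right _ _)⟩,
    fun x hx => lt_max_of_lt_right (lt_min (h1 x hx) (hlo x hx)),
    fun y hy => max_lt (hhi y hy) ((min_le_left _ _).trans_lt (h2 y hy))⟩

/-- Covering depends only on how left ends compare with right ends and with `0` and `1`. If `x` is
not covered by the new intervals, each of them lies entirely below or entirely above `x`. By the
hypotheses, the right ends of the old intervals of the first kind are below the left ends of those
of the second kind, so a point of the unit interval lies strictly between and is not covered either.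
-/
theorem cover_of_cover {ι : Type*} [Finite ι] {L U L' U' : ι → ℝ}
    (h : ∀ i j, L i ≤ U j → L' i ≤ U' j) (h0 : ∀ i, L i ≤ 0 → L' i ≤ 0)
    (h1 : ∀ i, 1 ≤ U i → 1 ≤ U' i) (hc : ∀ x ∈ Set.Icc (0 : ℝ) 1, ∃ i, L i ≤ x ∧ x ≤ U i) :
    ∀ x ∈ Set.Icc (0 : ℝ) 1, ∃ i, L' i ≤ x ∧ x ≤ U' i := by
  classical
  have := Fintype.ofFinite ι
  intro x hx
  by_contra! hn
  obtain ⟨m, hm, hA, hB⟩ := exists_mem_Icc_between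
    ((Finset.univ.filter fun i => U' i < x).image U) ((Finset.univ.filter fun i => x < L' i).image L)
    (by
      simp only [Finset.mem_image, Finset.mem_filter, Finset.mem_univ, true_and]
      rintro _ ⟨i, hi, rfl⟩ _ ⟨j, hj, rfl⟩
      by_contra! hle
      linarith [h j i hle])
    (by
      simp only [Finset.mem_image, Finset.mem_filter, Finset.mem_univ, true_and]
      rintro _ ⟨i, hi, rfl⟩
      by_contra! hle
      linarith [h1 i hle, hx.2])
    (by
      simp only [Finset.mem_image, Finset.mem_filter, Finset.mem_univ, true_and]
      rintro _ ⟨i, hi, rfl⟩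
      by_contra! hle
      linarith [h0 i hle, hx.1])
  obtain ⟨i, hi, hi'⟩ := hc m hm
  by_cases hL : L' i ≤ x
  · exact absurd (hA _ (Finset.mem_image_of_mem _ (by simpa using hn i hL))) (not_lt.2 hi')
  · exact absurd (hB _ (Finset.mem_image_of_mem _ (by simpa using hL))) (not_lt.2 hi)

/-- A gap begins at `0` or immediately after a right end, so only these positions need a test.
Conversely, a point slightly above `b`, chosen below all left ends that exceed `b`, can only be
covered by an interval that also contains `b`. -/
theorem cover_iff_germ {ι : Type*} [Finite ι] {L U : ι → ℝ} :
    (∀ x ∈ Set.Icc (0 : ℝ) 1, ∃ i, L i ≤ x ∧ x ≤ U i) ↔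
      ∀ b, (b = 0 ∨ ∃ i, b = U i) → 0 ≤ b → b < 1 → ∃ j, L j ≤ b ∧ b < U j := by
  classical
  have := Fintype.ofFinite ι
  constructor
  · intro hc b _ hb0 hb1
    obtain ⟨m, hm, hA, hB⟩ := exists_mem_Icc_between {b}
      ((Finset.univ.filter fun i => b < L i).image L) (by simp) (by simpa using hb1)
      (by
        simp only [Finset.mem_image, Finset.mem_filter, Finset.mem_univ, true_and]
        rintro _ ⟨i, hi, rfl⟩
        linarith)
    obtain ⟨i, hi, hi'⟩ := hc m hm
    refine ⟨i, ?_, (hA b (by simp)).trans_le hi'⟩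
    by_contra! hL
    exact absurd (hB _ (Finset.mem_image_of_mem _ (by simpa using hL))) (not_lt.2 hi)
  · intro hg x hx
    by_contra! hn
    -- The largest element `b` of `S` is the last right end before the uncovered `x`, or `0`. An
    -- interval that covers the positions after `b` would end later than `b` but before `x`, which
    -- contradicts this choice.
    set S : Finset ℝ := insert 0 ((Finset.univ.filter fun i => U i < x).image U) with hS
    have hne : S.Nonempty := Finset.insert_nonempty _ _
    have hmem := S.max'_mem hne
    set b := S.max' hne with hb
    have hb0 : 0 ≤ b := S.le_max' 0 (Finset.mem_insert_self _ _)
    have hbx : b ≤ x ∧ b < 1 := by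
      rcases Finset.mem_insert.1 hmem with h | h
      · rw [h]; exact ⟨hx.1, one_pos⟩
      · simp only [Finset.mem_image, Finset.mem_filter, Finset.mem_univ, true_and] at h
        obtain ⟨i, hi, he⟩ := h
        rw [← he]
        exact ⟨hi.le, hi.trans_le hx.2⟩
    obtain ⟨j, hj, hj'⟩ := hg b (by
      rcases Finset.mem_insert.1 hmem with h | h
      · exact .inl h
      · simp only [Finset.mem_image, Finset.mem_filter, Finset.mem_univ, true_and] at h
        obtain ⟨i, hi, he⟩ := h
        exact .inr ⟨i, he.symm⟩) hb0 hbx.2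
    have h2 := hn j (hj.trans hbx.1)
    have h3 : U j ≤ b := S.le_max' _ (Finset.mem_insert_of_mem
      (Finset.mem_image_of_mem _ (by simpa using h2)))
    linarith

/-! ## Moving points to discrete positions -/

section Discrete

variable {m : ℕ}

/-- The signed coordinates of a vector. -/
noncomputable def sc (y : Fin m → ℝ) (p : Fin m × Bool) : ℝ := if p.2 then y p.1 else -y p.1

theorem sc_not (y : Fin m → ℝ) (p : Fin m × Bool) : sc y (p.1, !p.2) = -sc y p := by
  cases h : p.2 <;> simp [sc, h]

/-- All inequalities of the relevant form are inherited by `y` from `x`. -/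
def Pres (δ : ℝ) (x y : Fin m → ℝ) : Prop :=
  ∀ (p q : Fin m × Bool) (b : Bool) (c : ℤ),
    sc x p + sc x q ≤ c + (if b then 2 * δ else 0) → sc y p + sc y q ≤ c + (if b then 2 * δ else 0)

/-- The inequalities that define the polytope around `x`. -/
def cell (δ : ℝ) (x : Fin m → ℝ) : Set (Fin m → ℝ) :=
  {y | ∀ k : (Fin m × Bool) × (Fin m × Bool) × Bool,
    sc y k.1 + sc y k.2.1 - (if k.2.2 then 2 * δ else 0) ≤
      ⌈sc x k.1 + sc x k.2.1 - (if k.2.2 then 2 * δ else 0)⌉}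

theorem self_mem_cell (δ : ℝ) (x : Fin m → ℝ) : x ∈ cell δ x := fun _ => Int.le_ceil _

/-- For integer `c`, the inequalities of `Pres` all follow from the one with the least `c` valid at
`x`, which is the rounded-up value. So finitely many inequalities, those of `cell`, suffice. -/
theorem pres_of_mem_cell {δ : ℝ} {x y : Fin m → ℝ} (h : y ∈ cell δ x) : Pres δ x y := by
  intro p q b c hc
  have h1 := h (p, q, b)
  have h2 : (⌈sc x p + sc x q - (if b then 2 * δ else 0)⌉ : ℝ) ≤ c := by
    exact_mod_cast Int.ceil_le.2 (by linarith)
  simp only at h1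
  linarith

theorem continuous_sc (p : Fin m × Bool) : Continuous fun y : Fin m → ℝ => sc y p := by
  unfold sc
  split_ifs <;> fun_prop

theorem Pres.mem_Icc {δ : ℝ} {x y : Fin m → ℝ} (h : Pres δ x y) (hx : ∀ i, x i ∈ Set.Icc (0 : ℝ) 1)
    (i : Fin m) : y i ∈ Set.Icc (0 : ℝ) 1 := by
  have h1 := h (i, true) (i, true) false 2 (by have := (hx i).2; simp [sc]; linarith)
  have h2 := h (i, false) (i, false) false 0 (by have := (hx i).1; simp [sc]; linarith)
  simp [sc] at h1 h2
  exact ⟨by linarith, by linarith⟩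

theorem isCompact_cell {δ : ℝ} {x : Fin m → ℝ} (hx : ∀ i, x i ∈ Set.Icc (0 : ℝ) 1) :
    IsCompact (cell δ x) := by
  refine (isCompact_univ_pi (s := fun _ : Fin m => Set.Icc (0 : ℝ) 1) fun _ =>
    isCompact_Icc).of_isClosed_subset ?_ fun y hy i _ => (pres_of_mem_cell hy).mem_Icc hx i
  rw [cell, Set.ofPred_forall]
  refine isClosed_iInter fun k => isClosed_le ?_ continuous_const
  exact ((continuous_sc k.1).add (continuous_sc k.2.1)).sub continuous_const

theorem sc_add_smul (y v : Fin m → ℝ) (t : ℝ) (p : Fin m × Bool) :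
    sc (y + t • v) p = sc y p + t * sc v p := by
  cases h : p.2 <;> simp [sc, h]
  ring

/-- Two signed coordinates that are linked by a tight inequality. -/
def linkGraph (δ : ℝ) (y : Fin m → ℝ) : SimpleGraph (Fin m × Bool) where
  Adj p q := p ≠ q ∧ ∃ c b : ℤ, |b| ≤ 1 ∧ sc y p - sc y q = c + 2 * δ * b
  symm := ⟨by
    rintro p q ⟨hne, c, b, hb, h⟩
    exact ⟨hne.symm, -c, -b, by rwa [abs_neg], by push_cast; linarith⟩⟩
  loopless := ⟨fun _ h => h.1 rfl⟩

theorem linkGraph_walk {δ : ℝ} {y : Fin m → ℝ} {p q : Fin m × Bool}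
    (w : (linkGraph δ y).Walk p q) :
    ∃ c b : ℤ, |b| ≤ w.length ∧ sc y p - sc y q = c + 2 * δ * b := by
  induction w with
  | nil => exact ⟨0, 0, by simp, by simp⟩
  | cons h w ih =>
    obtain ⟨-, c, b, hb, h1⟩ := h
    obtain ⟨c', b', hb', h2⟩ := ih
    refine ⟨c + c', b + b', (abs_add_le _ _).trans ((add_le_add hb hb').trans ?_),
      by push_cast; linarith⟩
    exact (add_comm _ _).le

/-- Changing both signs negates the linking equation. Thus the component of a signed coordinate has
a mirror image that is a component as well. -/
theorem linkGraph_not {δ : ℝ} {y : Fin m → ℝ} {p q : Fin m × Bool}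
    (h : (linkGraph δ y).Adj p q) : (linkGraph δ y).Adj (p.1, !p.2) (q.1, !q.2) := by
  obtain ⟨hne, c, b, hb, h⟩ := h
  refine ⟨fun he => hne ?_, -c, -b, by rwa [abs_neg], ?_⟩
  · simp only [Prod.mk.injEq] at he
    exact Prod.ext he.1 (by simpa using he.2)
  · rw [sc_not, sc_not]
    push_cast
    linarith

/-- A direction in which a coordinate that is not discrete can be moved both ways. -/
theorem exists_direction {δ : ℝ} {x y : Fin m → ℝ} (hy : y ∈ cell δ x) {i : Fin m}
    (hi : ¬ ∃ c b : ℤ, |b| ≤ 2 * m ∧ 2 * y i = c + 2 * δ * b) :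
    ∃ v : Fin m → ℝ, v ≠ 0 ∧ ∃ t : ℝ, t > 0 ∧ y + t • v ∈ cell δ x ∧ y + (-t) • v ∈ cell δ x := by
  classical
  set H := linkGraph δ y with hH
  let R : Fin m × Bool → Prop := fun p => H.Reachable (i, true) p
  -- A path from `(i, true)` to `(i, false)` would express `y i - (- y i)`. On `2 * m` vertices it
  -- has fewer than `2 * m` edges, each of which contributes at most `1` to `|b|`.
  have hnR : ¬ R (i, false) := by
    rintro ⟨w⟩
    obtain ⟨c, b, hb, h⟩ := linkGraph_walk w.toPath.1
    refine hi ⟨c, b, hb.trans ?_, ?_⟩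
    · have := w.toPath.2.length_lt
      simp only [Fintype.card_prod, Fintype.card_fin, Fintype.card_bool] at this
      norm_cast
      omega
    · simp [sc] at h
      linarith
  -- The direction moves the signed coordinates of the component of `(i, true)` up and those of its
  -- mirror image down at the same speed, so linked signed coordinates change equally.
  let v : Fin m → ℝ := fun j => (if R (j, true) then 1 else 0) - (if R (j, false) then 1 else 0)
  have hv : ∀ p, sc v p = (if R p then 1 else 0) - (if R (p.1, !p.2) then 1 else 0) := by
    rintro ⟨j, b⟩
    cases b <;> simp [sc, v]
  have hadj : ∀ p q, H.Adj p q → (R p ↔ R q) := fun p q h =>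
    ⟨fun hp => hp.trans h.reachable, fun hq => hq.trans h.symm.reachable⟩
  have hvadj : ∀ p q, p = q ∨ H.Adj p q → sc v p = sc v q := by
    rintro p q (rfl | h)
    · rfl
    · rw [hv, hv]
      simp only [hadj p q h, hadj _ _ (linkGraph_not h)]
  refine ⟨v, fun h0 => ?_, ?_⟩
  · have := congrFun h0 i
    have h1 : R (i, true) := SimpleGraph.Reachable.refl _
    simp [v, h1, hnR] at this
  · have key : ∀ᶠ t in nhds (0 : ℝ), y + t • v ∈ cell δ x := by
      simp only [cell, Set.mem_ofPred_eq]
      refine Filter.eventually_all.2 fun k => ?_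
      obtain ⟨p, q, b⟩ := k
      rcases (hy (p, q, b)).lt_or_eq with h | h
      · have hc : Continuous fun t : ℝ => sc (y + t • v) p + sc (y + t • v) q -
            (if b then 2 * δ else 0) := by
          simp only [sc_add_smul]
          fun_prop
        have := (hc.tendsto 0).eventually_lt_const (by simpa using h)
        filter_upwards [this] with t ht using ht.le
      · refine Filter.Eventually.of_forall fun t => ?_
        have hpq : sc v p = sc v (q.1, !q.2) := by
          refine hvadj _ _ ?_
          by_cases he : p = (q.1, !q.2)
          · exact .inl he
          · refine .inr ⟨he, ⌈sc x p + sc x q - (if b then 2 * δ else 0)⌉, if b then 1 else 0,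
              by cases b <;> simp, ?_⟩
            simp only at h
            rw [sc_not, ← h]
            cases b <;> simp
        rw [sc_not] at hpq
        rw [← h, sc_add_smul, sc_add_smul, hpq]
        apply le_of_eq
        ring
    obtain ⟨ε, hε, h⟩ := Metric.eventually_nhds_iff.1 key
    refine ⟨ε / 2, by positivity, h ?_, h ?_⟩ <;>
    simp [abs_of_pos hε, hε.lt]

/-- A vector can be made discrete without violating inequalities of the relevant form and
without increasing a given linear function. -/
theorem exists_discrete_vector (δ : ℝ) {x : Fin m → ℝ} (hx : ∀ i, x i ∈ Set.Icc (0 : ℝ) 1)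
    (l : (Fin m → ℝ) →ₗ[ℝ] ℝ) : ∃ y, Pres δ x y ∧ l y ≤ l x ∧
      ∀ i, ∃ c b : ℤ, |b| ≤ 2 * m ∧ 2 * y i = c + 2 * δ * b := by
  have hl : Continuous l := l.continuous_of_finiteDimensional
  set F := {y ∈ cell δ x | ∀ z ∈ cell δ x, l y ≤ l z} with hF
  have hFc : IsCompact F := by
    refine (isCompact_cell hx).of_isClosed_subset ?_ fun y hy => hy.1
    have : F = cell δ x ∩ ⋂ z ∈ cell δ x, {y | l y ≤ l z} := by
      ext y; simp [hF]
    rw [this]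
    exact (isCompact_cell hx).isClosed.inter
      (isClosed_biInter fun z _ => isClosed_le hl continuous_const)
  have hFne : F.Nonempty := by
    obtain ⟨y, hy, hmin⟩ := (isCompact_cell hx).exists_isMinOn ⟨x, self_mem_cell δ x⟩
      hl.continuousOn
    exact ⟨y, hy, fun z hz => hmin hz⟩
  -- Take an extreme point of the set `F` of minimizers. A direction `v` as in `exists_direction`
  -- would satisfy `l v = 0`, since neither of the two opposite moves can decrease `l`. Both moved
  -- points would then lie in `F`, with `y` as their midpoint.
  obtain ⟨y, hyF, hext⟩ := hFc.extremePoints_nonempty hFne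
  refine ⟨y, pres_of_mem_cell hyF.1, hyF.2 x (self_mem_cell δ x), fun i => ?_⟩
  by_contra hi
  obtain ⟨v, hv, t, ht, h1, h2⟩ := exists_direction hyF.1 hi
  have e1 := hyF.2 _ h1
  have e2 := hyF.2 _ h2
  simp only [map_add, map_smul, smul_eq_mul] at e1 e2
  have hlv : t * l v = 0 := by linarith
  have m1 : y + t • v ∈ F := ⟨h1, fun z hz => by
    simp only [map_add, map_smul, smul_eq_mul]; linarith [hyF.2 z hz]⟩
  have m2 : y + (-t) • v ∈ F := ⟨h2, fun z hz => by
    simp only [map_add, map_smul, smul_eq_mul]; linarith [hyF.2 z hz]⟩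
  have := hext m1 m2 ⟨1 / 2, 1 / 2, by norm_num, by norm_num, by norm_num, by
    ext j; simp; ring⟩
  have hz : t • v = 0 := by simpa using this
  rcases smul_eq_zero.1 hz with h | h
  exacts [ht.ne' h, hv h]

end Discrete

end DeltaTour

/-! ### How many points suffice. -/

namespace DeltaTour

section Count

variable {V : Type*} [DecidableEq V] [Fintype V]

set_option linter.unusedSectionVars false

theorem exists_vertex_between {G : SimpleGraph V} (hG : G.Connected) {u v : V} {i : ℕ}
    (hi : i ≤ G.dist u v) : ∃ x, G.dist u x = i ∧ i + G.dist x v = G.dist u v := by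
  obtain ⟨w, hw⟩ := hG.exists_walk_length_eq_dist u v
  have h1 := SimpleGraph.dist_le (w.take i)
  have h2 := SimpleGraph.dist_le (w.drop i)
  have h3 := hG.dist_triangle (u := u) (v := w.getVert i) (w := v)
  rw [SimpleGraph.Walk.take_length] at h1
  rw [SimpleGraph.Walk.drop_length] at h2
  exact ⟨w.getVert i, by omega, by omega⟩

theorem coord_mem {G : SimpleGraph V} {p : V → ℝ} (hp : p ∈ points G) (u : V) :
    p u ∈ Set.Icc (0 : ℝ) 1 := by
  by_cases h0 : p u = 0
  · simp [h0]
  · obtain rfl | ⟨v, a, h, ha, rfl⟩ := eq_or_edgePt_of_ne_zero hp h0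
    · simp [vertexPt_self]
    · rw [edgePt_left h.ne]
      exact ⟨by linarith [ha.2], by linarith [ha.1]⟩

theorem SameEdge.dist_le_one {G : SimpleGraph V} {p q : V → ℝ} (h : SameEdge G p q) :
    dist p q ≤ 1 := by
  obtain ⟨u, v, a, b, h, ha, hb, rfl, rfl⟩ := h
  rw [dist_edgePt h.ne, abs_le]
  exact ⟨by linarith [ha.2, hb.1], by linarith [ha.1, hb.2]⟩

theorem mem_between {G : SimpleGraph V} (hG : G.Connected) {K : Finset (V → ℝ)} {r : ℝ}
    {p q x : V → ℝ} (hp : p ∈ points G) (hq : q ∈ points G) (hx : x ∈ points G) (hxK : x ∈ K)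
    {a b : ℝ} (ha : pd G p x ≤ a) (hb : pd G x q ≤ b) (hab : a + b ≤ pd G p q) (har : a ≤ r) :
    x ∈ between G K r p q := by
  have := pd_triangle hG hp hx hq
  simp only [between, Finset.mem_filter]
  exact ⟨hxK, by linarith, by linarith⟩

/-- The distance exceeds `2`, so a shortest route passes vertices. With `t = ⌊δ / 4⌋`, the vertices
at distances `0, …, t - 1` from its first vertex on a shortest path lie within `δ / 4` of `p`, and
`t > δ / 4 - 1 > δ / 8` because `δ > 8`. -/
theorem vertices_between {G : SimpleGraph V} (hG : G.Connected) {δ : ℝ} (hδ : 8 < δ)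
    {p q : V → ℝ} (hp : p ∈ points G) (hq : q ∈ points G) (hpq : δ / 4 < pd G p q) :
    δ / 8 ≤ (between G (Finset.univ.image vertexPt) (δ / 4) p q).card := by
  obtain ⟨u, u', hu, hu', he⟩ | ⟨hs, he⟩ := route_pd hG hp hq
  · have hpu := coord_mem hp u
    have hqu := coord_mem hq u'
    have hpu' : 0 < p u := lt_of_le_of_ne hpu.1 (Ne.symm hu)
    have hqu' : 0 < q u' := lt_of_le_of_ne hqu.1 (Ne.symm hu')
    set t := ⌊δ / 4⌋₊ with ht
    have ht1 : (t : ℝ) ≤ δ / 4 := Nat.floor_le (by linarith)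
    have ht2 : δ / 4 < t + 1 := Nat.lt_floor_add_one _
    have htD : ∀ i < t, i ≤ G.dist u u' := by
      intro i hi
      have h1 : (i : ℝ) + 1 ≤ t := by exact_mod_cast hi
      have h2 : (i : ℝ) < G.dist u u' + 1 := by linarith
      have h3 : i < G.dist u u' + 1 := by exact_mod_cast h2
      omega
    have : Nonempty V := ⟨u⟩
    choose! x hx1 hx2 using fun i (hi : i < t) => exists_vertex_between hG (htD i hi)
    have hsub : (Finset.range t).image (fun i => (vertexPt (x i) : V → ℝ)) ⊆
        between G (Finset.univ.image vertexPt) (δ / 4) p q := by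
      intro y hy
      obtain ⟨i, hi, rfl⟩ := Finset.mem_image.1 hy
      have hi := Finset.mem_range.1 hi
      have h1 := pd_le ((Conn.to_vertex hp hu).trans (Conn.vertex hG u (x i)))
      have h2 := pd_le ((Conn.vertex hG (x i) u').trans (Conn.to_vertex hq hu').symm)
      have h3 : (i : ℝ) + 1 ≤ t := by exact_mod_cast hi
      have h4 : (i : ℝ) + G.dist (x i) u' = G.dist u u' := by exact_mod_cast hx2 i hi
      rw [hx1 i hi] at h1
      exact mem_between hG hp hq (vertexPt_mem G _)
        (Finset.mem_image_of_mem _ (Finset.mem_univ _)) h1 h2 (by linarith) (by linarith)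
    have hcard := Finset.card_le_card hsub
    rw [Finset.card_image_of_injOn, Finset.card_range] at hcard
    · have : (t : ℝ) ≤ (between G (Finset.univ.image vertexPt) (δ / 4) p q).card := by
        exact_mod_cast hcard
      linarith
    · intro i hi j hj hij
      have hi := Finset.mem_range.1 hi
      have hj := Finset.mem_range.1 hj
      have : x i = x j := vertexPt_ne_zero (by
        rw [← show vertexPt (x i) = vertexPt (x j) from hij, vertexPt_self]
        exact one_ne_zero)
      rw [← hx1 i hi, ← hx1 j hj, this]
  · linarith [hs.dist_le_one]

open Classical in
/-- All vertices and the multiples of `1 / N` on all edges. -/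
noncomputable def markers (G : SimpleGraph V) (N : ℕ) : Finset (V → ℝ) :=
  Finset.univ.image vertexPt ∪
    ((Finset.univ ×ˢ Finset.univ ×ˢ Finset.range (N + 1)).filter
      fun x : V × V × ℕ => G.Adj x.1 x.2.1).image
      fun x => edgePt x.1 x.2.1 (x.2.2 / N)

theorem card_markers_le (G : SimpleGraph V) (N : ℕ) : (markers G N).card ≤
    Fintype.card V + Fintype.card V * (Fintype.card V * (N + 1)) := by
  classical
  refine (Finset.card_union_le _ _).trans (add_le_add ?_ ?_)
  · exact Finset.card_image_le
  · refine Finset.card_image_le.trans ((Finset.card_filter_le _ _).trans ?_)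
    simp

theorem markers_subset {G : SimpleGraph V} {N : ℕ} (hN : 0 < N) {x : V → ℝ}
    (hx : x ∈ markers G N) : x ∈ points G := by
  classical
  simp only [markers, Finset.mem_union, Finset.mem_image, Finset.mem_univ, true_and,
    Finset.mem_filter, Finset.mem_product, Finset.mem_range] at hx
  obtain ⟨u, rfl⟩ | ⟨⟨u, v, j⟩, ⟨hj, h⟩, rfl⟩ := hx
  · exact vertexPt_mem G u
  · have hN' : (0 : ℝ) < N := by exact_mod_cast hN
    have hj' : (j : ℝ) ≤ N := by exact_mod_cast Nat.lt_succ_iff.1 hj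
    exact edgePt_mem h ⟨by positivity, (div_le_one hN').2 hj'⟩

theorem vertexPt_mem_markers (G : SimpleGraph V) (N : ℕ) (u : V) :
    vertexPt u ∈ markers G N :=
  Finset.mem_union_left _ (Finset.mem_image_of_mem _ (Finset.mem_univ u))

theorem edgePt_mem_markers {G : SimpleGraph V} {N j : ℕ} (hj : j ≤ N) {u v : V}
    (h : G.Adj u v) : edgePt u v (j / N) ∈ markers G N := by
  classical
  refine Finset.mem_union_right _ (Finset.mem_image.2 ⟨(u, v, j), ?_, rfl⟩)
  simp only [Finset.mem_filter, Finset.mem_product, Finset.mem_univ, Finset.mem_range, true_and]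
  exact ⟨by omega, h⟩

/-- Below every position on an edge there is a marker close by. -/
theorem exists_marker_below {G : SimpleGraph V} {N : ℕ} (hN : 0 < N) {u v : V} (h : G.Adj u v)
    {a : ℝ} (ha : a ∈ Set.Icc (0 : ℝ) 1) : ∃ c : ℝ, 0 ≤ c ∧ c ≤ a ∧ a < c + 1 / N ∧
      edgePt u v c ∈ markers G N := by
  have hN' : (0 : ℝ) < N := by exact_mod_cast hN
  have h0 : 0 ≤ a * N := mul_nonneg ha.1 hN'.le
  refine ⟨(⌊a * N⌋₊ : ℝ) / N, by positivity, ?_, ?_, edgePt_mem_markers ?_ h⟩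
  · rw [div_le_iff₀ hN']
    exact Nat.floor_le h0
  · rw [← add_div, lt_div_iff₀ hN']
    exact Nat.lt_floor_add_one _
  · have : ⌊a * N⌋₊ ≤ ⌊(N : ℝ)⌋₊ := Nat.floor_le_floor (by nlinarith [ha.2])
    simpa using this

/-- Follow a shortest route from `p`. Either its first vertex is within `r`, or the piece of length
`r` at `p` lies inside one edge and is at least as long as the spacing `1 / N` of the markers. -/
theorem marker_between {G : SimpleGraph V} (hG : G.Connected) {r : ℝ} {N : ℕ} (hN : 0 < N)
    (hr : 1 / (N : ℝ) ≤ r) {p q : V → ℝ} (hp : p ∈ points G) (hq : q ∈ points G)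
    (hpq : r < pd G p q) : 1 ≤ (between G (markers G N) r p q).card := by
  suffices h : ∃ x, x ∈ between G (markers G N) r p q from Finset.card_pos.2 h
  -- Here the route runs down the edge `uv` from position `a` to position `c`, and the marker just
  -- below `a` lies on it.
  have key : ∀ u v a c, G.Adj u v → a ∈ Set.Icc (0 : ℝ) 1 → 0 ≤ c → r < a - c →
      p = edgePt u v a → a - c + pd G (edgePt u v c) q ≤ pd G p q →
      ∃ x, x ∈ between G (markers G N) r p q := by
    intro u v a c h ha hc hac he hle
    obtain ⟨b, hb0, hba, hab, hb⟩ := exists_marker_below hN h ha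
    have hbI : b ∈ Set.Icc (0 : ℝ) 1 := ⟨hb0, hba.trans ha.2⟩
    have hcI : c ∈ Set.Icc (0 : ℝ) 1 := ⟨hc, by
      have : (0 : ℝ) ≤ 1 / N := by positivity
      linarith [ha.2]⟩
    have h1 : pd G p (edgePt u v b) ≤ a - b := by
      have := pd_le_dist (G := G) (p := p) (q := edgePt u v b) ⟨u, v, a, b, h, ha, hbI, he, rfl⟩
      rwa [he, dist_edgePt h.ne, abs_of_nonpos (by linarith), neg_sub, ← he] at this
    have h2 : pd G (edgePt u v b) (edgePt u v c) ≤ b - c := by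
      have := pd_le_dist (G := G) (p := edgePt u v b) (q := edgePt u v c)
        ⟨u, v, b, c, h, hbI, hcI, rfl, rfl⟩
      rwa [dist_edgePt h.ne, abs_of_nonpos (by linarith), neg_sub] at this
    have h3 := pd_triangle hG (edgePt_mem h hbI) (edgePt_mem h hcI) hq
    exact ⟨_, mem_between hG hp hq (edgePt_mem h hbI) hb h1 le_rfl (by linarith) (by linarith)⟩
  obtain ⟨u, u', hu, hu', he⟩ | ⟨hs, he⟩ := route_pd hG hp hq
  · have h1 := pd_le (Conn.to_vertex hp hu)
    have h2 := pd_le ((Conn.vertex hG u u').trans (Conn.to_vertex hq hu').symm)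
    by_cases hr' : 1 - p u ≤ r
    · exact ⟨_, mem_between hG hp hq (vertexPt_mem G u) (vertexPt_mem_markers G N u) h1 h2
        (by linarith) hr'⟩
    · obtain rfl | ⟨v, a, h, ha, hpe⟩ := eq_or_edgePt_of_ne_zero hp hu
      · rw [vertexPt_self] at hr'
        have : (0 : ℝ) ≤ 1 / N := by positivity
        exact absurd (by linarith) hr'
      · have hpu : p u = 1 - a := by rw [hpe, edgePt_left h.ne]
        refine key u v a 0 h ha le_rfl (by linarith) hpe ?_
        rw [edgePt_zero]
        linarith
  · obtain ⟨u, v, a, b, h, ha, hb, hpe, hqe⟩ := hs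
    rw [hpe, hqe, dist_edgePt h.ne, ← hpe, ← hqe] at he
    rcases le_total a b with hab | hab
    · rw [abs_of_nonneg (by linarith)] at he
      refine key v u (1 - a) (1 - b) h.symm ⟨by linarith [ha.2], by linarith [ha.1]⟩
        (by linarith [hb.2]) (by linarith) (by rw [hpe, edgePt_swap]) ?_
      rw [edgePt_swap, ← hqe, pd_self hq]
      linarith
    · rw [abs_of_nonpos (by linarith)] at he
      refine key u v a b h ha hb.1 (by linarith) hpe ?_
      rw [← hqe, pd_self hq]
      linarith

/-- The number of points that suffice to describe a shortest tour. -/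
def fewPts (n k : ℕ) : ℕ := 700 * k * (if n ≤ 8 * k then k * k else 1)

/-- The two cases are separated by `n` and `k` instead of `δ`, which the program can test with
integers. From `n ≤ k * δ`, the case `n > 8 * k` gives `δ > 8`, and weight `δ / 8` per point leads
to a bound linear in `k`. In the case `n ≤ 8 * k` the number of markers is a function of `k` only.
-/
theorem exists_fewPts {n : ℕ} {G : SimpleGraph (Fin n)} (hG : G.Connected) {δ : ℝ} (hδ : 0 < δ)
    {T : List (Fin n → ℝ)} (hT : IsDeltaTour G δ T) : ∃ g : ℕ → Fin n → ℝ,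
      (∀ i, g i ∈ points G) ∧ g (fewPts n ⌈n / δ⌉₊) = g 0 ∧
      (∀ p ∈ points G, ∃ i < fewPts n ⌈n / δ⌉₊, pd G p (g i) ≤ δ) ∧
      ∑ i ∈ Finset.range (fewPts n ⌈n / δ⌉₊), pd G (g i) (g (i + 1)) ≤ len T := by
  classical
  obtain ⟨v₀⟩ := hG.nonempty
  have hn : 1 ≤ n := v₀.pos
  have hn' : (1 : ℝ) ≤ n := by exact_mod_cast hn
  set k := ⌈n / δ⌉₊ with hk
  have hk1 : (n : ℝ) / δ ≤ k := Nat.le_ceil _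
  have hk2 : (n : ℝ) ≤ k * δ := (div_le_iff₀ hδ).1 hk1
  have hk0 : 0 < k := Nat.ceil_pos.2 (by positivity)
  have hk0' : (1 : ℝ) ≤ k := by exact_mod_cast hk0
  by_cases hnk : n ≤ 8 * k
  · have hN : 0 < 4 * k := by omega
    -- The spacing is fine enough because `1 ≤ n ≤ k * δ`.
    have hr : 1 / ((4 * k : ℕ) : ℝ) ≤ δ / 4 := by
      rw [div_le_iff₀ (by exact_mod_cast hN)]
      push_cast
      linarith
    refine exists_few_points hG hδ (K := markers G (4 * k)) (fun x hx => markers_subset hN hx)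
      one_pos (fun p hp q hq hpq => by exact_mod_cast marker_between hG hN hr hp hq hpq) ?_ hT
    have h1 := card_markers_le G (4 * k)
    rw [Fintype.card_fin] at h1
    have h2 : n + n * (n * (4 * k + 1)) ≤ 8 * k + 8 * k * (8 * k * (4 * k + 1)) := by gcongr
    have h3 : fewPts n k = 700 * k * (k * k) := by rw [fewPts, if_pos hnk]
    -- Twice the marker bound `8 * k + 64 * k ^ 2 * (4 * k + 1)`, plus one, is at most `657 * k ^
    -- 3`; this is the source of the constant `700`.
    have h4 : 2 * (markers G (4 * k)).card + 1 ≤ fewPts n k * 1 := by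
      rw [h3]
      have : 1 ≤ k * k := Nat.mul_pos hk0 hk0
      nlinarith
    exact_mod_cast h4
  · have hδ8 : 8 < δ := by
      by_contra! h
      have : (n : ℝ) ≤ 8 * k := by nlinarith
      exact hnk (by exact_mod_cast this)
    refine exists_few_points hG hδ (K := Finset.univ.image vertexPt) (w := δ / 8) (fun x hx => ?_)
      (by positivity) (fun p hp q hq hpq => vertices_between hG hδ8 hp hq hpq) ?_ hT
    · obtain ⟨u, -, rfl⟩ := Finset.mem_image.1 hx
      exact vertexPt_mem G u
    · have h1 : ((Finset.univ.image (vertexPt : Fin n → Fin n → ℝ)).card : ℝ) ≤ n := by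
        have := Finset.card_image_le (s := (Finset.univ : Finset (Fin n)))
          (f := (vertexPt : Fin n → Fin n → ℝ))
        rw [Finset.card_univ, Fintype.card_fin] at this
        exact_mod_cast this
      have h3 : (fewPts n k : ℝ) = 700 * k := by rw [fewPts, if_neg hnk]; push_cast; ring
      rw [h3]
      nlinarith

end Count

end DeltaTour

/-! ### Covering and length under a change of positions. -/

namespace DeltaTour

section DiscreteTuple

variable {n m : ℕ}

/-- Every point of the graph has distance at most `δ` to one of the given points. -/
def Covers (G : SimpleGraph (Fin n)) (δ : ℝ) (s : Fin m → Tri n) : Prop :=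
  (∀ w, ∃ i, vd G w (s i) ≤ δ) ∧
    ∀ a b, G.Adj a b → a < b → ∀ x ∈ Set.Icc (0 : ℝ) 1, ∃ i, td G ⟨a, b, x⟩ (s i) ≤ δ

open Classical in
/-- Left ends of the intervals of an edge `ab` that are covered by a point. -/
noncomputable def leftEnd (G : SimpleGraph (Fin n)) (δ : ℝ) (a b : Fin n) (t : Tri n) : Fin 5 → ℝ :=
  ![0, 0, 1 + (t.a + G.dist t.u b) - δ, 1 + (1 - t.a + G.dist t.v b) - δ,
    if a = t.u ∧ b = t.v then t.a - δ else 2]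

open Classical in
/-- Right ends of the intervals of an edge `ab` that are covered by a point. -/
noncomputable def rightEnd (G : SimpleGraph (Fin n)) (δ : ℝ) (a b : Fin n) (t : Tri n) :
    Fin 5 → ℝ :=
  ![δ - (t.a + G.dist t.u a), δ - (1 - t.a + G.dist t.v a), 1, 1,
    if a = t.u ∧ b = t.v then t.a + δ else -1]

/-- A route from the position `x` leaves the edge at `a`, towards either end of the edge of `t`, and
covers an interval starting at `0`; or it leaves at `b` and covers an interval ending at `1`; or it
stays inside the edge. The values `2` and `-1` make the last interval miss the unit interval if `t`
is on another edge. -/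
theorem td_le_iff_ends {G : SimpleGraph (Fin n)} {δ : ℝ} {a b : Fin n} {t : Tri n} {x : ℝ}
    (hx : x ∈ Set.Icc (0 : ℝ) 1) :
    td G ⟨a, b, x⟩ t ≤ δ ↔ ∃ k, leftEnd G δ a b t k ≤ x ∧ x ≤ rightEnd G δ a b t k := by
  have h0 := hx.1
  have h1 := hx.2
  have key : rd G ⟨a, b, x⟩ t ≤ δ ↔ (0 ≤ x ∧ x ≤ δ - (t.a + G.dist t.u a)) ∨
      (0 ≤ x ∧ x ≤ δ - (1 - t.a + G.dist t.v a)) ∨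
      (1 + (t.a + G.dist t.u b) - δ ≤ x ∧ x ≤ 1) ∨
      (1 + (1 - t.a + G.dist t.v b) - δ ≤ x ∧ x ≤ 1) := by
    simp only [rd, vd, min_le_iff, add_min, h0, h1, true_and, and_true, or_assoc]
    refine or_congr ?_ (or_congr ?_ (or_congr ?_ ?_)) <;> constructor <;> intro h <;> linarith
  by_cases h : a = t.u ∧ b = t.v
  · have e : td G ⟨a, b, x⟩ t = min (rd G ⟨a, b, x⟩ t) |t.a - x| := if_pos h
    simp only [e, min_le_iff, key, abs_le, Fin.exists_fin_succ, leftEnd, rightEnd, if_pos h]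
    simp only [Matrix.cons_val_zero, Matrix.cons_val_succ, or_assoc, IsEmpty.exists_iff, or_false]
    refine or_congr Iff.rfl (or_congr Iff.rfl (or_congr Iff.rfl (or_congr Iff.rfl ?_)))
    constructor <;> intro h <;> constructor <;> linarith [h.1, h.2]
  · have e : td G ⟨a, b, x⟩ t = rd G ⟨a, b, x⟩ t := if_neg h
    simp only [e, key, Fin.exists_fin_succ, leftEnd, rightEnd, if_neg h]
    simp only [Matrix.cons_val_zero, Matrix.cons_val_succ, IsEmpty.exists_iff, or_false]
    refine or_congr Iff.rfl (or_congr Iff.rfl (or_congr Iff.rfl ?_))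
    have : ¬ (2 ≤ x ∧ x ≤ -1) := fun h => by linarith [h.1]
    simp only [this, or_false]

/-- An expression that may be a left end, as a function of the positions of all points. -/
def LowForm (δ : ℝ) (f : (Fin m → ℝ) → ℝ) : Prop :=
  (∃ c : ℤ, ∀ y, f y = c) ∨ ∃ (p : Fin m × Bool) (c : ℤ), ∀ y, f y = sc y p + c - δ

/-- An expression that may be a right end, as a function of the positions of all points. -/
def UpForm (δ : ℝ) (f : (Fin m → ℝ) → ℝ) : Prop :=
  (∃ c : ℤ, ∀ y, f y = c) ∨ ∃ (p : Fin m × Bool) (c : ℤ), ∀ y, f y = sc y p + c + δ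

/-- Comparing ends `± x i + c - δ` and `± x j + d + δ` yields two signed coordinates and `2 * δ`. If
only one coordinate occurs, doubling the inequality brings it into the same form. This is why `Pres`
speaks of sums of two signed coordinates and of `2 * δ`. -/
theorem Pres.low_le_up {δ : ℝ} {x y : Fin m → ℝ} (h : Pres δ x y) {f g : (Fin m → ℝ) → ℝ}
    (hf : LowForm δ f) (hg : UpForm δ g) (hle : f x ≤ g x) : f y ≤ g y := by
  obtain ⟨c, hf⟩ | ⟨p, c, hf⟩ := hf <;> obtain ⟨d, hg⟩ | ⟨q, d, hg⟩ := hg <;>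
    rw [hf, hg] at hle ⊢
  · exact hle
  · have := h (q.1, !q.2) (q.1, !q.2) true (2 * (d - c))
      (by rw [sc_not]; push_cast; rw [if_pos rfl]; linarith)
    rw [sc_not, if_pos rfl] at this
    push_cast at this
    linarith
  · have := h p p true (2 * (d - c)) (by push_cast; rw [if_pos rfl]; linarith)
    rw [if_pos rfl] at this
    push_cast at this
    linarith
  · have := h p (q.1, !q.2) true (d - c) (by rw [sc_not]; push_cast; rw [if_pos rfl]; linarith)
    rw [sc_not, if_pos rfl] at this
    push_cast at this
    linarith

/-- The points of a tuple, moved to the given positions. -/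
def move (s : Fin m → Tri n) (y : Fin m → ℝ) (i : Fin m) : Tri n := ⟨(s i).u, (s i).v, y i⟩

theorem lowForm_leftEnd (G : SimpleGraph (Fin n)) (δ : ℝ) (a b : Fin n) (s : Fin m → Tri n)
    (i : Fin m) (k : Fin 5) : LowForm δ fun y => leftEnd G δ a b (move s y i) k := by
  fin_cases k
  · exact .inl ⟨0, fun y => by simp [leftEnd]⟩
  · exact .inl ⟨0, fun y => by simp [leftEnd]⟩
  · exact .inr ⟨(i, true), 1 + G.dist (s i).u b, fun y => by
      simp [leftEnd, move, sc]; ring⟩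
  · exact .inr ⟨(i, false), 2 + G.dist (s i).v b, fun y => by
      simp [leftEnd, move, sc]; ring⟩
  · by_cases h : a = (s i).u ∧ b = (s i).v
    · exact .inr ⟨(i, true), 0, fun y => by simp [leftEnd, move, sc, h]⟩
    · exact .inl ⟨2, fun y => by simp [leftEnd, move, h]⟩

theorem upForm_rightEnd (G : SimpleGraph (Fin n)) (δ : ℝ) (a b : Fin n) (s : Fin m → Tri n)
    (i : Fin m) (k : Fin 5) : UpForm δ fun y => rightEnd G δ a b (move s y i) k := by
  fin_cases k
  · exact .inr ⟨(i, false), -G.dist (s i).u a, fun y => by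
      simp [rightEnd, move, sc]; ring⟩
  · exact .inr ⟨(i, true), -1 - G.dist (s i).v a, fun y => by
      simp [rightEnd, move, sc]; ring⟩
  · exact .inl ⟨1, fun y => by simp [rightEnd]⟩
  · exact .inl ⟨1, fun y => by simp [rightEnd]⟩
  · by_cases h : a = (s i).u ∧ b = (s i).v
    · exact .inr ⟨(i, true), 0, fun y => by simp [rightEnd, move, sc, h]⟩
    · exact .inl ⟨-1, fun y => by simp [rightEnd, move, h]⟩

/-- Covering an edge is decided by comparisons of left and right ends, by `cover_of_cover`, and
covering a vertex by a comparison with `0`. All of them are inherited. -/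
theorem Pres.covers {G : SimpleGraph (Fin n)} {δ : ℝ} {s : Fin m → Tri n} {y : Fin m → ℝ}
    (h : Pres δ (fun i => (s i).a) y) (hs : Covers G δ s) : Covers G δ (move s y) := by
  constructor
  · intro w
    obtain ⟨i, hi⟩ := hs.1 w
    refine ⟨i, ?_⟩
    have c0 : UpForm (m := m) δ fun _ => 0 := .inl ⟨0, fun _ => by simp⟩
    rw [vd, min_le_iff] at hi ⊢
    refine hi.imp (fun hi => ?_) fun hi => ?_
    · have f : LowForm (m := m) δ fun y => y i + G.dist (s i).u w - δ :=
        .inr ⟨(i, true), G.dist (s i).u w, fun y => by simp [sc]⟩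
      have := h.low_le_up f c0 (by linarith)
      simp only [move]
      linarith
    · have f : LowForm (m := m) δ fun y => 1 - y i + G.dist (s i).v w - δ :=
        .inr ⟨(i, false), 1 + G.dist (s i).v w, fun y => by simp [sc]; ring⟩
      have := h.low_le_up f c0 (by linarith)
      simp only [move]
      linarith
  · intro a b hab hlt
    have e : ∀ s : Fin m → Tri n, (∀ x ∈ Set.Icc (0 : ℝ) 1, ∃ i, td G ⟨a, b, x⟩ (s i) ≤ δ) ↔
        ∀ x ∈ Set.Icc (0 : ℝ) 1, ∃ k : Fin m × Fin 5,
          leftEnd G δ a b (s k.1) k.2 ≤ x ∧ x ≤ rightEnd G δ a b (s k.1) k.2 := by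
      refine fun s => forall₂_congr fun x hx => ?_
      simp only [td_le_iff_ends hx, Prod.exists]
    rw [e]
    have hs2 := (e s).1 (hs.2 a b hab hlt)
    refine cover_of_cover (fun k k' hk => ?_) (fun k hk => ?_) (fun k hk => ?_) hs2
    · exact h.low_le_up (lowForm_leftEnd G δ a b s k.1 k.2) (upForm_rightEnd G δ a b s k'.1 k'.2) hk
    · exact h.low_le_up (g := fun _ => 0) (lowForm_leftEnd G δ a b s k.1 k.2)
        (.inl ⟨0, fun _ => by simp⟩) hk
    · exact h.low_le_up (f := fun _ => 1) (.inl ⟨1, fun _ => by simp⟩)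
        (upForm_rightEnd G δ a b s k.1 k.2) hk

theorem Pres.weak {G : SimpleGraph (Fin n)} {δ : ℝ} {s : Fin m → Tri n} {y : Fin m → ℝ}
    (h : Pres δ (fun i => (s i).a) y) (hs : ∀ i, (s i).Weak G) (i : Fin m) :
    (move s y i).Weak G := by
  have hy := h.mem_Icc (fun i => ⟨(hs i).nonneg, (hs i).le_one⟩) i
  rcases hs i with hw | hw
  · exact .inl ⟨hw.1, hw.2.1, hy.1, hy.2⟩
  · refine .inr ⟨hw.1, le_antisymm ?_ hy.1⟩
    have := h (i, true) (i, true) false 0 (by simp [sc, hw.2])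
    simp [sc] at this
    simp only [move]
    linarith

/-- The distance is a minimum of affine expressions. One that attains the minimum at the given
positions remains an upper bound wherever the points are moved. -/
theorem exists_affine {G : SimpleGraph (Fin n)} {δ : ℝ} (s : Fin m → Tri n) (i j : Fin m) :
    ∃ (p q : Fin m × Bool) (c : ℝ),
      td G (s i) (s j) = sc (fun i => (s i).a) p + sc (fun i => (s i).a) q + c ∧
      ∀ y, Pres δ (fun i => (s i).a) y → td G (move s y i) (move s y j) ≤ sc y p + sc y q + c := by
  have hrd : ∃ (p q : Fin m × Bool) (c : ℝ),
      rd G (s i) (s j) = sc (fun i => (s i).a) p + sc (fun i => (s i).a) q + c ∧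
      ∀ y, rd G (move s y i) (move s y j) ≤ sc y p + sc y q + c := by
    have e : ∀ s t : Tri n, rd G s t = min (min (s.a + t.a + G.dist t.u s.u)
        (s.a - t.a + (1 + G.dist t.v s.u))) (min (-s.a + t.a + (1 + G.dist t.u s.v))
          (-s.a - t.a + (2 + G.dist t.v s.v))) := by
      intro s t
      simp only [rd, vd, add_min]
      congr 2 <;> ring_nf
    simp only [e]
    rcases min_choice (min ((s i).a + (s j).a + G.dist (s j).u (s i).u)
        ((s i).a - (s j).a + (1 + G.dist (s j).v (s i).u)))
        (min (-(s i).a + (s j).a + (1 + G.dist (s j).u (s i).v))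
          (-(s i).a - (s j).a + (2 + G.dist (s j).v (s i).v))) with h | h <;> rw [h]
    · rcases min_choice ((s i).a + (s j).a + G.dist (s j).u (s i).u)
        ((s i).a - (s j).a + (1 + G.dist (s j).v (s i).u)) with h | h <;> rw [h]
      · exact ⟨(i, true), (j, true), _, by simp only [sc, if_true]; rfl, fun y =>
          (min_le_left _ _).trans ((min_le_left _ _).trans (le_of_eq (by simp [sc, move])))⟩
      · exact ⟨(i, true), (j, false), _, by simp [sc, sub_eq_add_neg]; rfl, fun y =>
          (min_le_left _ _).trans ((min_le_right _ _).trans (le_of_eq (by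
            simp [sc, move, sub_eq_add_neg])))⟩
    · rcases min_choice (-(s i).a + (s j).a + (1 + G.dist (s j).u (s i).v))
        (-(s i).a - (s j).a + (2 + G.dist (s j).v (s i).v)) with h | h <;> rw [h]
      · exact ⟨(i, false), (j, true), _, by simp [sc]; rfl, fun y =>
          (min_le_right _ _).trans ((min_le_left _ _).trans (le_of_eq (by simp [sc, move])))⟩
      · exact ⟨(i, false), (j, false), _, by simp [sc, sub_eq_add_neg]; rfl, fun y =>
          (min_le_right _ _).trans ((min_le_right _ _).trans (le_of_eq (by
            simp [sc, move, sub_eq_add_neg])))⟩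
  obtain ⟨p, q, c, h1, h2⟩ := hrd
  by_cases hsame : (s i).u = (s j).u ∧ (s i).v = (s j).v
  · rcases min_choice (rd G (s i) (s j)) |(s j).a - (s i).a| with h | h
    · exact ⟨p, q, c, by rw [td, if_pos hsame, h, h1], fun y _ => (td_le_rd _ _ _).trans (h2 y)⟩
    · rcases le_total (s i).a (s j).a with hle | hle
      · refine ⟨(j, true), (i, false), 0, ?_, fun y hy => ?_⟩
        · rw [td, if_pos hsame, h, abs_of_nonneg (by linarith)]
          simp [sc, sub_eq_add_neg]
        -- The order of the two positions is inherited, so the absolute value keeps its sign.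
        · have := hy (i, true) (j, false) false 0 (by simp [sc]; linarith)
          simp [sc] at this
          rw [td, if_pos (by exact hsame)]
          refine (min_le_right _ _).trans ?_
          simp only [move]
          rw [abs_of_nonneg (by linarith)]
          simp [sc, sub_eq_add_neg]
      · refine ⟨(i, true), (j, false), 0, ?_, fun y hy => ?_⟩
        · rw [td, if_pos hsame, h, abs_of_nonpos (by linarith)]
          simp [sc, sub_eq_add_neg]
        · have := hy (j, true) (i, false) false 0 (by simp [sc]; linarith)
          simp [sc] at this
          rw [td, if_pos (by exact hsame)]
          refine (min_le_right _ _).trans ?_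
          simp only [move]
          rw [abs_of_nonpos (by linarith)]
          simp [sc, sub_eq_add_neg]
  · exact ⟨p, q, c, by rw [td, if_neg hsame, h1], fun y _ => (td_le_rd _ _ _).trans (h2 y)⟩

/-- The signed coordinates as linear functions. -/
noncomputable def scl (p : Fin m × Bool) : (Fin m → ℝ) →ₗ[ℝ] ℝ :=
  if p.2 then LinearMap.proj p.1 else -LinearMap.proj p.1

theorem scl_apply (p : Fin m × Bool) (y : Fin m → ℝ) : scl p y = sc y p := by
  unfold scl sc
  split_ifs <;> simp

/-- The points of a covering tuple can be moved to discrete positions. -/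
theorem exists_discrete_tuple {G : SimpleGraph (Fin n)} {δ : ℝ} {s : Fin m → Tri n}
    (hs : ∀ i, (s i).Weak G) (hc : Covers G δ s) (nx : Fin m → Fin m) :
    ∃ s' : Fin m → Tri n, (∀ i, (s' i).Weak G) ∧ Covers G δ s' ∧
      (∀ i, ∃ c b : ℤ, |b| ≤ 2 * m ∧ 2 * (s' i).a = c + 2 * δ * b) ∧
      ∑ i, td G (s' i) (s' (nx i)) ≤ ∑ i, td G (s i) (s (nx i)) := by
  choose p q c h1 h2 using fun i => exists_affine (G := G) (δ := δ) s i (nx i)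
  obtain ⟨y, hy, hl, hd⟩ := exists_discrete_vector δ (x := fun i => (s i).a)
    (fun i => ⟨(hs i).nonneg, (hs i).le_one⟩) (∑ i, (scl (p i) + scl (q i)))
  refine ⟨move s y, hy.weak hs, hy.covers hc, hd, ?_⟩
  simp only [LinearMap.sum_apply, LinearMap.add_apply, scl_apply] at hl
  calc ∑ i, td G (move s y i) (move s y (nx i)) ≤ ∑ i, (sc y (p i) + sc y (q i) + c i) :=
        Finset.sum_le_sum fun i _ => h2 i y hy
    _ = ∑ i, (sc y (p i) + sc y (q i)) + ∑ i, c i := Finset.sum_add_distrib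
    _ ≤ ∑ i, (sc (fun i => (s i).a) (p i) + sc (fun i => (s i).a) (q i)) + ∑ i, c i := by
        linarith
    _ = ∑ i, td G (s i) (s (nx i)) := by
        rw [← Finset.sum_add_distrib]
        exact Finset.sum_congr rfl fun i _ => (h1 i).symm

end DiscreteTuple

end DeltaTour

/-! ## Tours through given points, and encodings of tuples of points -/

namespace DeltaTour

section Snoc

variable {V : Type*} [Fintype V] [DecidableEq V] {G : SimpleGraph V}

set_option linter.unusedSectionVars false

theorem len_append_singleton (T : List (V → ℝ)) {p : V → ℝ} (hp : T.getLast? = some p)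
    (q : V → ℝ) : len (T ++ [q]) = len T + dist p q := by
  induction T with
  | nil => simp at hp
  | cons x T ih =>
    cases T with
    | nil =>
      obtain rfl : x = p := by simpa using hp
      simp [len]
    | cons y T =>
      have := ih (by simpa using hp)
      simp only [List.cons_append, len] at this ⊢
      rw [this, add_assoc]

theorem IsWalkFromTo.singleton {p : V → ℝ} (hp : p ∈ points G) : IsWalkFromTo G p p [p] :=
  ⟨⟨by simp, by simpa using hp, by simp⟩, by simp, by simp⟩

theorem IsWalkFromTo.snoc {p q r : V → ℝ} {T : List (V → ℝ)} (h : IsWalkFromTo G p q T)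
    (hqr : q ≠ r) (hs : SameEdge G q r) :
    IsWalkFromTo G p r (T ++ [r]) ∧ len (T ++ [r]) = len T + dist q r := by
  obtain ⟨⟨h1, h2, h3⟩, h4, h5⟩ := h
  refine ⟨⟨⟨by simp, ?_, ?_⟩, ?_, by simp⟩, len_append_singleton T h5 r⟩
  · intro x hx
    rcases List.mem_append.1 hx with hx | hx
    · exact h2 x hx
    · rw [List.mem_singleton.1 hx]
      exact hs.symm.left_mem
  · refine List.isChain_append.2 ⟨h3, by simp, ?_⟩
    intro x hx y hy
    rw [h5] at hx
    simp only [Option.mem_def, Option.some.injEq] at hx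
    simp at hy
    subst hx
    subst hy
    exact ⟨hqr, hs⟩
  · cases T with
    | nil => exact absurd rfl h1
    | cons x T => simpa using h4

theorem Conn.extend {p q r : V → ℝ} {l : ℝ} (h : Conn G q r l) {T : List (V → ℝ)}
    (hT : IsWalkFromTo G p q T) :
    ∃ T', IsWalkFromTo G p r T' ∧ T ⊆ T' := by
  induction h generalizing T with
  | refl => exact ⟨T, hT, fun _ h => h⟩
  | @step q x r l hs _ ih =>
    by_cases hqx : q = x
    · subst hqx
      exact ih hT
    · obtain ⟨T', h1, h2⟩ := ih (hT.snoc hqx hs).1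
      exact ⟨T', h1, fun y hy => h2 (List.mem_append_left _ hy)⟩

theorem exists_tour_through (hG : G.Connected) {l : List (V → ℝ)} (hl : ∀ p ∈ l, p ∈ points G) :
    ∃ T, IsTour G T ∧ l ⊆ T := by
  obtain ⟨v⟩ := hG.nonempty
  have hv := vertexPt_mem G v
  have : ∃ q T, IsWalkFromTo G (vertexPt v) q T ∧ l ⊆ T := by
    induction l with
    | nil => exact ⟨_, _, IsWalkFromTo.singleton hv, by simp⟩
    | cons p l ih =>
      obtain ⟨q, T, hT, hs⟩ := ih fun p hp => hl p (List.mem_cons_of_mem _ hp)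
      have hq : q ∈ points G := hT.1.2.1 q (List.mem_of_getLast? hT.2.2)
      have hp := hl p List.mem_cons_self
      obtain ⟨T', h1, h2⟩ := (conn_pd hG hq hp).extend hT
      refine ⟨p, T', h1, ?_⟩
      rw [List.cons_subset]
      exact ⟨List.mem_of_getLast? h1.2.2, fun x hx => h2 (hs hx)⟩
  obtain ⟨q, T, hT, hs⟩ := this
  have hq : q ∈ points G := hT.1.2.1 q (List.mem_of_getLast? hT.2.2)
  obtain ⟨T', h1, h2⟩ := (conn_pd hG hq hv).extend hT
  exact ⟨T', ⟨_, h1⟩, fun x hx => h2 (hs hx)⟩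

theorem isDeltaTour_of_mem (hG : G.Connected) {δ : ℝ} {T : List (V → ℝ)} (hT : IsTour G T)
    (h : ∀ p ∈ points G, ∃ q ∈ T, pd G p q ≤ δ) : IsDeltaTour G δ T := by
  refine ⟨hT, fun p hp => ?_⟩
  obtain ⟨_, hw⟩ := hT
  obtain ⟨q, hq, hle⟩ := h p hp
  have hq' : q ∈ passed G T := by
    rw [passed_eq hw.1.2.2]
    exact mem_segments_of_mem hq
  refine (iInf₂_le q hq').trans ?_
  rw [ptDist_eq hG hp (hw.1.2.1 q hq)]
  exact ENNReal.ofReal_le_ofReal hle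

/-- A tour through a sufficiently fine set of markers. Its existence guarantees that the search
meets a covering tuple. -/
theorem exists_isDeltaTour (hG : G.Connected) {δ : ℝ} (hδ : 0 < δ) :
    ∃ T, IsDeltaTour G δ T := by
  obtain ⟨N, hN⟩ := exists_nat_gt (1 / δ)
  have hN0 : (0 : ℝ) < N := lt_trans (by positivity) hN
  have hN1 : 0 < N := by exact_mod_cast hN0
  have hN2 : 1 / (N : ℝ) < δ := by
    rw [div_lt_iff₀ hδ] at hN
    rw [div_lt_iff₀ hN0]
    linarith
  obtain ⟨T, hT, hs⟩ := exists_tour_through hG (l := (markers G N).toList)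
    fun p hp => markers_subset hN1 (Finset.mem_toList.1 hp)
  refine ⟨T, isDeltaTour_of_mem hG hT fun p hp => ?_⟩
  obtain ⟨u, rfl⟩ | ⟨u, v, a, h, ha, rfl⟩ := id hp
  · exact ⟨_, hs (Finset.mem_toList.2 (vertexPt_mem_markers G N u)), by rw [pd_self hp]; exact hδ.le⟩
  · obtain ⟨c, hc0, hca, hac, hc⟩ := exists_marker_below hN1 h ha
    refine ⟨_, hs (Finset.mem_toList.2 hc), ?_⟩
    refine (pd_le_dist ⟨u, v, a, c, h, ha, ⟨hc0, hca.trans ha.2⟩, rfl, rfl⟩).trans ?_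
    rw [dist_edgePt h.ne, abs_of_nonpos (by linarith)]
    linarith

end Snoc

/-! ### Encoding of tuples by numbers. -/

section Code

variable {n : ℕ} {G : SimpleGraph (Fin n)}

theorem exists_canon {p : Fin n → ℝ} (hp : p ∈ points G) : ∃ t : Tri n, t.Canon G ∧ t.pt = p := by
  obtain ⟨u, rfl⟩ | ⟨u, v, a, h, ha, rfl⟩ := hp
  · exact ⟨⟨u, u, 0⟩, .inr ⟨rfl, rfl⟩, edgePt_self u 0⟩
  · rcases eq_or_lt_of_le ha.1 with h0 | h0
    · exact ⟨⟨u, u, 0⟩, .inr ⟨rfl, rfl⟩, by rw [← h0, Tri.pt, edgePt_self, edgePt_zero]⟩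
    rcases eq_or_lt_of_le ha.2 with h1 | h1
    · exact ⟨⟨v, v, 0⟩, .inr ⟨rfl, rfl⟩, by rw [h1, Tri.pt, edgePt_self, edgePt_one]⟩
    rcases lt_or_gt_of_ne h.ne with hlt | hlt
    · exact ⟨⟨u, v, a⟩, .inl ⟨h, hlt, h0, h1⟩, rfl⟩
    · exact ⟨⟨v, u, 1 - a⟩, .inl ⟨h.symm, hlt, by simpa using h1, by simpa using h0⟩,
        edgePt_swap u v a⟩

/-- The program can test whether two points are equal by comparing canonical triples. Interior
positions and the order of the two ends remove all ambiguity. -/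
theorem Tri.Canon.eq_of_pt_eq {s t : Tri n} (hs : s.Canon G) (ht : t.Canon G)
    (h : s.pt = t.pt) : s = t := by
  have key : ∀ s t : Tri n, s.Canon G → t.Canon G → s.pt = t.pt → s.u = t.u := by
    intro s t hs ht h
    have hsu : ∀ t : Tri n, t.Canon G → t.pt t.u ≠ 0 := by
      rintro t (ht | ht)
      · rw [Tri.pt, edgePt_left ht.1.ne]
        linarith [ht.2.2.2]
      · rw [Tri.pt, ← ht.1, edgePt_self, vertexPt_self]
        exact one_ne_zero
    by_contra hne
    have h1 := ht.weak.coord (u := s.u) (h ▸ hsu s hs)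
    have h2 := hs.weak.coord (u := t.u) (h ▸ hsu t ht)
    have h1' : s.u = t.v := by
      rcases h1 with h1 | h1
      exacts [absurd h1.1 hne, h1.1]
    have h2' : t.u = s.v := by
      rcases h2 with h2 | h2
      exacts [absurd h2.1.symm hne, h2.1]
    rcases hs with hs | hs
    · rcases ht with ht | ht
      · have h3 := hs.2.1
        have h4 := ht.2.1
        rw [← h2'] at h3
        rw [← h1'] at h4
        exact lt_asymm h3 h4
      · exact hne (h1'.trans ht.1.symm)
    · exact hne (hs.1.trans h2'.symm)
  have hu := key s t hs ht h
  have hsa : ∀ t : Tri n, t.Canon G → t.a = 1 - t.pt t.u := by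
    rintro t (ht | ht)
    · rw [Tri.pt, edgePt_left ht.1.ne]
      ring
    · rw [Tri.pt, ← ht.1, edgePt_self, vertexPt_self, ht.2]
      ring
  have ha : s.a = t.a := by rw [hsa s hs, hsa t ht, h, hu]
  have hv : s.v = t.v := by
    rcases hs with hs | hs
    · rcases ht with ht | ht
      · by_contra hne
        have h1 : s.pt s.v = s.a := edgePt_right hs.1.ne _
        have h2 : t.pt s.v = 0 := edgePt_other (by rw [← hu]; exact hs.1.ne') hne _
        rw [h, h2] at h1
        linarith [hs.2.2.1]
      · linarith [hs.2.2.1, ht.2]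
    · rcases ht with ht | ht
      · linarith [hs.2, ht.2.2.1]
      · rw [← hs.1, ← ht.1, hu]
  cases s
  cases t
  simp_all

theorem covers_iff (hG : G.Connected) {m : ℕ} {δ : ℝ} {s : Fin m → Tri n}
    (hs : ∀ i, (s i).Weak G) :
    Covers G δ s ↔ ∀ p ∈ points G, ∃ i, pd G p (s i).pt ≤ δ := by
  have hv : ∀ w i, pd G (vertexPt w) (s i).pt = vd G w (s i) := by
    intro w i
    have h1 : (⟨w, w, 0⟩ : Tri n).Weak G := .inr ⟨rfl, rfl⟩
    have h2 := pd_pt hG h1 (hs i)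
    have h3 : (⟨w, w, 0⟩ : Tri n).pt = vertexPt w := edgePt_self w 0
    rw [h3] at h2
    refine le_antisymm (pd_pt_le_vd hG w (hs i)) ?_
    rw [h2]
    have hr : vd G w (s i) ≤ rd G ⟨w, w, 0⟩ (s i) := by
      simp only [rd]
      exact le_min (by linarith) (by linarith)
    unfold td
    split_ifs with h
    · refine le_min hr ?_
      have ha : (s i).a = 0 := by
        rcases hs i with hw | hw
        · exact absurd (h.1.symm.trans h.2) hw.1.ne
        · exact hw.2
      have h4 : vd G w (s i) ≤ (s i).a + G.dist (s i).u w := min_le_left _ _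
      have h5 : (s i).u = w := h.1.symm
      rw [ha, h5, SimpleGraph.dist_self] at h4
      simpa [ha] using h4
    · exact hr
  constructor
  · intro h p hp
    obtain ⟨t, ht, rfl⟩ := exists_canon hp
    rcases id ht with ht' | ht'
    · obtain ⟨i, hi⟩ := h.2 t.u t.v ht'.1 ht'.2.1 t.a ⟨ht'.2.2.1.le, ht'.2.2.2.le⟩
      exact ⟨i, by rwa [pd_pt hG ht.weak (hs i)]⟩
    · obtain ⟨i, hi⟩ := h.1 t.u
      have h3 : t.pt = vertexPt t.u := by rw [Tri.pt, ← ht'.1, edgePt_self]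
      exact ⟨i, by rwa [h3, hv]⟩
  · intro h
    constructor
    · intro w
      obtain ⟨i, hi⟩ := h _ (vertexPt_mem G w)
      exact ⟨i, by rwa [← hv]⟩
    · intro a b hab hlt x hx
      obtain ⟨i, hi⟩ := h _ (edgePt_mem hab hx)
      have h1 : (⟨a, b, x⟩ : Tri n).Weak G := .inl ⟨hab, hlt, hx⟩
      exact ⟨i, by rwa [← pd_pt hG h1 (hs i)]⟩

/-- The base of the encoding of tuples. -/
def base (n m : ℕ) : ℕ := 8 * ((m + 1) * (n + 1))

/-- A vertex from a digit. -/
def vtx (n : ℕ) [NeZero n] (u : ℕ) : Fin n :=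
  if h : u < n then ⟨u, h⟩ else ⟨0, NeZero.pos n⟩

/-- The offset of the positions. -/
noncomputable def offset (n m : ℕ) (δ : ℝ) : ℝ := 1 + m * (2 * δ + 2 * n)

/-- The position from two digits. -/
noncomputable def decPos (n m : ℕ) (δ : ℝ) (y : ℕ) : ℝ :=
  ((y / base n m / base n m % base n m : ℕ) : ℝ) / 2 +
    (y / base n m / base n m / base n m % base n m : ℕ) * δ - offset n m δ

open Classical in
/-- The point encoded by the last four digits of a number. -/
noncomputable def decTri (G : SimpleGraph (Fin n)) [NeZero n] (δ : ℝ) (m y : ℕ) : Tri n :=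
  let u := vtx n (y % base n m)
  let v := vtx n (y / base n m % base n m)
  let r := decPos n m δ y
  if u < v ∧ G.Adj u v ∧ 0 < r ∧ r < 1 then ⟨u, v, r⟩ else ⟨u, u, 0⟩

theorem decTri_canon (G : SimpleGraph (Fin n)) [NeZero n] (δ : ℝ) (m y : ℕ) :
    (decTri G δ m y).Canon G := by
  simp only [decTri]
  split_ifs with h
  · exact .inl ⟨h.2.1, h.1, h.2.2⟩
  · exact .inr ⟨rfl, rfl⟩

/-- The points of the tuple encoded by a number. -/
noncomputable def decTuple (G : SimpleGraph (Fin n)) [NeZero n] (δ : ℝ) (m x i : ℕ) : Tri n :=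
  decTri G δ m (x / (base n m ^ 4) ^ i)

theorem vtx_val [NeZero n] (u : Fin n) : vtx n (u : ℕ) = u := by simp [vtx, u.2]

/-- With `2 * t.a = c + 2 * δ * b`, the last two digits are `A = c + 4 * m * n + 2` and `B = b + 2 *
m`. Subtracting `offset` from `A / 2 + B * δ` leaves `c / 2 + b * δ`. As `A ≤ 8 * m * n + 4` and `B
≤ 4 * m`, all digits are below the base. Only the points agree, since positions `0` and `1` are
decoded as vertices. The number `z` stands for the codes of further points. -/
theorem exists_decTri_eq [NeZero n] {δ : ℝ} (hδ : 0 < δ) (hδn : δ ≤ n) {m : ℕ} {t : Tri n}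
    (ht : t.Weak G) (hd : ∃ c b : ℤ, |b| ≤ 2 * m ∧ 2 * t.a = c + 2 * δ * b) :
    ∃ y < base n m ^ 4, ∀ z, (decTri G δ m (y + base n m ^ 4 * z)).pt = t.pt := by
  set Q := base n m with hQ
  have hnm : n ≤ (m + 1) * n := Nat.le_mul_of_pos_left _ (by omega)
  have hQe : Q = 8 * (m * n) + 8 * m + 8 * n + 8 := by rw [hQ, base]; ring
  have hnQ : ∀ u : Fin n, (u : ℕ) < Q := fun u => by have := u.2; omega
  have hQ0 : 0 < Q := by omega
  have dig : ∀ d₀ d₁ d₂ d₃ : ℕ, d₀ < Q → d₁ < Q → d₂ < Q → d₃ < Q →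
      ∃ y < Q ^ 4, ∀ z, (y + Q ^ 4 * z) % Q = d₀ ∧ (y + Q ^ 4 * z) / Q % Q = d₁ ∧
        (y + Q ^ 4 * z) / Q / Q % Q = d₂ ∧ (y + Q ^ 4 * z) / Q / Q / Q % Q = d₃ := by
    intro d₀ d₁ d₂ d₃ h₀ h₁ h₂ h₃
    refine ⟨d₀ + Q * (d₁ + Q * (d₂ + Q * d₃)), ?_, fun z => ?_⟩
    · have e₃ : d₃ + 1 ≤ Q := h₃
      have e₂ : d₂ + Q * d₃ + 1 ≤ Q * Q := by nlinarith
      have e₁ : d₁ + Q * (d₂ + Q * d₃) + 1 ≤ Q * (Q * Q) := by nlinarith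
      have e₀ : d₀ + Q * (d₁ + Q * (d₂ + Q * d₃)) + 1 ≤ Q * (Q * (Q * Q)) := by nlinarith
      calc _ < Q * (Q * (Q * Q)) := e₀
        _ = Q ^ 4 := by ring
    · have e : d₀ + Q * (d₁ + Q * (d₂ + Q * d₃)) + Q ^ 4 * z =
          d₀ + Q * (d₁ + Q * (d₂ + Q * (d₃ + Q * z))) := by ring
      have div : ∀ d x, d < Q → (d + Q * x) / Q = x := fun d x hd => by
        rw [Nat.add_mul_div_left _ _ hQ0, Nat.div_eq_of_lt hd, zero_add]
      have mod : ∀ d x, d < Q → (d + Q * x) % Q = d := fun d x hd => by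
        rw [Nat.add_mul_mod_self_left, Nat.mod_eq_of_lt hd]
      rw [e, div _ _ h₀, div _ _ h₁, div _ _ h₂, mod _ _ h₀, mod _ _ h₁, mod _ _ h₂, mod _ _ h₃]
      exact ⟨rfl, rfl, rfl, rfl⟩
  have vert : ∀ w : Fin n, t.pt = vertexPt w →
      ∃ y < Q ^ 4, ∀ z, (decTri G δ m (y + Q ^ 4 * z)).pt = t.pt := by
    intro w hw
    obtain ⟨y, hy, h⟩ := dig w w 0 0 (hnQ w) (hnQ w) hQ0 hQ0
    refine ⟨y, hy, fun z => ?_⟩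
    obtain ⟨h0, h1, -, -⟩ := h z
    simp only [decTri, ← hQ, h0, h1, vtx_val, lt_irrefl, false_and, if_false]
    rw [hw, Tri.pt, edgePt_self]
  by_cases ha0 : t.a = 0
  · exact vert t.u (by rw [Tri.pt, ha0, edgePt_zero])
  by_cases ha1 : t.a = 1
  · exact vert t.v (by rw [Tri.pt, ha1, edgePt_one])
  have hw : G.Adj t.u t.v ∧ t.u < t.v ∧ 0 ≤ t.a ∧ t.a ≤ 1 := by
    rcases ht with h | h
    exacts [h, absurd h.2 ha0]
  have hpos : 0 < t.a := lt_of_le_of_ne hw.2.2.1 (Ne.symm ha0)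
  have hlt : t.a < 1 := lt_of_le_of_ne hw.2.2.2 ha1
  obtain ⟨c, b, hb, hcb⟩ := hd
  have hb' : |(b : ℝ)| ≤ 2 * m := by exact_mod_cast hb
  -- The hypothesis `δ ≤ n` confines `c = 2 * t.a - 2 * δ * b` to a range that does not depend on
  -- `δ`.
  have hδb : |δ * b| ≤ n * (2 * m) := by
    rw [abs_mul, abs_of_pos hδ]
    exact mul_le_mul hδn hb' (abs_nonneg _) (by positivity)
  obtain ⟨hl, hr⟩ := abs_le.1 hδb
  have hc1 : -(4 * (m * n) : ℤ) - 2 ≤ c := by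
    have : -(4 * (m * n) : ℝ) - 2 ≤ c := by nlinarith
    exact_mod_cast this
  have hc2 : c ≤ 4 * (m * n) + 2 := by
    have : (c : ℝ) ≤ 4 * (m * n) + 2 := by nlinarith
    exact_mod_cast this
  obtain ⟨hb1, hb2⟩ := abs_le.1 hb
  obtain ⟨A, hA⟩ := Int.eq_ofNat_of_zero_le (show 0 ≤ c + (4 * (m * n) + 2) by linarith)
  obtain ⟨B, hB⟩ := Int.eq_ofNat_of_zero_le (show 0 ≤ b + 2 * m by linarith)
  have hmn : ((m * n : ℕ) : ℤ) = m * n := by push_cast; rfl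
  obtain ⟨y, hy, h⟩ := dig t.u t.v A B (hnQ _) (hnQ _) (by
    zify
    rw [hQe]
    push_cast
    linarith [Int.natCast_nonneg m, Int.natCast_nonneg n]) (by
    zify
    rw [hQe]
    push_cast
    have : (0 : ℤ) ≤ m * n := by positivity
    linarith [Int.natCast_nonneg m, Int.natCast_nonneg n])
  refine ⟨y, hy, fun z => ?_⟩
  obtain ⟨h0, h1, h2, h3⟩ := h z
  have hA' : (A : ℝ) = c + (4 * (m * n) + 2) := by exact_mod_cast hA.symm
  have hB' : (B : ℝ) = b + 2 * m := by exact_mod_cast hB.symm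
  have hp : decPos n m δ (y + Q ^ 4 * z) = t.a := by
    simp only [decPos, ← hQ, h2, h3, offset, hA', hB']
    linear_combination (-1 / 2 : ℝ) * hcb
  have e0 : vtx n ((y + Q ^ 4 * z) % base n m) = t.u := by rw [← hQ, h0, vtx_val]
  have e1 : vtx n ((y + Q ^ 4 * z) / base n m % base n m) = t.v := by rw [← hQ, h1, vtx_val]
  simp only [decTri, e0, e1, hp, hw.2.1, hw.1, hpos, hlt, and_self, if_true]

/-- Since the code of a point tolerates arbitrary higher digits, codes can be concatenated, with the
first point in the lowest digits. -/
theorem exists_decTuple_eq [NeZero n] {δ : ℝ} (m : ℕ) (p : ℕ → Fin n → ℝ) (k : ℕ)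
    (h : ∀ i < k, ∃ y < base n m ^ 4, ∀ z, (decTri G δ m (y + base n m ^ 4 * z)).pt = p i) :
    ∃ x < (base n m ^ 4) ^ k, ∀ i < k, (decTuple G δ m x i).pt = p i := by
  induction k generalizing p with
  | zero => exact ⟨0, by simp, by simp⟩
  | succ k ih =>
    obtain ⟨x, hx, hxi⟩ := ih (fun i => p (i + 1)) fun i hi => h (i + 1) (by omega)
    obtain ⟨y, hy, hyz⟩ := h 0 (by omega)
    refine ⟨y + base n m ^ 4 * x, ?_, fun i hi => ?_⟩
    · calc y + base n m ^ 4 * x < base n m ^ 4 * (x + 1) := by rw [mul_add]; omega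
        _ ≤ base n m ^ 4 * (base n m ^ 4) ^ k := Nat.mul_le_mul_left _ hx
        _ = _ := by ring
    · cases i with
      | zero => simpa [decTuple] using hyz x
      | succ i =>
        rw [← hxi i (by omega), decTuple, decTuple, pow_succ' _ i, ← Nat.div_div_eq_div_mul,
          Nat.add_mul_div_left _ _ (by omega), Nat.div_eq_of_lt hy, zero_add]

/-- The tuple encoded by `x` covers the graph. -/
def GoodCode (G : SimpleGraph (Fin n)) [NeZero n] (δ : ℝ) (m x : ℕ) : Prop :=
  ∀ a b, G.Adj a b → a < b → ∀ y ∈ Set.Icc (0 : ℝ) 1, ∃ i < m,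
    td G ⟨a, b, y⟩ (decTuple G δ m x i) ≤ δ

/-- The length of the closed route along the tuple encoded by `x`. -/
noncomputable def codeLen (G : SimpleGraph (Fin n)) [NeZero n] (δ : ℝ) (m x : ℕ) : ℝ :=
  ∑ i ∈ Finset.range m, td G (decTuple G δ m x i)
    (if i + 1 = m then decTuple G δ m x 0 else decTuple G δ m x (i + 1))

/-- `GoodCode` speaks of edges only. A vertex is an end of some edge, unless it is the only vertex;
then every tuple consists of copies of it. -/
theorem GoodCode.exists_le [NeZero n] (hG : G.Connected) {δ : ℝ} (hδ : 0 < δ) {m x : ℕ}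
    (hm : 0 < m) (h : GoodCode G δ m x) {p : Fin n → ℝ} (hp : p ∈ points G) :
    ∃ i < m, pd G p (decTuple G δ m x i).pt ≤ δ := by
  have hc : ∀ i, (decTuple G δ m x i).Weak G := fun i => (decTri_canon G δ m _).weak
  have edge : ∀ a b, G.Adj a b → ∀ y ∈ Set.Icc (0 : ℝ) 1, ∃ i < m,
      pd G (edgePt a b y) (decTuple G δ m x i).pt ≤ δ := by
    have key : ∀ a b, G.Adj a b → a < b → ∀ y ∈ Set.Icc (0 : ℝ) 1, ∃ i < m,
        pd G (edgePt a b y) (decTuple G δ m x i).pt ≤ δ := by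
      intro a b hab hlt y hy
      obtain ⟨i, hi, hle⟩ := h a b hab hlt y hy
      refine ⟨i, hi, ?_⟩
      have h1 : (⟨a, b, y⟩ : Tri n).Weak G := .inl ⟨hab, hlt, hy⟩
      rwa [← pd_pt hG h1 (hc i)] at hle
    intro a b hab y hy
    rcases lt_or_gt_of_ne hab.ne with hlt | hlt
    · exact key a b hab hlt y hy
    · rw [← edgePt_swap]
      exact key b a hab.symm hlt (1 - y) ⟨by linarith [hy.2], by linarith [hy.1]⟩
  obtain ⟨u, rfl⟩ | ⟨u, v, a, hA, ha, rfl⟩ := hp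
  · by_cases hn : Nontrivial (Fin n)
    · obtain ⟨v, hv⟩ := hG.preconnected.exists_adj_of_nontrivial u
      have := edge u v hv 0 (by simp)
      rwa [edgePt_zero] at this
    · rw [not_nontrivial_iff_subsingleton] at hn
      refine ⟨0, hm, ?_⟩
      have : (decTuple G δ m x 0).pt = vertexPt u := by
        rw [Tri.pt, Subsingleton.elim (decTuple G δ m x 0).u u,
          Subsingleton.elim (decTuple G δ m x 0).v u, edgePt_self]
      rw [this, pd_self (vertexPt_mem G u)]
      exact hδ.le
  · exact edge u v hA a ha

theorem codeLen_eq [NeZero n] (hG : G.Connected) {δ : ℝ} {m x : ℕ} {g : ℕ → Fin n → ℝ}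
    (hg : ∀ i < m, (decTuple G δ m x i).pt = g i) (hgm : g m = g 0) :
    codeLen G δ m x = ∑ i ∈ Finset.range m, pd G (g i) (g (i + 1)) := by
  have hc : ∀ i, (decTuple G δ m x i).Weak G := fun i => (decTri_canon G δ m _).weak
  refine Finset.sum_congr rfl fun i hi => ?_
  have hi := Finset.mem_range.1 hi
  split_ifs with h
  · rw [← pd_pt hG (hc i) (hc 0), hg i hi, hg 0 (by omega), h, hgm]
  · rw [← pd_pt hG (hc i) (hc (i + 1)), hg i hi, hg (i + 1) (by omega)]

/-- This links the two reductions: few points of `T`, moved to discrete positions, have a code.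
Together with the converse, that a good code yields a tour of length at most `codeLen`, it makes the
minimum over codes the minimum over all `δ`-tours. -/
theorem exists_goodCode [NeZero n] (hG : G.Connected) {δ : ℝ} (hδ : 0 < δ)
    {T : List (Fin n → ℝ)} (hT : IsDeltaTour G δ T) {m : ℕ} (hm : m = fewPts n ⌈n / δ⌉₊) :
    ∃ x < (base n m ^ 4) ^ m, GoodCode G δ m x ∧ codeLen G δ m x ≤ len T := by
  have hn : 0 < n := NeZero.pos n
  have hk : 0 < ⌈n / δ⌉₊ := Nat.ceil_pos.2 (by positivity)
  have hm0 : 0 < m := by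
    rw [hm, fewPts]
    split_ifs <;> positivity
  have good : ∀ x (g : ℕ → Fin n → ℝ), (∀ i < m, (decTuple G δ m x i).pt = g i) →
      (∀ p ∈ points G, ∃ i < m, pd G p (g i) ≤ δ) → GoodCode G δ m x := by
    intro x g hg hcov a b hab hlt y hy
    obtain ⟨i, hi, hle⟩ := hcov _ (edgePt_mem hab hy)
    have h1 : (⟨a, b, y⟩ : Tri n).Weak G := .inl ⟨hab, hlt, hy⟩
    refine ⟨i, hi, ?_⟩
    rw [← hg i hi] at hle
    exact (pd_pt hG h1 (decTri_canon G δ m _).weak).symm.trans_le hle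
  obtain ⟨g, hgp, hgm, hgc, hgl⟩ := exists_fewPts hG hδ hT
  rw [← hm] at hgm hgc hgl
  by_cases hδn : δ ≤ n
  · choose t ht htp using fun i => exists_canon (hgp i)
    let nx : Fin m → Fin m := fun i => if h : i + 1 < m then ⟨i + 1, h⟩ else ⟨0, hm0⟩
    have hcov : Covers G δ fun i : Fin m => t i := by
      rw [covers_iff hG fun i => (ht _).weak]
      intro p hp
      obtain ⟨i, hi, hle⟩ := hgc p hp
      exact ⟨⟨i, hi⟩, by rwa [htp]⟩
    obtain ⟨s, hsw, hsc, hsd, hsl⟩ := exists_discrete_tuple (fun i => (ht _).weak) hcov nx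
    have hlen : ∑ i : Fin m, td G (t i) (t (nx i)) =
        ∑ i ∈ Finset.range m, pd G (g i) (g (i + 1)) := by
      rw [← Fin.sum_univ_eq_sum_range fun i => pd G (g i) (g (i + 1))]
      refine Finset.sum_congr rfl fun i _ => ?_
      rw [← pd_pt hG (ht _).weak (ht _).weak, htp, htp]
      simp only [nx]
      split_ifs with h
      · rfl
      · have : (i : ℕ) + 1 = m := by omega
        rw [this, hgm]
    let p : ℕ → Fin n → ℝ := fun i => if h : i < m then (s ⟨i, h⟩).pt else (s ⟨0, hm0⟩).pt
    obtain ⟨x, hx, hxp⟩ := exists_decTuple_eq (G := G) (δ := δ) m p m fun i hi => by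
      simp only [p, hi, dif_pos]
      exact exists_decTri_eq hδ hδn (hsw _) (hsd _)
    refine ⟨x, hx, good x p hxp fun q hq => ?_, ?_⟩
    · obtain ⟨i, hi⟩ := (covers_iff hG hsw).1 hsc q hq
      exact ⟨i, i.2, by simpa [p] using hi⟩
    · rw [codeLen_eq hG hxp (by simp [p])]
      refine le_trans (le_of_eq ?_) (hsl.trans (hlen.le.trans hgl))
      rw [← Fin.sum_univ_eq_sum_range fun i => pd G (p i) (p (i + 1))]
      refine Finset.sum_congr rfl fun i _ => ?_
      rw [← pd_pt hG (hsw _) (hsw _)]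
      simp only [p, nx, i.2, dif_pos]
      split_ifs with h <;> rfl
  -- For `δ > n` the digits would not suffice, but code `0`, which repeats one vertex, covers
  -- everything: vertices are at most `n - 1` apart, and reaching a vertex along an edge costs at
  -- most `1`.
  · push Not at hδn
    have hQ : 0 < base n m := by unfold base; positivity
    refine ⟨0, by positivity, ?_, ?_⟩
    · intro a b hab hlt y hy
      refine ⟨0, hm0, ?_⟩
      set t := decTuple G δ m 0 0
      have ht : t.Weak G := (decTri_canon G δ m _).weak
      have hd : ∀ u v, (G.dist u v : ℝ) ≤ n - 1 := by
        intro u v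
        obtain ⟨w, hw, hl⟩ := hG.exists_path_of_dist u v
        have := hw.length_lt
        rw [hl, Fintype.card_fin] at this
        have : ((G.dist u v + 1 : ℕ) : ℝ) ≤ n := by exact_mod_cast this
        push_cast at this
        linarith
      have htu : t.a = 0 := by
        have : t.u = t.v := by
          simp only [t, decTuple, decTri]
          simp
        rcases ht with h | h
        · exact absurd this h.1.ne
        · exact h.2
      have hv : vd G a t ≤ n - 1 :=
        (min_le_left _ _).trans (by rw [htu, zero_add]; exact hd _ _)
      have : rd G ⟨a, b, y⟩ t ≤ y + vd G a t := min_le_left _ _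
      linarith [td_le_rd G ⟨a, b, y⟩ t, hy.2]
    · have h0 : ∀ i, decTuple G δ m 0 i = decTri G δ m 0 := fun i => by simp [decTuple]
      rw [codeLen_eq (g := fun _ => (decTri G δ m 0).pt) hG (fun i _ => by rw [h0]) rfl]
      simp only [pd_self (decTri_canon G δ m 0).weak.pt_mem, Finset.sum_const_zero]
      exact (Finset.sum_nonneg fun i _ => pd_nonneg _ _).trans hgl

end Code

end DeltaTour

/-! ## Subprograms: decoding of tuples -/

namespace DeltaTour

section State

variable (s : State) (i j v : ℕ) (a : ℝ)

@[simp] theorem State.setN_natReg :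
    (s.setN i v).natReg j = if j = i then v else s.natReg j := Function.update_apply _ _ _ _

@[simp] theorem State.setN_realReg : (s.setN i v).realReg = s.realReg := rfl

@[simp] theorem State.setN_natMem : (s.setN i v).natMem = s.natMem := rfl

@[simp] theorem State.setN_realMem : (s.setN i v).realMem = s.realMem := rfl

@[simp] theorem State.setR_natReg : (s.setR i a).natReg = s.natReg := rfl

@[simp] theorem State.setR_realReg :
    (s.setR i a).realReg j = if j = i then a else s.realReg j := Function.update_apply _ _ _ _

@[simp] theorem State.setR_natMem : (s.setR i a).natMem = s.natMem := rfl

@[simp] theorem State.setR_realMem : (s.setR i a).realMem = s.realMem := rfl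

end State

namespace BExp

/-- Disjunction. -/
def or (a b : BExp) : BExp := .not (.and (.not a) (.not b))

theorem holds_or (s : State) (a b : BExp) : (a.or b).Holds s ↔ a.Holds s ∨ b.Holds s := by
  simp only [or, Holds]
  tauto

/-- Equality of natural numbers. -/
def eqN (a b : NExp) : BExp := .and (.leN a b) (.leN b a)

theorem holds_eqN (s : State) (a b : NExp) : (eqN a b).Holds s ↔ a.eval s = b.eval s := by
  simp only [eqN, Holds]
  omega

end BExp

/-- Row `a` and column `b` of the distance matrix, as an address. -/
def dstAddr (a b : NExp) : NExp := .add (.load (.add (.add (.var 5) (.var 5)) a)) b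

/-- The distance of two vertices. -/
def dst (a b : NExp) : RExp := .load (dstAddr a b)

/-- The addresses of the components of a point of the tuple. -/
def tuAddr (i : NExp) : NExp := .add (.var 5) (.add i i)

def tvAddr (i : NExp) : NExp := .add (.var 5) (.add (.add i i) (.const 1))

def taAddr (i : NExp) : NExp := .add (.add (.var 5) (.var 5)) i

/-- The components of a point of the tuple. -/
def tu (i : NExp) : NExp := .load (tuAddr i)

def tv (i : NExp) : NExp := .load (tvAddr i)

def ta (i : NExp) : RExp := .load (taAddr i)

namespace Stmt

/-- The parameters of the computation, the memory, and the registers that hold `δ` and the offset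
are not written. -/
def keeps (S : Stmt) : Bool :=
  S.pureN && S.pureR && [1, 3, 4, 5].all (fun i => !S.writesN.contains i) &&
    [0, 1].all fun i => !S.writesR.contains i

end Stmt

variable {n : ℕ}

/-- The size of the search space. -/
def space (n m : ℕ) : ℕ := (base n m ^ 4) ^ m

theorem base_eq (n m : ℕ) : base n m = 8 * (m * n) + 8 * m + 8 * n + 8 := by rw [base]; ring

/-- The memory is divided at `R = space n m` and `2 * R`. Integer cells hold the input and later the
output below `R`, the ends of the tuple from `R` on, and row pointers from `2 * R` on. Real cells
hold the output positions below `R`, the distance matrix with rows of width `base n m` from `R` on,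
and the tuple positions from `2 * R` on. As `n ≤ base n m`, this bound makes the matrix fit. -/
theorem base_sq_le (n : ℕ) {m : ℕ} (hm : 0 < m) : base n m * base n m ≤ space n m := by
  have h : 0 < base n m := by rw [base_eq]; omega
  rw [space, ← pow_mul, ← pow_two]
  exact Nat.pow_le_pow_right h (by omega)

/-- The registers that hold the parameters. -/
structure Params (n m : ℕ) (δ : ℝ) (s : State) : Prop where
  reg_n : s.natReg 1 = n
  reg_m : s.natReg 3 = m
  reg_q : s.natReg 4 = base n m
  reg_r : s.natReg 5 = space n m
  reg_d : s.realReg 0 = δ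
  reg_off : s.realReg 1 = offset n m δ

/-- The parameters and the row pointers. -/
structure Rows (n m : ℕ) (δ : ℝ) (s : State) : Prop extends Params n m δ s where
  row : ∀ u < n, s.natMem (space n m + space n m + u) = space n m + u * base n m

/-- The parameters, the row pointers, and the distance matrix. -/
structure Ctx (G : SimpleGraph (Fin n)) (m : ℕ) (δ : ℝ) (s : State) : Prop
    extends Rows n m δ s where
  dist : ∀ u v : Fin n, s.realMem (space n m + u * base n m + v) = G.dist u v

/-- Entries `0, …, c - 1` of the tuple. -/
def Tup (m : ℕ) (t : ℕ → Tri n) (c : ℕ) (s : State) : Prop :=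
  ∀ i < c, s.natMem (space n m + (i + i)) = (t i).u ∧
    s.natMem (space n m + (i + i + 1)) = (t i).v ∧ s.realMem (space n m + space n m + i) = (t i).a

section

variable {G : SimpleGraph (Fin n)} {m : ℕ} {δ : ℝ} {s s' : State}

theorem Ctx.of_eq (h : Ctx G m δ s) (hn : ∀ i ∈ [1, 3, 4, 5], s'.natReg i = s.natReg i)
    (hr : ∀ i ∈ [0, 1], s'.realReg i = s.realReg i)
    (hmn : ∀ u < n, s'.natMem (space n m + space n m + u) = s.natMem (space n m + space n m + u))
    (hmr : ∀ u v : Fin n, s'.realMem (space n m + u * base n m + v) =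
      s.realMem (space n m + u * base n m + v)) : Ctx G m δ s' where
  reg_n := (hn 1 (by simp)).trans h.reg_n
  reg_m := (hn 3 (by simp)).trans h.reg_m
  reg_q := (hn 4 (by simp)).trans h.reg_q
  reg_r := (hn 5 (by simp)).trans h.reg_r
  reg_d := (hr 0 (by simp)).trans h.reg_d
  reg_off := (hr 1 (by simp)).trans h.reg_off
  row u hu := (hmn u hu).trans (h.row u hu)
  dist u v := (hmr u v).trans (h.dist u v)

theorem Ctx.frame {S : Stmt} (h : Ctx G m δ s) (hf : S.Frame s s') (hk : S.keeps = true) :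
    Ctx G m δ s' := by
  simp only [Stmt.keeps, Bool.and_eq_true, List.all_cons, List.all_nil, Bool.not_eq_true',
    List.contains_eq_mem, decide_eq_false_iff_not] at hk
  obtain ⟨⟨⟨h1, h2⟩, h3, h4, h5, h6, -⟩, h7, h8, -⟩ := hk
  refine h.of_eq ?_ ?_ (fun u _ => by rw [hf.mn h1]) fun u v => by rw [hf.mr h2]
  · simp [hf.n _ h3, hf.n _ h4, hf.n _ h5, hf.n _ h6]
  · simp [hf.r _ h7, hf.r _ h8]

theorem Tup.frame {S : Stmt} {t : ℕ → Tri n} {c : ℕ} (h : Tup m t c s) (hf : S.Frame s s')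
    (hk : S.keeps = true) : Tup m t c s' := by
  simp only [Stmt.keeps, Bool.and_eq_true] at hk
  intro i hi
  rw [hf.mn hk.1.1.1, hf.mr hk.1.1.2]
  exact h i hi

theorem Ctx.setN (h : Ctx G m δ s) {i : ℕ} (hi : i ∉ [1, 3, 4, 5]) (v : ℕ) :
    Ctx G m δ (s.setN i v) := by
  simp at hi
  exact h.of_eq (by simp; omega) (by simp) (by simp) (by simp)

theorem Tup.setN {t : ℕ → Tri n} {c : ℕ} (h : Tup m t c s) (i v : ℕ) :
    Tup m t c (s.setN i v) := h

theorem Ctx.setR (h : Ctx G m δ s) {i : ℕ} (hi : i ∉ [0, 1]) (v : ℝ) :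
    Ctx G m δ (s.setR i v) := by
  simp at hi
  exact h.of_eq (by simp) (by simp; omega) (by simp) (by simp)

theorem Tup.setR {t : ℕ → Tri n} {c : ℕ} (h : Tup m t c s) (i : ℕ) (v : ℝ) :
    Tup m t c (s.setR i v) := h

theorem Rows.eval_dstAddr (h : Rows n m δ s) {a b : NExp} {u v : Fin n} (ha : a.eval s = u)
    (hb : b.eval s = v) : (dstAddr a b).eval s = space n m + u * base n m + v := by
  simp only [dstAddr, NExp.eval, ha, hb, h.reg_r, h.row u u.2]

theorem Ctx.eval_dst (h : Ctx G m δ s) {a b : NExp} {u v : Fin n} (ha : a.eval s = u)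
    (hb : b.eval s = v) : (dst a b).eval s = G.dist u v := by
  rw [dst, RExp.eval, h.toRows.eval_dstAddr ha hb, h.dist]

theorem Ctx.eval_tu (h : Ctx G m δ s) {t : ℕ → Tri n} {c : ℕ} (ht : Tup m t c s) {e : NExp} {i : ℕ}
    (he : e.eval s = i) (hi : i < c) : (tu e).eval s = (t i).u := by
  simp only [tu, tuAddr, NExp.eval, he, h.reg_r, (ht i hi).1]

theorem Ctx.eval_tv (h : Ctx G m δ s) {t : ℕ → Tri n} {c : ℕ} (ht : Tup m t c s) {e : NExp} {i : ℕ}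
    (he : e.eval s = i) (hi : i < c) : (tv e).eval s = (t i).v := by
  simp only [tv, tvAddr, NExp.eval, he, h.reg_r, (ht i hi).2.1]

theorem Ctx.eval_ta (h : Ctx G m δ s) {t : ℕ → Tri n} {c : ℕ} (ht : Tup m t c s) {e : NExp} {i : ℕ}
    (he : e.eval s = i) (hi : i < c) : (ta e).eval s = (t i).a := by
  simp only [ta, taAddr, RExp.eval, NExp.eval, he, h.reg_r, (ht i hi).2.2]

end

namespace Stmt

section Run

variable (s : State)

theorem run_skip : skip.run s = s := rfl

theorem run_setN (x : ℕ) (e : NExp) : (setN x e).run s = s.setN x (e.eval s) := rfl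

theorem run_setR (x : ℕ) (e : RExp) : (setR x e).run s = s.setR x (e.eval s) := rfl

theorem run_seq (A B : Stmt) : (seq A B).run s = B.run (A.run s) := rfl

theorem run_ite_true {b : BExp} {s : State} (h : b.Holds s) (A B : Stmt) :
    (ite b A B).run s = A.run s := if_pos h

theorem run_ite_false {b : BExp} {s : State} (h : ¬ b.Holds s) (A B : Stmt) :
    (ite b A B).run s = B.run s := if_neg h

end Run

/-- Split off the last digit of register `20` into register `p`. -/
def divModLoop (p : ℕ) : Stmt :=
  loop 25 5 (ite (.leN (.var 4) (.var p))
    (seq (setN p (.sub (.var p) (.var 4))) (setN 20 (.add (.var 20) (.const 1)))) skip)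

def divMod (p : ℕ) : Stmt :=
  seq (setN p (.var 20)) (seq (setN 20 (.const 0)) (divModLoop p))

/-- Division by repeated subtraction, with a fixed number of rounds that is at least `y`. The
invariant says that the remainder is already below `Q` or the quotient has grown in every round; in
the latter case the quotient is at least `y`, which forces the remainder to be `0`. -/
theorem run_divMod {p : ℕ} (hp : p ∉ [4, 5, 20, 25]) {s : State} {Q : ℕ} (hQ : 0 < Q)
    (h4 : s.natReg 4 = Q) {y : ℕ} (h20 : s.natReg 20 = y) (hy : y ≤ s.natReg 5) :
    ((divMod p).run s).natReg p = y % Q ∧ ((divMod p).run s).natReg 20 = y / Q := by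
  simp only [List.mem_cons, List.not_mem_nil, or_false, not_or] at hp
  obtain ⟨hp4, hp5, hp20, hp25⟩ := hp
  set s₁ := (s.setN p y).setN 20 0 with hs₁
  have e : (divMod p).run s = (divModLoop p).run s₁ := by
    simp only [divMod, run_seq, run_setN, NExp.eval, h20, hs₁]
  rw [e]
  have key : ((divModLoop p).run s₁).natReg p + Q * ((divModLoop p).run s₁).natReg 20 = y ∧
      (((divModLoop p).run s₁).natReg p < Q ∨
        s₁.natReg 5 ≤ ((divModLoop p).run s₁).natReg 20) := by
    refine run_loop_inv (fun j st => st.natReg p + Q * st.natReg 20 = y ∧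
      (st.natReg p < Q ∨ j ≤ st.natReg 20)) ?_ ?_
    · simp [hs₁, hp20, hp25]
    · intro j st _ hj hf ⟨i1, i2⟩
      have hst4 : st.natReg 4 = Q := by
        rw [hf.n 4 (by simp [writesN]; omega)]
        simp [hs₁, Ne.symm hp4, h4]
      by_cases hle : Q ≤ st.natReg p
      · rw [run_ite_true (by simpa [BExp.Holds, NExp.eval, hst4] using hle)]
        simp only [run_seq, run_setN, NExp.eval, State.setN_natReg, hp20, hp25,
          if_false, hst4, Ne.symm hp20, if_true]
        simp only [show (20 : ℕ) ≠ 25 by decide, if_false]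
        rw [mul_add]
        omega
      · rw [run_ite_false (by simpa [BExp.Holds, NExp.eval, hst4] using hle)]
        simp only [run_skip, State.setN_natReg, hp25, if_false, show (20 : ℕ) ≠ 25 by decide]
        omega
  have h5 : s₁.natReg 5 = s.natReg 5 := by simp [hs₁, Ne.symm hp5]
  rw [h5] at key
  obtain ⟨k1, k2⟩ := key
  set a := ((divModLoop p).run s₁).natReg p
  set b := ((divModLoop p).run s₁).natReg 20
  have ha : a < Q := by
    rcases k2 with k2 | k2
    · exact k2
    · rcases Nat.eq_zero_or_pos a with h0 | h0
      · omega
      · nlinarith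
  constructor
  · rw [← k1, Nat.add_mul_mod_self_left, Nat.mod_eq_of_lt ha]
  · rw [← k1, Nat.add_mul_div_left _ _ hQ, Nat.div_eq_of_lt ha, zero_add]

/-- Add a half for each unit of register `23` and `δ` for each unit of register `24`. -/
def decodePosLoop : Stmt :=
  loop 26 4 (seq (ite (.leN (.add (.var 26) (.const 1)) (.var 23))
      (setR 2 (.add (.var 2) (.const (1 / 2)))) skip)
    (ite (.leN (.add (.var 26) (.const 1)) (.var 24)) (setR 2 (.add (.var 2) (.var 0))) skip))

/-- Compute the position of a point from two digits. -/
def decodePos : Stmt := seq (setR 2 (.sub (.const 0) (.var 1))) decodePosLoop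

/-- In the absence of multiplication, both terms are accumulated by `Q` rounds of one loop, in which
each digit counts only until it is exhausted; hence the minima in the invariant. -/
theorem run_decodePos {s : State} {a b : ℕ} (ha : s.natReg 23 = a) (hb : s.natReg 24 = b)
    (ha4 : a ≤ s.natReg 4) (hb4 : b ≤ s.natReg 4) : (decodePos.run s).realReg 2 =
      (a : ℝ) / 2 + b * s.realReg 0 - s.realReg 1 := by
  set s₁ := s.setR 2 (0 - s.realReg 1) with hs₁
  have e : decodePos.run s = decodePosLoop.run s₁ := by
    simp only [decodePos, run_seq, run_setR, RExp.eval, hs₁, Rat.cast_zero]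
  rw [e]
  have key : (decodePosLoop.run s₁).realReg 2 = ((min a (s₁.natReg 4) : ℕ) : ℝ) / 2 +
      (min b (s₁.natReg 4) : ℕ) * s.realReg 0 - s.realReg 1 := by
    refine run_loop_inv (fun j st => st.realReg 2 =
      ((min a j : ℕ) : ℝ) / 2 + (min b j : ℕ) * s.realReg 0 - s.realReg 1) ?_ ?_
    · simp [hs₁]
    · intro j st _ hj hf hi
      have h23 : st.natReg 23 = a := (hf.n 23 (by decide)).trans ha
      have h24 : st.natReg 24 = b := (hf.n 24 (by decide)).trans hb
      have h0 : st.realReg 0 = s.realReg 0 := (hf.r 0 (by decide)).trans (by simp [hs₁])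
      have m1 : ∀ a : ℕ, j + 1 ≤ a → ((min a (j + 1) : ℕ) : ℝ) = (min a j : ℕ) + 1 := by
        intro a _
        exact_mod_cast (by omega : min a (j + 1) = min a j + 1)
      have m2 : ∀ a : ℕ, ¬ j + 1 ≤ a → ((min a (j + 1) : ℕ) : ℝ) = (min a j : ℕ) := by
        intro a _
        exact_mod_cast (by omega : min a (j + 1) = min a j)
      rw [run_seq]
      generalize hst : (ite _ _ _).run st = st'
      have k : st'.natReg 26 = j ∧ st'.natReg 24 = b ∧ st'.realReg 0 = s.realReg 0 ∧
          st'.realReg 2 = ((min a (j + 1) : ℕ) : ℝ) / 2 + (min b j : ℕ) * s.realReg 0 -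
            s.realReg 1 := by
        rw [← hst]
        by_cases h1 : j + 1 ≤ a
        · rw [run_ite_true (by simpa [BExp.Holds, NExp.eval, h23, hj] using h1), m1 a h1]
          refine ⟨hj, h24, h0, ?_⟩
          simp only [run_setR, RExp.eval, State.setR_realReg, if_true, hi]
          push_cast
          ring
        · rw [run_ite_false (by simpa [BExp.Holds, NExp.eval, h23, hj] using h1), m2 a h1]
          exact ⟨hj, h24, h0, hi⟩
      obtain ⟨k1, k2, k3, k4⟩ := k
      by_cases h2 : j + 1 ≤ b
      · rw [run_ite_true (by simpa [BExp.Holds, NExp.eval, k1, k2] using h2), m1 b h2]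
        simp only [run_setR, RExp.eval, State.setR_realReg, State.setN_realReg, if_true, k4, k3]
        ring
      · rw [run_ite_false (by simpa [BExp.Holds, NExp.eval, k1, k2] using h2), m2 b h2]
        exact k4
  rw [key]
  have h4 : s₁.natReg 4 = s.natReg 4 := rfl
  rw [h4, min_eq_left ha4, min_eq_left hb4]

end Stmt

end DeltaTour

/-! ### Decoding points and whole tuples. -/

namespace DeltaTour

variable {n : ℕ}

namespace Stmt

/-- Replace the number in register `p` by `0` if it is not a vertex. -/
def clamp (p : ℕ) : Stmt := ite (.leN (.var 1) (.var p)) (setN p (.const 0)) skip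

theorem run_clamp [NeZero n] {p d : ℕ} {s : State} (h1 : s.natReg 1 = n) (hp : s.natReg p = d) :
    ((clamp p).run s).natReg p = vtx n d := by
  by_cases h : n ≤ d
  · rw [clamp, run_ite_true (by simpa [BExp.Holds, NExp.eval, h1, hp] using h)]
    simp [run_setN, NExp.eval, vtx, not_lt.2 h]
  · rw [clamp, run_ite_false (by simpa [BExp.Holds, NExp.eval, h1, hp] using h)]
    simp [run_skip, hp, vtx, not_le.1 h]

/-- Make the point with components in registers `21`, `22` and real register `2` canonical. -/
def canonize : Stmt :=
  ite (.and (.leN (.add (.var 21) (.const 1)) (.var 22))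
      (.and (.leR (dst (.var 21) (.var 22)) (.const 1))
        (.and (.not (.leR (.var 2) (.const 0))) (.not (.leR (.const 1) (.var 2))))))
    skip (seq (setN 22 (.var 21)) (setR 2 (.const 0)))

/-- Compute the components of the point encoded by the last four digits of register `20`. -/
def decodeRegs : Stmt :=
  seq (divMod 21) (seq (divMod 22) (seq (divMod 23) (seq (divMod 24) (seq (clamp 21)
    (seq (clamp 22) (seq decodePos canonize))))))

theorem run_decodeRegs [NeZero n] {G : SimpleGraph (Fin n)} (hG : G.Connected) {m : ℕ} {δ : ℝ}
    {s : State} (h : Ctx G m δ s) {y : ℕ} (h20 : s.natReg 20 = y) (hy : y ≤ space n m) :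
    (decodeRegs.run s).natReg 20 = y / base n m / base n m / base n m / base n m ∧
      (decodeRegs.run s).natReg 21 = (decTri G δ m y).u ∧
      (decodeRegs.run s).natReg 22 = (decTri G δ m y).v ∧
      (decodeRegs.run s).realReg 2 = (decTri G δ m y).a := by
  set Q := base n m with hQ
  have hQ0 : 0 < Q := by rw [hQ, base_eq]; omega
  simp only [decodeRegs, run_seq]
  have c₁ := h.frame ((divMod 21).run_frame s) (by decide)
  obtain ⟨a₁, b₁⟩ := run_divMod (p := 21) (by decide) hQ0 h.reg_q h20 (by rw [h.reg_r]; exact hy)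
  set s₁ := (divMod 21).run s
  have f₂ := (divMod 22).run_frame s₁
  have c₂ := c₁.frame f₂ (by decide)
  have y₂ : y / Q ≤ space n m := (Nat.div_le_self _ _).trans hy
  obtain ⟨a₂, b₂⟩ := run_divMod (p := 22) (by decide) hQ0 c₁.reg_q b₁ (by rwa [c₁.reg_r])
  set s₂ := (divMod 22).run s₁
  have f₃ := (divMod 23).run_frame s₂
  have c₃ := c₂.frame f₃ (by decide)
  have y₃ : y / Q / Q ≤ space n m := (Nat.div_le_self _ _).trans y₂
  obtain ⟨a₃, b₃⟩ := run_divMod (p := 23) (by decide) hQ0 c₂.reg_q b₂ (by rwa [c₂.reg_r])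
  set s₃ := (divMod 23).run s₂
  have f₄ := (divMod 24).run_frame s₃
  have c₄ := c₃.frame f₄ (by decide)
  have y₄ : y / Q / Q / Q ≤ space n m := (Nat.div_le_self _ _).trans y₃
  obtain ⟨a₄, b₄⟩ := run_divMod (p := 24) (by decide) hQ0 c₃.reg_q b₃ (by rwa [c₃.reg_r])
  set s₄ := (divMod 24).run s₃
  have f₅ := (clamp 21).run_frame s₄
  have c₅ := c₄.frame f₅ (by decide)
  have a₅ := run_clamp c₄.reg_n ((f₄.n 21 (by decide)).trans ((f₃.n 21 (by decide)).trans
    ((f₂.n 21 (by decide)).trans a₁)))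
  set s₅ := (clamp 21).run s₄
  have f₆ := (clamp 22).run_frame s₅
  have c₆ := c₅.frame f₆ (by decide)
  have a₆ := run_clamp c₅.reg_n ((f₅.n 22 (by decide)).trans ((f₄.n 22 (by decide)).trans
    ((f₃.n 22 (by decide)).trans a₂)))
  set s₆ := (clamp 22).run s₅
  have f₇ := decodePos.run_frame s₆
  have c₇ := c₆.frame f₇ (by decide)
  have a₇ := run_decodePos (s := s₆) ((f₆.n 23 (by decide)).trans ((f₅.n 23 (by decide)).trans
    ((f₄.n 23 (by decide)).trans a₃))) ((f₆.n 24 (by decide)).trans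
    ((f₅.n 24 (by decide)).trans a₄)) (by rw [c₆.reg_q]; exact (Nat.mod_lt _ hQ0).le)
    (by rw [c₆.reg_q]; exact (Nat.mod_lt _ hQ0).le)
  rw [c₆.reg_d, c₆.reg_off] at a₇
  set s₇ := decodePos.run s₆
  have f₈ := canonize.run_frame s₇
  have e20 : s₇.natReg 20 = y / Q / Q / Q / Q :=
    (f₇.n 20 (by decide)).trans ((f₆.n 20 (by decide)).trans ((f₅.n 20 (by decide)).trans b₄))
  have e21 : s₇.natReg 21 = vtx n (y % Q) :=
    (f₇.n 21 (by decide)).trans ((f₆.n 21 (by decide)).trans a₅)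
  have e22 : s₇.natReg 22 = vtx n (y / Q % Q) := (f₇.n 22 (by decide)).trans a₆
  refine ⟨(f₈.n 20 (by decide)).trans e20, ?_⟩
  have hdec : s₇.realReg 2 = decPos n m δ y := a₇
  have hcond : BExp.Holds s₇ (.and (.leN (.add (.var 21) (.const 1)) (.var 22))
      (.and (.leR (dst (.var 21) (.var 22)) (.const 1))
        (.and (.not (.leR (.var 2) (.const 0))) (.not (.leR (.const 1) (.var 2)))))) ↔
      vtx n (y % Q) < vtx n (y / Q % Q) ∧ G.Adj (vtx n (y % Q)) (vtx n (y / Q % Q)) ∧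
        0 < decPos n m δ y ∧ decPos n m δ y < 1 := by
    have hd := c₇.eval_dst (a := .var 21) (b := .var 22) e21 e22
    simp only [BExp.Holds, hd, NExp.eval, RExp.eval, e21, e22, hdec, Rat.cast_zero, Rat.cast_one,
      not_le]
    -- Distinct vertices of a connected graph have distance at least `1`, so a distance of at most
    -- `1` means adjacency.
    refine and_congr_right fun hlt => and_congr_left fun _ => ?_
    have hpos := hG.pos_dist_of_ne (ne_of_lt (Fin.lt_def.2 hlt))
    rw [← SimpleGraph.dist_eq_one_iff_adj]
    norm_cast
    omega
  by_cases hc : BExp.Holds s₇ (.and (.leN (.add (.var 21) (.const 1)) (.var 22))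
      (.and (.leR (dst (.var 21) (.var 22)) (.const 1))
        (.and (.not (.leR (.var 2) (.const 0))) (.not (.leR (.const 1) (.var 2))))))
  · rw [canonize, run_ite_true hc]
    have hc' := hcond.1 hc
    simp only [decTri, ← hQ, if_pos hc']
    exact ⟨e21, e22, hdec⟩
  · rw [canonize, run_ite_false hc]
    have hc' := fun h' => hc (hcond.2 h')
    simp only [decTri, ← hQ, if_neg hc']
    simp [run_seq, run_setN, run_setR, NExp.eval, RExp.eval, e21]

/-- Decode a point and store it as entry number `27` of the tuple. -/
def decodePoint : Stmt :=
  seq decodeRegs (seq (stN (tuAddr (.var 27)) (.var 21))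
    (seq (stN (tvAddr (.var 27)) (.var 22)) (stR (taAddr (.var 27)) (.var 2))))

theorem run_store {s : State} {R i u v : ℕ} {a : ℝ} {j p q r : ℕ} (hR : s.natReg 5 = R)
    (hi : s.natReg j = i) (hu : s.natReg p = u) (hv : s.natReg q = v) (ha : s.realReg r = a) :
    (seq (stN (tuAddr (.var j)) (.var p)) (seq (stN (tvAddr (.var j)) (.var q))
      (stR (taAddr (.var j)) (.var r)))).run s = { s with
        natMem := Function.update (Function.update s.natMem (R + (i + i)) u) (R + (i + i + 1)) v
        realMem := Function.update s.realMem (R + R + i) a } := by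
  simp only [run, tuAddr, tvAddr, taAddr, NExp.eval, RExp.eval, hR, hi, hu, hv, ha]

theorem Ctx.store {G : SimpleGraph (Fin n)} {m : ℕ} (hm : 0 < m) {δ : ℝ} {s : State}
    (h : Ctx G m δ s) {i : ℕ} (hi : i ≤ m) (u v : ℕ) (a : ℝ) :
    Ctx G m δ { s with
        natMem := Function.update (Function.update s.natMem (space n m + (i + i)) u)
          (space n m + (i + i + 1)) v
        realMem := Function.update s.realMem (space n m + space n m + i) a } := by
  have hb := base_eq n m
  have hs := base_sq_le n hm
  have hq : base n m ≤ base n m * base n m := Nat.le_mul_of_pos_left _ (by omega)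
  refine h.of_eq (by simp) (by simp) (fun w _ => ?_) fun w w' => ?_
  · simp only
    rw [Function.update_of_ne (by omega), Function.update_of_ne (by omega)]
  · have hw : ((w : ℕ) + 1) * base n m ≤ base n m * base n m :=
      Nat.mul_le_mul_right _ (by have := w.2; omega)
    have hw' := w'.2
    simp only
    rw [Function.update_of_ne]
    rw [add_mul] at hw
    omega

theorem Tup.store {m : ℕ} {t : ℕ → Tri n} {s : State} {c : ℕ} (h : Tup m t c s) :
    Tup m t (c + 1) { s with
        natMem := Function.update (Function.update s.natMem (space n m + (c + c)) (t c).u)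
          (space n m + (c + c + 1)) (t c).v
        realMem := Function.update s.realMem (space n m + space n m + c) (t c).a } := by
  intro i hi
  simp only
  rcases Nat.lt_succ_iff_lt_or_eq.1 hi with hi | rfl
  · rw [Function.update_of_ne (by omega), Function.update_of_ne (by omega),
      Function.update_of_ne (by omega), Function.update_of_ne (by omega),
      Function.update_of_ne (by omega)]
    exact h i hi
  · rw [Function.update_of_ne (by omega), Function.update_self, Function.update_self,
      Function.update_self]
    simp

/-- Decode all points of the tuple encoded in register `20`. -/
def decodeLoop : Stmt := loop 27 3 decodePoint

/-- Decode all points and append a copy of the first one. -/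
def decodeAll : Stmt :=
  seq decodeLoop (seq (setN 21 (tu (.const 0))) (seq (setN 22 (tv (.const 0)))
    (seq (setR 2 (ta (.const 0))) (seq (stN (tuAddr (.var 3)) (.var 21))
      (seq (stN (tvAddr (.var 3)) (.var 22)) (stR (taAddr (.var 3)) (.var 2)))))))

end Stmt

/-- The closed sequence of the points encoded by `x`. -/
noncomputable def cyc (G : SimpleGraph (Fin n)) [NeZero n] (δ : ℝ) (m x i : ℕ) : Tri n :=
  if i = m then decTuple G δ m x 0 else decTuple G δ m x i

theorem cyc_of_lt (G : SimpleGraph (Fin n)) [NeZero n] (δ : ℝ) {m i : ℕ} (hi : i < m) (x : ℕ) :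
    cyc G δ m x i = decTuple G δ m x i := if_neg hi.ne

theorem cyc_self (G : SimpleGraph (Fin n)) [NeZero n] (δ : ℝ) (m x : ℕ) :
    cyc G δ m x m = decTuple G δ m x 0 := if_pos rfl

theorem cyc_canon (G : SimpleGraph (Fin n)) [NeZero n] (δ : ℝ) (m x i : ℕ) :
    (cyc G δ m x i).Canon G := by
  unfold cyc
  split_ifs <;> exact decTri_canon _ _ _ _

theorem codeLen_eq_sum_cyc (G : SimpleGraph (Fin n)) [NeZero n] (δ : ℝ) (m x : ℕ) :
    codeLen G δ m x = ∑ i ∈ Finset.range m, td G (cyc G δ m x i) (cyc G δ m x (i + 1)) :=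
  Finset.sum_congr rfl fun i hi => by
    rw [cyc_of_lt G δ (Finset.mem_range.1 hi)]
    rfl

namespace Stmt

/-- After `j` rounds the lowest `4 * j` digits have been split off. Entry `m` repeats entry `0`, so
that the successor of point `i < m` is always entry `i + 1`. -/
theorem run_decodeAll [NeZero n] {G : SimpleGraph (Fin n)} (hG : G.Connected) {m : ℕ} (hm : 0 < m)
    {δ : ℝ} {s : State} (h : Ctx G m δ s) {x : ℕ} (h20 : s.natReg 20 = x) (hx : x < space n m) :
    Ctx G m δ (decodeAll.run s) ∧ Tup m (cyc G δ m x) (m + 1) (decodeAll.run s) := by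
  have key : (Ctx G m δ (decodeLoop.run s) ∧ Tup m (cyc G δ m x) (s.natReg 3) (decodeLoop.run s)) ∧
      (decodeLoop.run s).natReg 20 = x / (base n m ^ 4) ^ (s.natReg 3) := by
    refine run_loop_inv (fun j st => (Ctx G m δ st ∧ Tup m (cyc G δ m x) j st) ∧
      st.natReg 20 = x / (base n m ^ 4) ^ j) ⟨⟨h.setN (by decide) 0, ?_⟩, by simp [h20]⟩ ?_
    · intro i hi
      omega
    · rintro j st hj hj' - ⟨⟨i1, i2⟩, i3⟩
      rw [h.reg_m] at hj
      obtain ⟨r1, r2, r3, r4⟩ := run_decodeRegs hG i1 i3 ((Nat.div_le_self _ _).trans hx.le)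
      have f := decodeRegs.run_frame st
      have c := i1.frame f (by decide)
      have t := i2.frame f (by decide)
      rw [decodePoint, run_seq, run_store c.reg_r ((f.n 27 (by decide)).trans hj') r2 r3 r4]
      have hd : decTri G δ m (x / (base n m ^ 4) ^ j) = cyc G δ m x j :=
        (cyc_of_lt G δ hj x).symm
      rw [hd]
      refine ⟨⟨(Ctx.store hm c hj.le _ _ _).setN (by decide) _, (Tup.store t).setN _ _⟩, ?_⟩
      simp only [State.setN_natReg, show (20 : ℕ) ≠ 27 by decide, if_false, r1]
      rw [Nat.div_div_eq_div_mul, Nat.div_div_eq_div_mul, Nat.div_div_eq_div_mul,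
        Nat.div_div_eq_div_mul]
      congr 1
      ring
  rw [h.reg_m] at key
  obtain ⟨⟨k1, k2⟩, -⟩ := key
  rw [decodeAll, run_seq]
  set s₁ := decodeLoop.run s
  have e1 := k1.eval_tu k2 (e := .const 0) (i := 0) rfl hm
  have e2 := k1.eval_tv k2 (e := .const 0) (i := 0) rfl hm
  have e3 := k1.eval_ta k2 (e := .const 0) (i := 0) rfl hm
  have h0 : cyc G δ m x 0 = cyc G δ m x m := by rw [cyc_self, cyc_of_lt G δ hm]
  rw [h0] at e1 e2 e3
  rw [run_seq, run_setN, run_seq, run_setN, run_seq, run_setR]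
  set s₂ := s₁.setN 21 ((tu (.const 0)).eval s₁)
  have c₂ : Ctx G m δ s₂ := k1.setN (by decide) _
  have t₂ : Tup m (cyc G δ m x) m s₂ := k2.setN _ _
  have e2' := c₂.eval_tv t₂ (e := .const 0) (i := 0) rfl hm
  set s₃ := s₂.setN 22 ((tv (.const 0)).eval s₂)
  have c₃ : Ctx G m δ s₃ := c₂.setN (by decide) _
  have t₃ : Tup m (cyc G δ m x) m s₃ := t₂.setN _ _
  have e3' := c₃.eval_ta t₃ (e := .const 0) (i := 0) rfl hm
  set s₄ := s₃.setR 2 ((ta (.const 0)).eval s₃)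
  have c₄ : Ctx G m δ s₄ := c₃.setR (by decide) _
  have t₄ : Tup m (cyc G δ m x) m s₄ := t₃.setR _ _
  rw [h0] at e2' e3'
  rw [run_store (u := (cyc G δ m x m).u) (v := (cyc G δ m x m).v) (a := (cyc G δ m x m).a)
    c₄.reg_r c₄.reg_m ?_ ?_ ?_]
  · exact ⟨Ctx.store hm c₄ le_rfl _ _ _, Tup.store t₄⟩
  · simp [s₄, s₃, s₂, e1]
  · simp [s₄, s₃, e2']
  · simp [s₄, e3']

end Stmt

end DeltaTour

/-! ## Subprograms: testing whether a tuple covers the graph -/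

namespace DeltaTour

variable {n : ℕ}

/-- The position `β` of the edge `ab` and all positions slightly above are covered by `t`. -/
def GermCovered (G : SimpleGraph (Fin n)) (δ : ℝ) (a b : Fin n) (t : Tri n) (β : ℝ) : Prop :=
  ∃ k, leftEnd G δ a b t k ≤ β ∧ β < rightEnd G δ a b t k

/-- If `β` is a position of the edge `ab`, then it and all positions slightly above are covered by
one of the points. -/
def GermOk (G : SimpleGraph (Fin n)) (δ : ℝ) (a b : Fin n) (m : ℕ) (t : ℕ → Tri n) (β : ℝ) : Prop :=
  0 ≤ β → β < 1 → ∃ i < m, GermCovered G δ a b (t i) β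

/-- The continuum of positions on an edge is reduced to the position `0` and the right ends of the
covered intervals. -/
theorem edge_covered_iff {G : SimpleGraph (Fin n)} {δ : ℝ} {a b : Fin n} {m : ℕ} {t : ℕ → Tri n} :
    (∀ y ∈ Set.Icc (0 : ℝ) 1, ∃ i < m, td G ⟨a, b, y⟩ (t i) ≤ δ) ↔
      GermOk G δ a b m t 0 ∧ ∀ i < m, ∀ k, GermOk G δ a b m t (rightEnd G δ a b (t i) k) := by
  have e : (∀ y ∈ Set.Icc (0 : ℝ) 1, ∃ i < m, td G ⟨a, b, y⟩ (t i) ≤ δ) ↔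
      ∀ y ∈ Set.Icc (0 : ℝ) 1, ∃ p : Fin m × Fin 5,
        leftEnd G δ a b (t p.1) p.2 ≤ y ∧ y ≤ rightEnd G δ a b (t p.1) p.2 := by
    refine forall₂_congr fun y hy => ?_
    constructor
    · rintro ⟨i, hi, h⟩
      obtain ⟨k, hk⟩ := (td_le_iff_ends hy).1 h
      exact ⟨⟨⟨i, hi⟩, k⟩, hk⟩
    · rintro ⟨⟨i, k⟩, hk⟩
      exact ⟨i, i.2, (td_le_iff_ends hy).2 ⟨k, hk⟩⟩
  rw [e, cover_iff_germ]
  have e' : ∀ β, (∃ j : Fin m × Fin 5, leftEnd G δ a b (t j.1) j.2 ≤ β ∧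
      β < rightEnd G δ a b (t j.1) j.2) ↔ ∃ i < m, GermCovered G δ a b (t i) β := by
    intro β
    constructor
    · rintro ⟨⟨i, k⟩, hk⟩
      exact ⟨i, i.2, k, hk⟩
    · rintro ⟨i, hi, k, hk⟩
      exact ⟨⟨⟨i, hi⟩, k⟩, hk⟩
  simp only [e']
  constructor
  · intro h
    exact ⟨h 0 (.inl rfl), fun i hi k => h _ (.inr ⟨⟨⟨i, hi⟩, k⟩, rfl⟩)⟩
  · rintro ⟨h0, h⟩ β (rfl | ⟨⟨i, k⟩, rfl⟩)
    · exact h0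
    · exact h i i.2 k

/-- Distance of the vertex `x` to a point of the tuple, via either end of the edge. -/
def viaU (j x : NExp) : RExp := .add (ta j) (dst (tu j) x)

def viaV (j x : NExp) : RExp := .add (.sub (.const 1) (ta j)) (dst (tv j) x)

/-- The point of the tuple lies on the edge given by registers `30` and `31`. -/
def onEdge (j : NExp) : BExp := .and (.eqN (.var 30) (tu j)) (.eqN (.var 31) (tv j))

/-- The germ at the position in real register `3` is covered by a point of the tuple. -/
def germTest (j : NExp) : BExp :=
  .or (.not (.leR (.sub (.var 0) (viaU j (.var 30))) (.var 3)))
    (.or (.not (.leR (.sub (.var 0) (viaV j (.var 30))) (.var 3)))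
      (.or (.leR (.sub (.add (.const 1) (viaU j (.var 31))) (.var 0)) (.var 3))
        (.or (.leR (.sub (.add (.const 1) (viaV j (.var 31))) (.var 0)) (.var 3))
          (.and (onEdge j) (.and (.leR (.sub (ta j) (.var 0)) (.var 3))
            (.not (.leR (.add (ta j) (.var 0)) (.var 3))))))))

section

variable {G : SimpleGraph (Fin n)} {m : ℕ} {δ : ℝ} {s : State} {t : ℕ → Tri n} {c : ℕ}

theorem Ctx.eval_viaU (h : Ctx G m δ s) (ht : Tup m t c s) {e x : NExp} {i : ℕ} {w : Fin n}
    (he : e.eval s = i) (hi : i < c) (hx : x.eval s = w) :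
    (viaU e x).eval s = (t i).a + G.dist (t i).u w := by
  simp only [viaU, RExp.eval, h.eval_ta ht he hi, h.eval_dst (h.eval_tu ht he hi) hx]

theorem Ctx.eval_viaV (h : Ctx G m δ s) (ht : Tup m t c s) {e x : NExp} {i : ℕ} {w : Fin n}
    (he : e.eval s = i) (hi : i < c) (hx : x.eval s = w) :
    (viaV e x).eval s = 1 - (t i).a + G.dist (t i).v w := by
  simp only [viaV, RExp.eval, h.eval_ta ht he hi, h.eval_dst (h.eval_tv ht he hi) hx, Rat.cast_one]

theorem Ctx.holds_onEdge (h : Ctx G m δ s) (ht : Tup m t c s) {e : NExp} {i : ℕ} {a b : Fin n}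
    (he : e.eval s = i) (hi : i < c) (ha : s.natReg 30 = a) (hb : s.natReg 31 = b) :
    (onEdge e).Holds s ↔ a = (t i).u ∧ b = (t i).v := by
  simp only [onEdge, BExp.Holds, BExp.holds_eqN, h.eval_tu ht he hi, h.eval_tv ht he hi,
    NExp.eval, ha, hb, Fin.ext_iff]

/-- For a position in the half-open unit interval, the comparisons with the ends `0` and `1` are
true and need no code. -/
theorem Ctx.holds_germTest (h : Ctx G m δ s) (ht : Tup m t c s) {e : NExp} {i : ℕ} {a b : Fin n}
    (he : e.eval s = i) (hi : i < c) (ha : s.natReg 30 = a) (hb : s.natReg 31 = b)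
    (h0 : 0 ≤ s.realReg 3) (h1 : s.realReg 3 < 1) :
    (germTest e).Holds s ↔ GermCovered G δ a b (t i) (s.realReg 3) := by
  simp only [germTest, BExp.holds_or, BExp.Holds, h.holds_onEdge ht he hi ha hb, RExp.eval,
    h.eval_viaU ht he hi (x := .var 30) ha, h.eval_viaU ht he hi (x := .var 31) hb,
    h.eval_viaV ht he hi (x := .var 30) ha, h.eval_viaV ht he hi (x := .var 31) hb,
    h.eval_ta ht he hi, h.reg_d, Rat.cast_one, not_le]
  simp only [GermCovered, Fin.exists_fin_succ, leftEnd, rightEnd]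
  simp only [Matrix.cons_val_zero, Matrix.cons_val_succ, IsEmpty.exists_iff, or_false, h0, h1,
    true_and, and_true]
  refine or_congr Iff.rfl (or_congr Iff.rfl (or_congr Iff.rfl (or_congr Iff.rfl ?_)))
  by_cases hs : a = (t i).u ∧ b = (t i).v
  · simp only [hs, and_self, if_true, true_and]
  · simp only [hs, if_false, false_and, false_iff, not_and, not_lt]
    intro _
    linarith

end

namespace Stmt

/-- Look for a point of the tuple that covers the germ at the position in real register `3`. -/
def germLoop : Stmt := loop 33 3 (ite (germTest (.var 33)) (setN 34 (.const 1)) skip)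

/-- Set register `35` if the germ at the position in real register `3` is not covered. -/
def germCheck : Stmt :=
  seq (setN 34 (.const 0)) (seq germLoop
    (ite (.and (.leR (.const 0) (.var 3)) (.and (.not (.leR (.const 1) (.var 3)))
      (.leN (.var 34) (.const 0)))) (setN 35 (.const 1)) skip))

/-- Register `35` is only ever raised, so successive checks accumulate the conjunction of their
conditions. -/
theorem run_germCheck {G : SimpleGraph (Fin n)} {m : ℕ} {δ : ℝ} {s : State} {t : ℕ → Tri n}
    {c : ℕ} (h : Ctx G m δ s) (ht : Tup m t c s) (hc : m ≤ c) {a b : Fin n}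
    (ha : s.natReg 30 = a) (hb : s.natReg 31 = b) :
    (germCheck.run s).natReg 35 = 0 ↔ s.natReg 35 = 0 ∧ GermOk G δ a b m t (s.realReg 3) := by
  rw [germCheck, run_seq, run_setN, run_seq]
  set s₁ := s.setN 34 ((NExp.const 0).eval s) with hs₁
  have c₁ : Ctx G m δ s₁ := h.setN (by decide) _
  have t₁ : Tup m t c s₁ := ht.setN _ _
  have key : 0 ≤ s.realReg 3 → s.realReg 3 < 1 → ((germLoop.run s₁).natReg 34 = 0 ↔
      ¬ ∃ i < s₁.natReg 3, GermCovered G δ a b (t i) (s.realReg 3)) := by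
    intro h0 h1
    refine run_loop_inv (fun j st => st.natReg 34 = 0 ↔
      ¬ ∃ i < j, GermCovered G δ a b (t i) (s.realReg 3)) (by simp [hs₁, NExp.eval]) ?_
    intro j st hj hj' hf hi
    rw [c₁.reg_m] at hj
    have f3 : st.realReg 3 = s.realReg 3 := hf.r 3 (by decide)
    have ht' := (c₁.frame hf (by decide)).holds_germTest (t₁.frame hf (by decide)) (e := .var 33)
      hj' (hj.trans_le hc) ((hf.n 30 (by decide)).trans ha) ((hf.n 31 (by decide)).trans hb)
      (by rwa [f3]) (by rwa [f3])
    rw [f3] at ht'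
    by_cases hg : GermCovered G δ a b (t j) (s.realReg 3)
    · rw [run_ite_true (ht'.2 hg)]
      simp only [run_setN, State.setN_natReg, NExp.eval, show (34 : ℕ) ≠ 33 by decide, if_false,
        if_true, one_ne_zero, false_iff, not_not]
      exact ⟨j, by omega, hg⟩
    · rw [run_ite_false fun h => hg (ht'.1 h)]
      simp only [run_skip, State.setN_natReg, show (34 : ℕ) ≠ 33 by decide, if_false, hi]
      refine not_congr ⟨fun ⟨i, hi, h⟩ => ⟨i, by omega, h⟩, fun ⟨i, hi, h⟩ => ⟨i, ?_, h⟩⟩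
      rcases Nat.lt_succ_iff_lt_or_eq.1 hi with hi | rfl
      · exact hi
      · exact absurd h hg
  rw [c₁.reg_m] at key
  have f := germLoop.run_frame s₁
  set s₂ := germLoop.run s₁
  have f3 : s₂.realReg 3 = s.realReg 3 := f.r 3 (by decide)
  have f35 : s₂.natReg 35 = s.natReg 35 := (f.n 35 (by decide)).trans (by simp [hs₁])
  by_cases hcond : BExp.Holds s₂ (.and (.leR (.const 0) (.var 3))
      (.and (.not (.leR (.const 1) (.var 3))) (.leN (.var 34) (.const 0))))
  · rw [run_ite_true hcond]
    simp only [BExp.Holds, RExp.eval, NExp.eval, f3, Rat.cast_zero, Rat.cast_one, not_le] at hcond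
    obtain ⟨h0, h1, h2⟩ := hcond
    simp only [run_setN, State.setN_natReg, if_true, NExp.eval, one_ne_zero, false_iff, not_and]
    intro _ hok
    exact (key h0 h1).1 (by omega) (hok h0 h1)
  · rw [run_ite_false hcond]
    simp only [BExp.Holds, RExp.eval, NExp.eval, f3, Rat.cast_zero, Rat.cast_one, not_le,
      not_and] at hcond
    rw [run_skip, f35]
    refine (and_iff_left ?_).symm
    intro h0 h1
    by_contra hno
    have := hcond h0 h1
    have := (key h0 h1).2 hno
    omega

/-- Test the germs at the right ends of the intervals covered by point number `32`. -/
def germPoint : Stmt :=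
  seq (setR 3 (.sub (.var 0) (viaU (.var 32) (.var 30)))) (seq germCheck
    (seq (setR 3 (.sub (.var 0) (viaV (.var 32) (.var 30)))) (seq germCheck
      (ite (onEdge (.var 32)) (seq (setR 3 (.add (ta (.var 32)) (.var 0))) germCheck) skip))))

theorem run_germPoint {G : SimpleGraph (Fin n)} {m : ℕ} {δ : ℝ} {s : State} {t : ℕ → Tri n}
    {c : ℕ} (h : Ctx G m δ s) (ht : Tup m t c s) (hc : m ≤ c) {a b : Fin n}
    (ha : s.natReg 30 = a) (hb : s.natReg 31 = b) {i : ℕ} (hi : s.natReg 32 = i) (him : i < m) :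
    (germPoint.run s).natReg 35 = 0 ↔
      s.natReg 35 = 0 ∧ ∀ k, GermOk G δ a b m t (rightEnd G δ a b (t i) k) := by
  have e : (∀ k, GermOk G δ a b m t (rightEnd G δ a b (t i) k)) ↔
      GermOk G δ a b m t (δ - ((t i).a + G.dist (t i).u a)) ∧
      GermOk G δ a b m t (δ - (1 - (t i).a + G.dist (t i).v a)) ∧
      (a = (t i).u ∧ b = (t i).v → GermOk G δ a b m t ((t i).a + δ)) := by
    -- The right ends `1` and `-1` are not in the half-open unit interval and impose no condition.
    -- So at most three of the five right ends are tested.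
    have h1 : GermOk G δ a b m t 1 := fun _ h => absurd h (lt_irrefl _)
    have h2 : GermOk G δ a b m t (-1) := fun h => absurd h (by norm_num)
    simp only [Fin.forall_fin_succ, rightEnd]
    simp only [Matrix.cons_val_zero, Matrix.cons_val_succ, IsEmpty.forall_iff, and_true, h1,
      true_and]
    refine and_congr Iff.rfl (and_congr Iff.rfl ?_)
    by_cases hs : a = (t i).u ∧ b = (t i).v
    · simp only [hs, and_self, if_true, true_imp_iff]
    · simp only [hs, if_false, h2, false_imp_iff]
  rw [e, germPoint, run_seq, run_setR, run_seq, run_seq, run_setR, run_seq]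
  have hic : i < c := him.trans_le hc
  have v₁ : (RExp.sub (.var 0) (viaU (.var 32) (.var 30))).eval s =
      δ - ((t i).a + G.dist (t i).u a) := by
    rw [RExp.eval, h.eval_viaU ht (e := .var 32) hi hic (x := .var 30) ha, RExp.eval, h.reg_d]
  rw [v₁]
  set s₁ := s.setR 3 (δ - ((t i).a + G.dist (t i).u a)) with hs₁
  have c₁ : Ctx G m δ s₁ := h.setR (by decide) _
  have t₁ : Tup m t c s₁ := ht.setR _ _
  have r₁ := run_germCheck c₁ t₁ hc (a := a) (b := b) ha hb
  have f₁ := germCheck.run_frame s₁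
  have c₁' := c₁.frame f₁ (by decide)
  have t₁' := t₁.frame f₁ (by decide)
  set s₂ := germCheck.run s₁
  have ha₂ : s₂.natReg 30 = a := (f₁.n 30 (by decide)).trans ha
  have hb₂ : s₂.natReg 31 = b := (f₁.n 31 (by decide)).trans hb
  have hi₂ : s₂.natReg 32 = i := (f₁.n 32 (by decide)).trans hi
  have v₂ : (RExp.sub (.var 0) (viaV (.var 32) (.var 30))).eval s₂ =
      δ - (1 - (t i).a + G.dist (t i).v a) := by
    rw [RExp.eval, c₁'.eval_viaV t₁' (e := .var 32) hi₂ hic (x := .var 30) ha₂, RExp.eval,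
      c₁'.reg_d]
  rw [v₂]
  set s₃ := s₂.setR 3 (δ - (1 - (t i).a + G.dist (t i).v a)) with hs₃
  have c₃ : Ctx G m δ s₃ := c₁'.setR (by decide) _
  have t₃ : Tup m t c s₃ := t₁'.setR _ _
  have r₃ := run_germCheck c₃ t₃ hc (a := a) (b := b) ha₂ hb₂
  have f₃ := germCheck.run_frame s₃
  have c₃' := c₃.frame f₃ (by decide)
  have t₃' := t₃.frame f₃ (by decide)
  set s₄ := germCheck.run s₃
  have ha₄ : s₄.natReg 30 = a := (f₃.n 30 (by decide)).trans ha₂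
  have hb₄ : s₄.natReg 31 = b := (f₃.n 31 (by decide)).trans hb₂
  have hi₄ : s₄.natReg 32 = i := (f₃.n 32 (by decide)).trans hi₂
  have he := c₃'.holds_onEdge t₃' (e := .var 32) hi₄ hic ha₄ hb₄
  have x₁ : s₁.realReg 3 = δ - ((t i).a + G.dist (t i).u a) := by simp [hs₁]
  have x₃ : s₃.realReg 3 = δ - (1 - (t i).a + G.dist (t i).v a) := by simp [hs₃]
  have y₁ : s₁.natReg 35 = s.natReg 35 := rfl
  have y₃ : s₃.natReg 35 = s₂.natReg 35 := rfl
  rw [x₁, y₁] at r₁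
  rw [x₃, y₃, r₁] at r₃
  by_cases hs : a = (t i).u ∧ b = (t i).v
  · rw [run_ite_true (he.2 hs), run_seq, run_setR]
    have v₅ : (RExp.add (ta (.var 32)) (.var 0)).eval s₄ = (t i).a + δ := by
      rw [RExp.eval, c₃'.eval_ta t₃' (e := .var 32) hi₄ hic, RExp.eval, c₃'.reg_d]
    rw [v₅]
    set s₅ := s₄.setR 3 ((t i).a + δ) with hs₅
    have c₅ : Ctx G m δ s₅ := c₃'.setR (by decide) _
    have t₅ : Tup m t c s₅ := t₃'.setR _ _
    rw [run_germCheck c₅ t₅ hc (a := a) (b := b) ha₄ hb₄]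
    have x₅ : s₅.realReg 3 = (t i).a + δ := by simp [hs₅]
    have y₅ : s₅.natReg 35 = s₄.natReg 35 := rfl
    rw [x₅, y₅, r₃]
    exact ⟨fun ⟨⟨⟨p, q⟩, r⟩, w⟩ => ⟨p, q, r, fun _ => w⟩,
      fun ⟨p, q, r, w⟩ => ⟨⟨⟨p, q⟩, r⟩, w hs⟩⟩
  · rw [run_ite_false fun h => hs (he.1 h), run_skip, r₃]
    exact ⟨fun ⟨⟨p, q⟩, r⟩ => ⟨p, q, r, fun w => absurd w hs⟩, fun ⟨p, q, r, _⟩ => ⟨⟨p, q⟩, r⟩⟩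

/-- Set register `35` if the edge given by registers `30` and `31` is not covered. -/
def edgeCheck : Stmt := seq (setR 3 (.const 0)) (seq germCheck (loop 32 3 germPoint))

theorem run_edgeCheck {G : SimpleGraph (Fin n)} {m : ℕ} {δ : ℝ} {s : State} {t : ℕ → Tri n}
    {c : ℕ} (h : Ctx G m δ s) (ht : Tup m t c s) (hc : m ≤ c) {a b : Fin n}
    (ha : s.natReg 30 = a) (hb : s.natReg 31 = b) : (edgeCheck.run s).natReg 35 = 0 ↔
      s.natReg 35 = 0 ∧ ∀ y ∈ Set.Icc (0 : ℝ) 1, ∃ i < m, td G ⟨a, b, y⟩ (t i) ≤ δ := by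
  rw [edge_covered_iff, edgeCheck, run_seq, run_setR, run_seq]
  set s₁ := s.setR 3 ((RExp.const 0).eval s) with hs₁
  have c₁ : Ctx G m δ s₁ := h.setR (by decide) _
  have t₁ : Tup m t c s₁ := ht.setR _ _
  have r₁ := run_germCheck c₁ t₁ hc (a := a) (b := b) ha hb
  have x₁ : s₁.realReg 3 = 0 := by simp [hs₁, RExp.eval]
  have y₁ : s₁.natReg 35 = s.natReg 35 := rfl
  rw [x₁, y₁] at r₁
  have f₁ := germCheck.run_frame s₁
  have c₂ := c₁.frame f₁ (by decide)
  have t₂ := t₁.frame f₁ (by decide)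
  set s₂ := germCheck.run s₁
  have ha₂ : s₂.natReg 30 = a := (f₁.n 30 (by decide)).trans ha
  have hb₂ : s₂.natReg 31 = b := (f₁.n 31 (by decide)).trans hb
  have key : ((loop 32 3 germPoint).run s₂).natReg 35 = 0 ↔ s₂.natReg 35 = 0 ∧
      ∀ i < s₂.natReg 3, ∀ k, GermOk G δ a b m t (rightEnd G δ a b (t i) k) := by
    refine run_loop_inv (fun j st => st.natReg 35 = 0 ↔ s₂.natReg 35 = 0 ∧
      ∀ i < j, ∀ k, GermOk G δ a b m t (rightEnd G δ a b (t i) k)) (by simp) ?_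
    intro j st hj hj' hf hi
    rw [c₂.reg_m] at hj
    have := run_germPoint (c₂.frame hf (by decide)) (t₂.frame hf (by decide)) hc
      ((hf.n 30 (by decide)).trans ha₂) ((hf.n 31 (by decide)).trans hb₂) hj' hj
    simp only [State.setN_natReg, show (35 : ℕ) ≠ 32 by decide, if_false]
    rw [this, hi, and_assoc]
    refine and_congr Iff.rfl ⟨fun h i hi => ?_, fun h => ⟨fun i hi => h i (by omega), h j (by omega)⟩⟩
    rcases Nat.lt_succ_iff_lt_or_eq.1 hi with hi | rfl
    exacts [h.1 i hi, h.2]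
  rw [key, r₁, c₂.reg_m, and_assoc]

/-- Test the edge given by registers `30` and `31`, if it is one. -/
def pairCheck : Stmt :=
  ite (.and (.leN (.add (.var 30) (.const 1)) (.var 31))
    (.leR (dst (.var 30) (.var 31)) (.const 1))) edgeCheck skip

/-- Set register `35` to `0` if the tuple covers the graph, and to another value otherwise. -/
def coverCheck : Stmt := seq (setN 35 (.const 0)) (loop 30 1 (loop 31 1 pairCheck))

theorem run_coverCheck {G : SimpleGraph (Fin n)} (hG : G.Connected) {m : ℕ} {δ : ℝ} {s : State}
    {t : ℕ → Tri n} {c : ℕ} (h : Ctx G m δ s) (ht : Tup m t c s) (hc : m ≤ c) :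
    (coverCheck.run s).natReg 35 = 0 ↔ ∀ a b, G.Adj a b → a < b →
      ∀ y ∈ Set.Icc (0 : ℝ) 1, ∃ i < m, td G ⟨a, b, y⟩ (t i) ≤ δ := by
  let E : Fin n → Fin n → Prop := fun a b => G.Adj a b → a < b →
    ∀ y ∈ Set.Icc (0 : ℝ) 1, ∃ i < m, td G ⟨a, b, y⟩ (t i) ≤ δ
  have pair : ∀ (st : State) (a b : Fin n), Ctx G m δ st → Tup m t c st → st.natReg 30 = a →
      st.natReg 31 = b → ((pairCheck.run st).natReg 35 = 0 ↔ st.natReg 35 = 0 ∧ E a b) := by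
    intro st a b hst htt ha hb
    have hd := hst.eval_dst (a := .var 30) (b := .var 31) ha hb
    have hcond : BExp.Holds st (.and (.leN (.add (.var 30) (.const 1)) (.var 31))
        (.leR (dst (.var 30) (.var 31)) (.const 1))) ↔ G.Adj a b ∧ a < b := by
      simp only [BExp.Holds, hd, NExp.eval, RExp.eval, ha, hb, Rat.cast_one]
      rw [← SimpleGraph.dist_eq_one_iff_adj, Fin.lt_def]
      norm_cast
      constructor
      · rintro ⟨h1, h2⟩
        have := hG.pos_dist_of_ne (ne_of_lt (Fin.lt_def.2 h1))
        omega
      · omega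
    by_cases hab : G.Adj a b ∧ a < b
    · rw [pairCheck, run_ite_true (hcond.2 hab), run_edgeCheck hst htt hc ha hb]
      simp only [E, hab, true_imp_iff]
    · rw [pairCheck, run_ite_false fun h => hab (hcond.1 h), run_skip]
      refine (and_iff_left ?_).symm
      exact fun h1 h2 => absurd ⟨h1, h2⟩ hab
  rw [coverCheck, run_seq, run_setN]
  set s₁ := s.setN 35 ((NExp.const 0).eval s) with hs₁
  have c₁ : Ctx G m δ s₁ := h.setN (by decide) _
  have t₁ : Tup m t c s₁ := ht.setN _ _
  have key : ((loop 30 1 (loop 31 1 pairCheck)).run s₁).natReg 35 = 0 ↔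
      ∀ a : Fin n, (a : ℕ) < s₁.natReg 1 → ∀ b, E a b := by
    refine run_loop_inv (fun j st => st.natReg 35 = 0 ↔ ∀ a : Fin n, (a : ℕ) < j → ∀ b, E a b)
      (by simp [hs₁, NExp.eval]) ?_
    intro j st hj hj' hf hi
    rw [c₁.reg_n] at hj
    have c₂ := c₁.frame hf (by decide)
    have t₂ := t₁.frame hf (by decide)
    have inner : ((loop 31 1 pairCheck).run st).natReg 35 = 0 ↔
        st.natReg 35 = 0 ∧ ∀ b : Fin n, (b : ℕ) < st.natReg 1 → E ⟨j, hj⟩ b := by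
      refine run_loop_inv (fun l st' => st'.natReg 35 = 0 ↔
        st.natReg 35 = 0 ∧ ∀ b : Fin n, (b : ℕ) < l → E ⟨j, hj⟩ b) (by simp) ?_
      intro l st' hl hl' hf' hi'
      rw [c₂.reg_n] at hl
      have := pair st' ⟨j, hj⟩ ⟨l, hl⟩ (c₂.frame hf' (by decide)) (t₂.frame hf' (by decide))
        ((hf'.n 30 (by decide)).trans hj') hl'
      simp only [State.setN_natReg, show (35 : ℕ) ≠ 31 by decide, if_false]
      rw [this, hi', and_assoc]
      refine and_congr Iff.rfl ⟨fun h b hb => ?_,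
        fun h => ⟨fun b hb => h b (by omega), h ⟨l, hl⟩ (by simp)⟩⟩
      rcases Nat.lt_succ_iff_lt_or_eq.1 hb with hb | hb
      · exact h.1 b hb
      · have : b = ⟨l, hl⟩ := Fin.ext hb
        rw [this]
        exact h.2
    rw [c₂.reg_n] at inner
    simp only [State.setN_natReg, show (35 : ℕ) ≠ 30 by decide, if_false]
    rw [inner, hi]
    refine ⟨fun h a ha b => ?_, fun h => ⟨fun a ha => h a (by omega), fun b _ => h ⟨j, hj⟩ (by simp) b⟩⟩
    rcases Nat.lt_succ_iff_lt_or_eq.1 ha with ha | ha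
    · exact h.1 a ha b
    · have : a = ⟨j, hj⟩ := Fin.ext ha
      rw [this]
      exact h.2 b b.2
  rw [key, c₁.reg_n]
  exact ⟨fun h a b => h a a.2 b, fun h a _ b => h a b⟩

end Stmt

end DeltaTour

/-! ## Subprograms: the length of a closed route, and the search for a shortest one -/

namespace DeltaTour

variable {n : ℕ}

/-- The vertices `x` and `y` are ends of the edges of `X` and `Y`, and `l` is the length of the route
from `X` via `x` and `y` to `Y`. -/
def Via (G : SimpleGraph (Fin n)) (X Y : Tri n) (x y : Fin n) (l : ℝ) : Prop :=
  ∃ cx cy : ℝ, ((x = X.u ∧ cx = X.a) ∨ (x = X.v ∧ cx = 1 - X.a)) ∧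
    ((y = Y.u ∧ cy = Y.a) ∨ (y = Y.v ∧ cy = 1 - Y.a)) ∧ l = cx + (cy + G.dist y x)

namespace Stmt

/-- Compare the route in registers `41`, `42` and real register `4` with another one. -/
def better (e : RExp) (x y : NExp) : Stmt :=
  seq (setR 5 e) (ite (.leR (.var 4) (.var 5)) skip
    (seq (setN 41 x) (seq (setN 42 y) (setR 4 (.var 5)))))

/-- Registers `41`, `42` and real register `4` hold a route between entries `i` and `i + 1`. -/
structure RouteInv (G : SimpleGraph (Fin n)) (m : ℕ) (δ : ℝ) (t : ℕ → Tri n) (c i : ℕ) (l : ℝ)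
    (s : State) : Prop where
  ctx : Ctx G m δ s
  tup : Tup m t c s
  index : s.natReg 40 = i
  len : s.realReg 4 = l
  via : ∃ x y : Fin n, s.natReg 41 = x ∧ s.natReg 42 = y ∧ Via G (t i) (t (i + 1)) x y l

section Route

variable {G : SimpleGraph (Fin n)} {m : ℕ} {δ : ℝ} {t : ℕ → Tri n} {c i : ℕ} {l l' : ℝ} {s : State}

/-- The expressions `x` and `y` are evaluated after other registers have changed, whence the
hypothesis on all configurations `s'` with the same context. -/
theorem RouteInv.better (h : RouteInv G m δ t c i l s) {e : RExp} {x y : NExp} {u v : Fin n}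
    (he : e.eval s = l')
    (hx : ∀ s', Ctx G m δ s' → Tup m t c s' → s'.natReg 40 = i → x.eval s' = u ∧ y.eval s' = v)
    (hv : Via G (t i) (t (i + 1)) u v l') :
    RouteInv G m δ t c i (min l l') ((better e x y).run s) := by
  obtain ⟨x₀, y₀, hx₀, hy₀, hv₀⟩ := h.via
  have hk : (Stmt.better e x y).keeps = true := rfl
  have f := (Stmt.better e x y).run_frame s
  have c' := h.ctx.frame f hk
  have t' := h.tup.frame f hk
  have i' : ((Stmt.better e x y).run s).natReg 40 = i :=
    (f.n 40 (by simp [Stmt.better, writesN])).trans h.index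
  suffices hs : ((Stmt.better e x y).run s).realReg 4 = min l l' ∧ ∃ x₁ y₁ : Fin n,
      ((Stmt.better e x y).run s).natReg 41 = x₁ ∧ ((Stmt.better e x y).run s).natReg 42 = y₁ ∧
      Via G (t i) (t (i + 1)) x₁ y₁ (min l l') from ⟨c', t', i', hs.1, hs.2⟩
  rw [Stmt.better, run_seq, run_setR, he]
  set s₁ := s.setR 5 l' with hs₁
  have c₁ : Ctx G m δ s₁ := h.ctx.setR (by decide) _
  have t₁ : Tup m t c s₁ := h.tup.setR _ _
  have hcond : BExp.Holds s₁ (.leR (.var 4) (.var 5)) ↔ l ≤ l' := by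
    simp [BExp.Holds, RExp.eval, hs₁, h.len]
  by_cases hle : l ≤ l'
  · rw [run_ite_true (hcond.2 hle), run_skip, min_eq_left hle]
    exact ⟨by simp [hs₁, h.len], x₀, y₀, hx₀, hy₀, hv₀⟩
  · rw [run_ite_false fun h => hle (hcond.1 h), min_eq_right (not_le.1 hle).le, run_seq, run_seq,
      run_setN, run_setN, run_setR, (hx s₁ c₁ t₁ h.index).1]
    set s₂ := s₁.setN 41 u
    have c₂ : Ctx G m δ s₂ := c₁.setN (by decide) _
    have t₂ : Tup m t c s₂ := t₁.setN _ _
    rw [(hx s₂ c₂ t₂ h.index).2]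
    exact ⟨by simp [RExp.eval, s₂, hs₁], u, v, by simp [s₂], by simp, hv⟩

end Route

/-- The index of the next point. -/
def next : NExp := .add (.var 40) (.const 1)

/-- The route via vertices from point number `40` to the next one. -/
def routeVia : Stmt :=
  seq (setR 4 (.add (ta (.var 40)) (viaU next (tu (.var 40)))))
    (seq (setN 41 (tu (.var 40))) (seq (setN 42 (tu next))
      (seq (better (.add (ta (.var 40)) (viaV next (tu (.var 40)))) (tu (.var 40)) (tv next))
        (seq (better (.add (.sub (.const 1) (ta (.var 40))) (viaU next (tv (.var 40))))
            (tv (.var 40)) (tu next))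
          (better (.add (.sub (.const 1) (ta (.var 40))) (viaV next (tv (.var 40))))
            (tv (.var 40)) (tv next))))))

/-- The distance via vertices is a minimum of four candidates, one for each choice of ends. The ends
that attain it are kept as well, because the output must reproduce the walk and not only its length.
-/
theorem run_routeVia {G : SimpleGraph (Fin n)} {m : ℕ} {δ : ℝ} {t : ℕ → Tri n} {c i : ℕ} {s : State}
    (h : Ctx G m δ s) (ht : Tup m t c s) (hi : s.natReg 40 = i) (hic : i + 1 < c) :
    RouteInv G m δ t c i (rd G (t i) (t (i + 1))) (routeVia.run s) := by
  have hic' : i < c := by omega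
  have ev : ∀ s', Ctx G m δ s' → Tup m t c s' → s'.natReg 40 = i →
      ((tu (.var 40)).eval s' = (t i).u ∧ (tv (.var 40)).eval s' = (t i).v) ∧
      ((tu next).eval s' = (t (i + 1)).u ∧ (tv next).eval s' = (t (i + 1)).v) ∧
      (ta (.var 40)).eval s' = (t i).a ∧ next.eval s' = i + 1 := by
    intro s' h ht hi
    have hn : next.eval s' = i + 1 := by simp [next, NExp.eval, hi]
    exact ⟨⟨h.eval_tu ht (e := .var 40) hi hic', h.eval_tv ht (e := .var 40) hi hic'⟩,
      ⟨h.eval_tu ht hn hic, h.eval_tv ht hn hic⟩, h.eval_ta ht (e := .var 40) hi hic', hn⟩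
  have base : RouteInv G m δ t c i ((t i).a + ((t (i + 1)).a + G.dist (t (i + 1)).u (t i).u))
      (((s.setR 4 ((t i).a + ((t (i + 1)).a + G.dist (t (i + 1)).u (t i).u))).setN 41
        (t i).u).setN 42 (t (i + 1)).u) := by
    refine ⟨((h.setR (by decide) _).setN (by decide) _).setN (by decide) _, ht, by simp [hi],
      by simp, _, _, by simp, by simp, _, _, .inl ⟨rfl, rfl⟩, .inl ⟨rfl, rfl⟩, rfl⟩
  have hrd : rd G (t i) (t (i + 1)) =
      min (min (min ((t i).a + ((t (i + 1)).a + G.dist (t (i + 1)).u (t i).u))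
        ((t i).a + (1 - (t (i + 1)).a + G.dist (t (i + 1)).v (t i).u)))
        (1 - (t i).a + ((t (i + 1)).a + G.dist (t (i + 1)).u (t i).v)))
        (1 - (t i).a + (1 - (t (i + 1)).a + G.dist (t (i + 1)).v (t i).v)) := by
    simp only [rd, vd, ← min_add_add_left, min_assoc]
  obtain ⟨⟨e₁, e₂⟩, ⟨e₃, e₄⟩, e₅, e₆⟩ := ev s h ht hi
  have hs : routeVia.run s = (seq (better (.add (ta (.var 40)) (viaV next (tu (.var 40))))
        (tu (.var 40)) (tv next))
      (seq (better (.add (.sub (.const 1) (ta (.var 40))) (viaU next (tv (.var 40))))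
        (tv (.var 40)) (tu next))
      (better (.add (.sub (.const 1) (ta (.var 40))) (viaV next (tv (.var 40))))
        (tv (.var 40)) (tv next)))).run
      (((s.setR 4 ((t i).a + ((t (i + 1)).a + G.dist (t (i + 1)).u (t i).u))).setN 41
        (t i).u).setN 42 (t (i + 1)).u) := by
    rw [routeVia, run_seq, run_setR, run_seq, run_setN, run_seq, run_setN]
    rw [RExp.eval, e₅, h.eval_viaU ht e₆ hic e₁]
    set s₁ := s.setR 4 ((t i).a + ((t (i + 1)).a + G.dist (t (i + 1)).u (t i).u))
    have c₁ : Ctx G m δ s₁ := h.setR (by decide) _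
    have t₁ : Tup m t c s₁ := ht.setR _ _
    rw [(ev s₁ c₁ t₁ hi).1.1]
    set s₂ := s₁.setN 41 (t i).u
    have c₂ : Ctx G m δ s₂ := c₁.setN (by decide) _
    have t₂ : Tup m t c s₂ := t₁.setN _ _
    rw [(ev s₂ c₂ t₂ hi).2.1.1]
  rw [hs, run_seq, run_seq, hrd]
  have r₂ := base.better (e := .add (ta (.var 40)) (viaV next (tu (.var 40))))
    (x := tu (.var 40)) (y := tv next) (u := (t i).u) (v := (t (i + 1)).v)
    (l' := (t i).a + (1 - (t (i + 1)).a + G.dist (t (i + 1)).v (t i).u)) (by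
      obtain ⟨⟨e₁, e₂⟩, ⟨e₃, e₄⟩, e₅, e₆⟩ := ev _ base.ctx base.tup base.index
      rw [RExp.eval, e₅, base.ctx.eval_viaV base.tup e₆ hic e₁])
    (fun s' h ht hi => ⟨(ev s' h ht hi).1.1, (ev s' h ht hi).2.1.2⟩)
    ⟨_, _, .inl ⟨rfl, rfl⟩, .inr ⟨rfl, rfl⟩, rfl⟩
  have r₃ := r₂.better (e := .add (.sub (.const 1) (ta (.var 40))) (viaU next (tv (.var 40))))
    (x := tv (.var 40)) (y := tu next) (u := (t i).v) (v := (t (i + 1)).u)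
    (l' := 1 - (t i).a + ((t (i + 1)).a + G.dist (t (i + 1)).u (t i).v)) (by
      obtain ⟨⟨e₁, e₂⟩, ⟨e₃, e₄⟩, e₅, e₆⟩ := ev _ r₂.ctx r₂.tup r₂.index
      simp only [RExp.eval, e₅, r₂.ctx.eval_viaU r₂.tup e₆ hic e₂, Rat.cast_one])
    (fun s' h ht hi => ⟨(ev s' h ht hi).1.2, (ev s' h ht hi).2.1.1⟩)
    ⟨_, _, .inr ⟨rfl, rfl⟩, .inl ⟨rfl, rfl⟩, rfl⟩
  exact r₃.better (e := .add (.sub (.const 1) (ta (.var 40))) (viaV next (tv (.var 40))))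
    (x := tv (.var 40)) (y := tv next) (u := (t i).v) (v := (t (i + 1)).v)
    (l' := 1 - (t i).a + (1 - (t (i + 1)).a + G.dist (t (i + 1)).v (t i).v)) (by
      obtain ⟨⟨e₁, e₂⟩, ⟨e₃, e₄⟩, e₅, e₆⟩ := ev _ r₃.ctx r₃.tup r₃.index
      simp only [RExp.eval, e₅, r₃.ctx.eval_viaV r₃.tup e₆ hic e₂, Rat.cast_one])
    (fun s' h ht hi => ⟨(ev s' h ht hi).1.2, (ev s' h ht hi).2.1.2⟩)
    ⟨_, _, .inr ⟨rfl, rfl⟩, .inr ⟨rfl, rfl⟩, rfl⟩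

/-- Compare with the route inside the edge. -/
def direct : Stmt :=
  seq (ite (.leR (ta (.var 40)) (ta next)) (setR 5 (.sub (ta next) (ta (.var 40))))
      (setR 5 (.sub (ta (.var 40)) (ta next))))
    (ite (.leR (.var 4) (.var 5)) skip (seq (setN 43 (.const 1)) (setR 4 (.var 5))))

/-- A shortest route from point number `40` to the next one; register `43` tells whether it stays
inside an edge. -/
def route : Stmt :=
  seq routeVia (seq (setN 43 (.const 0))
    (ite (.and (.eqN (tu (.var 40)) (tu next)) (.eqN (tv (.var 40)) (tv next))) direct skip))

theorem run_route {G : SimpleGraph (Fin n)} {m : ℕ} {δ : ℝ} {t : ℕ → Tri n} {c i : ℕ} {s : State}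
    (h : Ctx G m δ s) (ht : Tup m t c s) (hi : s.natReg 40 = i) (hic : i + 1 < c) :
    (route.run s).realReg 4 = td G (t i) (t (i + 1)) ∧
    (((route.run s).natReg 43 = 0 ∧ ∃ x y : Fin n, (route.run s).natReg 41 = x ∧
        (route.run s).natReg 42 = y ∧ Via G (t i) (t (i + 1)) x y (td G (t i) (t (i + 1)))) ∨
      ((route.run s).natReg 43 = 1 ∧ (t i).u = (t (i + 1)).u ∧ (t i).v = (t (i + 1)).v ∧
        td G (t i) (t (i + 1)) = |(t (i + 1)).a - (t i).a|)) := by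
  obtain ⟨c₁, t₁, i₁, l₁, x, y, hx, hy, hv⟩ := run_routeVia h ht hi hic
  rw [route, run_seq, run_seq, run_setN]
  set s₁ := (routeVia.run s).setN 43 ((NExp.const 0).eval (routeVia.run s)) with hs₁
  have c₂ : Ctx G m δ s₁ := c₁.setN (by decide) _
  have t₂ : Tup m t c s₁ := t₁.setN _ _
  have hic' : i < c := by omega
  have hn : next.eval s₁ = i + 1 := by simp [next, NExp.eval, hs₁, i₁]
  have e40 : (NExp.var 40).eval s₁ = i := i₁
  have e₁ := c₂.eval_tu t₂ e40 hic'
  have e₂ := c₂.eval_tv t₂ e40 hic'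
  have e₃ := c₂.eval_tu t₂ hn hic
  have e₄ := c₂.eval_tv t₂ hn hic
  have e₅ := c₂.eval_ta t₂ e40 hic'
  have e₆ := c₂.eval_ta t₂ hn hic
  have hcond : BExp.Holds s₁ (.and (.eqN (tu (.var 40)) (tu next)) (.eqN (tv (.var 40)) (tv next))) ↔
      (t i).u = (t (i + 1)).u ∧ (t i).v = (t (i + 1)).v := by
    simp only [BExp.Holds, BExp.holds_eqN, e₁, e₂, e₃, e₄, Fin.ext_iff]
  have r4 : s₁.realReg 4 = rd G (t i) (t (i + 1)) := l₁
  by_cases hsame : (t i).u = (t (i + 1)).u ∧ (t i).v = (t (i + 1)).v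
  · rw [run_ite_true (hcond.2 hsame), direct, run_seq]
    have hd : (ite (.leR (ta (.var 40)) (ta next)) (setR 5 (.sub (ta next) (ta (.var 40))))
        (setR 5 (.sub (ta (.var 40)) (ta next)))).run s₁ =
        s₁.setR 5 |(t (i + 1)).a - (t i).a| := by
      by_cases hle : (t i).a ≤ (t (i + 1)).a
      · rw [run_ite_true (by simpa [BExp.Holds, e₅, e₆] using hle), run_setR, RExp.eval, e₅, e₆,
          abs_of_nonneg (by linarith)]
      · rw [run_ite_false (by simpa [BExp.Holds, e₅, e₆] using hle), run_setR, RExp.eval, e₅, e₆,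
          abs_of_nonpos (by linarith), neg_sub]
    rw [hd, td, if_pos hsame]
    have hc2 : BExp.Holds (s₁.setR 5 |(t (i + 1)).a - (t i).a|) (.leR (.var 4) (.var 5)) ↔
        rd G (t i) (t (i + 1)) ≤ |(t (i + 1)).a - (t i).a| := by
      simp [BExp.Holds, RExp.eval, r4]
    by_cases hle : rd G (t i) (t (i + 1)) ≤ |(t (i + 1)).a - (t i).a|
    · rw [run_ite_true (hc2.2 hle), run_skip, min_eq_left hle]
      exact ⟨r4, .inl ⟨by simp [hs₁, NExp.eval], x, y, hx, hy, hv⟩⟩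
    · rw [run_ite_false fun h => hle (hc2.1 h), min_eq_right (not_le.1 hle).le]
      refine ⟨by simp [run_seq, run_setN, run_setR, RExp.eval], .inr ⟨?_, hsame.1, hsame.2, rfl⟩⟩
      simp [run_seq, run_setN, run_setR, NExp.eval]
  · rw [run_ite_false fun h => hsame (hcond.1 h), run_skip, td, if_neg hsame]
    exact ⟨r4, .inl ⟨by simp [hs₁, NExp.eval], x, y, hx, hy, hv⟩⟩

/-- The length of the closed route along the tuple, in real register `11`. -/
def length : Stmt :=
  seq (setR 11 (.const 0)) (loop 40 3 (seq route (setR 11 (.add (.var 11) (.var 4)))))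

theorem run_length {G : SimpleGraph (Fin n)} {m : ℕ} {δ : ℝ} {t : ℕ → Tri n} {s : State}
    (h : Ctx G m δ s) (ht : Tup m t (m + 1) s) :
    (length.run s).realReg 11 = ∑ i ∈ Finset.range m, td G (t i) (t (i + 1)) := by
  rw [length, run_seq, run_setR]
  set s₁ := s.setR 11 ((RExp.const 0).eval s) with hs₁
  have c₁ : Ctx G m δ s₁ := h.setR (by decide) _
  have t₁ : Tup m t (m + 1) s₁ := ht.setR _ _
  have key : ((loop 40 3 (seq route (setR 11 (.add (.var 11) (.var 4))))).run s₁).realReg 11 =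
      ∑ i ∈ Finset.range (s₁.natReg 3), td G (t i) (t (i + 1)) := by
    refine run_loop_inv (fun j st => st.realReg 11 =
      ∑ i ∈ Finset.range j, td G (t i) (t (i + 1))) (by simp [hs₁, RExp.eval]) ?_
    intro j st hj hj' hf hi
    rw [c₁.reg_m] at hj
    have r := (run_route (c₁.frame hf (by decide)) (t₁.frame hf (by decide)) hj' (by omega)).1
    have f := (route.run_frame st).r 11 (by decide)
    simp [run_seq, run_setR, RExp.eval, r, f, hi, Finset.sum_range_succ]
  rw [key, c₁.reg_m]

/-- Test the tuple number `62`. -/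
def tryCode : Stmt :=
  seq (setN 20 (.var 62)) (seq decodeAll (seq coverCheck (seq length
    (ite (.and (.leN (.var 35) (.const 0))
        (.or (.leN (.var 60) (.const 0)) (.not (.leR (.var 10) (.var 11)))))
      (seq (setN 60 (.const 1)) (seq (setN 61 (.var 62)) (setR 10 (.var 11)))) skip))))

/-- Find the code of a shortest tuple that covers the graph. -/
def search : Stmt := seq (setN 60 (.const 0)) (loop 62 5 tryCode)

/-- The registers `60`, `61` and real register `10` describe a shortest tuple among the first `j`. -/
def Best (G : SimpleGraph (Fin n)) [NeZero n] (δ : ℝ) (m j : ℕ) (s : State) : Prop :=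
  (s.natReg 60 = 0 ∧ ∀ x < j, ¬ GoodCode G δ m x) ∨
    (s.natReg 60 = 1 ∧ s.natReg 61 < j ∧ GoodCode G δ m (s.natReg 61) ∧
      s.realReg 10 = codeLen G δ m (s.natReg 61) ∧
      ∀ x < j, GoodCode G δ m x → codeLen G δ m (s.natReg 61) ≤ codeLen G δ m x)

theorem run_tryCode {G : SimpleGraph (Fin n)} [NeZero n] (hG : G.Connected) {m : ℕ} (hm : 0 < m)
    {δ : ℝ} {s : State} (h : Ctx G m δ s) {j : ℕ} (hj : s.natReg 62 = j) (hjs : j < space n m)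
    (hb : Best G δ m j s) :
    Ctx G m δ (tryCode.run s) ∧ Best G δ m (j + 1) (tryCode.run s) := by
  rw [tryCode, run_seq, run_setN, run_seq, run_seq, run_seq, NExp.eval, hj]
  set s₁ := s.setN 20 j with hs₁
  have c₁ : Ctx G m δ s₁ := h.setN (by decide) _
  obtain ⟨c₂, t₂⟩ := run_decodeAll hG hm c₁ (x := j) (by simp [hs₁]) hjs
  have f₂ := decodeAll.run_frame s₁
  set s₂ := decodeAll.run s₁
  have hcov : (coverCheck.run s₂).natReg 35 = 0 ↔ GoodCode G δ m j := by
    rw [run_coverCheck hG c₂ t₂ (by omega)]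
    refine forall₅_congr fun a b _ _ y => forall_congr' fun _ => exists_congr fun i => ?_
    exact and_congr_right fun hi => by rw [cyc_of_lt G δ hi]
  have f₃ := coverCheck.run_frame s₂
  have c₃ := c₂.frame f₃ (by decide)
  have t₃ := t₂.frame f₃ (by decide)
  set s₃ := coverCheck.run s₂
  have hlen := run_length c₃ t₃
  rw [← codeLen_eq_sum_cyc] at hlen
  have f₄ := length.run_frame s₃
  have c₄ := c₃.frame f₄ (by decide)
  set s₄ := length.run s₃
  have g : ∀ r ∈ [60, 61, 62], s₄.natReg r = s.natReg r := by
    intro r hr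
    rw [f₄.n r (by revert r; decide), f₃.n r (by revert r; decide), f₂.n r (by revert r; decide)]
    simp only [hs₁, State.setN_natReg]
    rw [if_neg (by revert r; decide)]
  have g10 : s₄.realReg 10 = s.realReg 10 := by
    rw [f₄.r 10 (by decide), f₃.r 10 (by decide), f₂.r 10 (by decide)]
    rfl
  have g35 : s₄.natReg 35 = 0 ↔ GoodCode G δ m j := by
    rw [f₄.n 35 (by decide)]
    exact hcov
  have g60 := g 60 (by decide)
  have g61 := g 61 (by decide)
  have g62 := (g 62 (by decide)).trans hj
  have hcond : BExp.Holds s₄ (.and (.leN (.var 35) (.const 0))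
      (.or (.leN (.var 60) (.const 0)) (.not (.leR (.var 10) (.var 11))))) ↔
      GoodCode G δ m j ∧ (s.natReg 60 = 0 ∨ codeLen G δ m j < s.realReg 10) := by
    simp only [BExp.Holds, BExp.holds_or, NExp.eval, RExp.eval, Nat.le_zero, g35, g60, g10, hlen,
      not_le]
  by_cases hc : GoodCode G δ m j ∧ (s.natReg 60 = 0 ∨ codeLen G δ m j < s.realReg 10)
  · rw [run_ite_true (hcond.2 hc), run_seq, run_setN, run_seq, run_setN, run_setR]
    refine ⟨((c₄.setN (by decide) _).setN (by decide) _).setR (by decide) _, .inr ⟨?_, ?_, ?_, ?_, ?_⟩⟩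
    · simp [NExp.eval]
    · simp [NExp.eval, g62]
    · simpa [NExp.eval, g62] using hc.1
    · simp [NExp.eval, RExp.eval, g62, hlen]
    · simp only [State.setR_natReg, State.setN_natReg, if_true, NExp.eval, g62,
        show (62 : ℕ) ≠ 60 by decide, if_false]
      intro x hx hgx
      rcases Nat.lt_succ_iff_lt_or_eq.1 hx with hx | rfl
      · rcases hb with ⟨-, hb⟩ | ⟨h1, -, -, h2, hb⟩
        · exact absurd hgx (hb x hx)
        · have := hb x hx hgx
          have h3 : codeLen G δ m j < s.realReg 10 := hc.2.resolve_left (by omega)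
          linarith
      · exact le_rfl
  · rw [run_ite_false fun h => hc (hcond.1 h), run_skip]
    refine ⟨c₄, ?_⟩
    unfold Best
    rw [g60, g61, g10]
    rcases hb with ⟨h0, hb⟩ | ⟨h1, h2, h3, h4, hb⟩
    · refine .inl ⟨h0, fun x hx hgx => ?_⟩
      rcases Nat.lt_succ_iff_lt_or_eq.1 hx with hx | rfl
      exacts [hb x hx hgx, hc ⟨hgx, .inl h0⟩]
    · refine .inr ⟨h1, by omega, h3, h4, fun x hx hgx => ?_⟩
      rcases Nat.lt_succ_iff_lt_or_eq.1 hx with hx | rfl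
      · exact hb x hx hgx
      · by_contra! hlt
        exact hc ⟨hgx, .inr (h4 ▸ hlt)⟩

theorem run_search {G : SimpleGraph (Fin n)} [NeZero n] (hG : G.Connected) {m : ℕ} (hm : 0 < m)
    {δ : ℝ} {s : State} (h : Ctx G m δ s) {x₀ : ℕ} (hx₀ : x₀ < space n m)
    (hgood : GoodCode G δ m x₀) :
    Ctx G m δ (search.run s) ∧ (search.run s).natReg 61 < space n m ∧
      GoodCode G δ m ((search.run s).natReg 61) ∧ ∀ x < space n m, GoodCode G δ m x →
        codeLen G δ m ((search.run s).natReg 61) ≤ codeLen G δ m x := by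
  rw [search, run_seq, run_setN]
  set s₁ := s.setN 60 ((NExp.const 0).eval s) with hs₁
  have c₁ : Ctx G m δ s₁ := h.setN (by decide) _
  have key : Ctx G m δ ((loop 62 5 tryCode).run s₁) ∧
      Best G δ m (s₁.natReg 5) ((loop 62 5 tryCode).run s₁) := by
    refine run_loop_inv (fun j st => Ctx G m δ st ∧ Best G δ m j st)
      ⟨c₁.setN (by decide) _, .inl ⟨by simp [hs₁, NExp.eval], by simp⟩⟩ ?_
    rintro j st hj hj' - ⟨hc, hb⟩
    rw [c₁.reg_r] at hj
    obtain ⟨r1, r2⟩ := run_tryCode hG hm hc hj' hj hb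
    exact ⟨r1.setN (by decide) _, r2⟩
  rw [c₁.reg_r] at key
  obtain ⟨k1, ⟨-, hb⟩ | ⟨-, h2, h3, -, hb⟩⟩ := key
  -- A flag that is still `0` would mean that no code is good, but `x₀` is.
  · exact absurd hgood (hb x₀ hx₀)
  · exact ⟨k1, h2, h3, hb⟩

end Stmt

end DeltaTour

/-! ## Subprograms: the output of a tour -/

namespace DeltaTour

variable {n : ℕ}

theorem sameEdge_vertexPt {G : SimpleGraph (Fin n)} {x y : Fin n} (h : G.Adj x y) :
    SameEdge G (vertexPt x) (vertexPt y) ∧ dist (vertexPt x) (vertexPt y) = 1 := by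
  constructor
  · exact ⟨x, y, 0, 1, h, by simp, by simp, (edgePt_zero x y).symm, (edgePt_one x y).symm⟩
  · rw [← edgePt_zero x y, ← edgePt_one x y, dist_edgePt h.ne]
    simp

theorem Tri.Weak.end_of_edge {G : SimpleGraph (Fin n)} {X : Tri n} (h : X.Weak G) {x : Fin n}
    {c : ℝ} (hx : (x = X.u ∧ c = X.a) ∨ (x = X.v ∧ c = 1 - X.a)) :
    (X.pt = vertexPt x ∨ SameEdge G X.pt (vertexPt x)) ∧ dist X.pt (vertexPt x) ≤ c := by
  rcases id h with hw | hw
  · rcases hx with ⟨rfl, rfl⟩ | ⟨rfl, rfl⟩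
    · refine ⟨.inr ⟨X.u, X.v, X.a, 0, hw.1, hw.2.2, by simp, rfl, (edgePt_zero _ _).symm⟩, ?_⟩
      rw [Tri.pt, ← edgePt_zero X.u X.v, dist_edgePt hw.1.ne, abs_of_nonpos (by linarith [h.nonneg])]
      linarith
    · refine ⟨.inr ⟨X.u, X.v, X.a, 1, hw.1, hw.2.2, by simp, rfl, (edgePt_one _ _).symm⟩, ?_⟩
      rw [Tri.pt, ← edgePt_one X.u X.v, dist_edgePt hw.1.ne, abs_of_nonneg (by linarith [h.le_one])]
  · have hp : X.pt = vertexPt x := by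
      have : x = X.u := by
        rcases hx with ⟨h, -⟩ | ⟨h, -⟩
        exacts [h, h.trans hw.1.symm]
      rw [this, Tri.pt, ← hw.1, edgePt_self]
    refine ⟨.inl hp, ?_⟩
    rw [hp, dist_self]
    rcases hx with ⟨-, rfl⟩ | ⟨-, rfl⟩
    exacts [h.nonneg, by linarith [h.le_one]]

/-- The walk `T` from `p` to `X` has been output. -/
structure OutInv (G : SimpleGraph (Fin n)) (m : ℕ) (δ : ℝ) (t : ℕ → Tri n) (c : ℕ)
    (p : Fin n → ℝ) (X : Tri n) (T : List (Fin n → ℝ)) (s : State) : Prop where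
  ctx : Ctx G m δ s
  tup : Tup m t c s
  out : Outputs G s T
  walk : IsWalkFromTo G p X.pt T
  canon : X.Canon G
  u : s.natReg 56 = X.u
  v : s.natReg 57 = X.v
  a : s.realReg 7 = X.a

section

variable {G : SimpleGraph (Fin n)} {m : ℕ} {δ : ℝ} {t : ℕ → Tri n} {c : ℕ} {p : Fin n → ℝ}
  {X Y : Tri n} {T : List (Fin n → ℝ)} {s s' : State}

theorem Outputs.of_eq (h : Outputs G s T) (h0 : s'.natReg 0 = s.natReg 0)
    (hn : s'.natMem = s.natMem) (hr : s'.realMem = s.realMem) : Outputs G s' T := by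
  unfold Outputs
  rw [h0, hn, hr]
  exact h

theorem OutInv.frame {S : Stmt} (h : OutInv G m δ t c p X T s) (hf : S.Frame s s')
    (hk : S.keeps = true) (hw : ∀ r ∈ [0, 56, 57], r ∉ S.writesN) (hr : 7 ∉ S.writesR) :
    OutInv G m δ t c p X T s' := by
  have hk' := hk
  simp only [Stmt.keeps, Bool.and_eq_true] at hk'
  exact ⟨h.ctx.frame hf hk, h.tup.frame hf hk,
    h.out.of_eq (hf.n 0 (hw 0 (by simp))) (hf.mn hk'.1.1.1) (hf.mr hk'.1.1.2), h.walk, h.canon,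
    (hf.n 56 (hw 56 (by simp))).trans h.u, (hf.n 57 (hw 57 (by simp))).trans h.v,
    (hf.r 7 hr).trans h.a⟩

theorem OutInv.setN (h : OutInv G m δ t c p X T s) {i : ℕ} (hi : i ∉ [0, 1, 3, 4, 5, 56, 57])
    (v : ℕ) : OutInv G m δ t c p X T (s.setN i v) := by
  simp at hi
  exact ⟨h.ctx.setN (by simp; omega) v, h.tup.setN _ _,
    h.out.of_eq (by simp; omega) rfl rfl, h.walk, h.canon, by simp; rw [if_neg (by omega), h.u],
    by simp; rw [if_neg (by omega), h.v], h.a⟩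

theorem OutInv.setR (h : OutInv G m δ t c p X T s) {i : ℕ} (hi : i ∉ [0, 1, 7])
    (v : ℝ) : OutInv G m δ t c p X T (s.setR i v) := by
  simp at hi
  exact ⟨h.ctx.setR (by simp; omega) v, h.tup.setR _ _,
    h.out.of_eq rfl rfl rfl, h.walk, h.canon, h.u, h.v, by simp; rw [if_neg (by omega), h.a]⟩

end

namespace Stmt

/-- Output the point in registers `54`, `55` and real register `6`. -/
def put : Stmt :=
  seq (stN (.add (.var 0) (.var 0)) (.var 54))
    (seq (stN (.add (.add (.var 0) (.var 0)) (.const 1)) (.var 55))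
      (seq (stR (.var 0) (.var 6)) (seq (setN 0 (.add (.var 0) (.const 1)))
        (seq (setN 56 (.var 54)) (seq (setN 57 (.var 55)) (setR 7 (.var 6)))))))

/-- Output the point in registers `54`, `55` and real register `6` if it differs from the last. -/
def emit : Stmt :=
  ite (.and (.eqN (.var 56) (.var 54)) (.and (.eqN (.var 57) (.var 55))
    (.and (.leR (.var 6) (.var 7)) (.leR (.var 7) (.var 6))))) skip put

section

variable {G : SimpleGraph (Fin n)} {m : ℕ} {δ : ℝ} {t : ℕ → Tri n} {c : ℕ} {p : Fin n → ℝ}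
  {X Y : Tri n} {T : List (Fin n → ℝ)} {s : State}

/-- The output overwrites cells below `space n m`, where the adjacency matrix was. From here on only
the distance matrix is needed, and the bound on the length of `T` keeps the output away from
everything else. -/
theorem run_put (h : Ctx G m δ s) (ht : Tup m t c s) (ho : Outputs G s T) (hY : Y.Canon G)
    (hu : s.natReg 54 = Y.u) (hv : s.natReg 55 = Y.v) (ha : s.realReg 6 = Y.a)
    (hT : 2 * T.length + 2 ≤ space n m) (hw : IsWalkFromTo G p Y.pt (T ++ [Y.pt])) :
    OutInv G m δ t c p Y (T ++ [Y.pt]) (put.run s) := by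
  have h0 := ho.1
  set k := T.length with hk
  have e : put.run s = (((({ s with
      natMem := Function.update (Function.update s.natMem (k + k) Y.u) (k + k + 1) Y.v
      realMem := Function.update s.realMem k Y.a } : State).setN 0 (k + 1)).setN 56 Y.u).setN 57
      Y.v).setR 7 Y.a := by
    simp [put, run, NExp.eval, RExp.eval, h0, hu, hv, ha, State.setN, State.setR]
  rw [e]
  refine ⟨?_, ?_, ⟨by simp [hk], ?_⟩, hw, hY, by simp, by simp, by simp⟩
  · have hn : ∀ u : Fin n, k < space n m + u * base n m := fun u => by omega
    refine h.of_eq (by simp) (by simp) (fun u _ => ?_) fun u v => ?_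
    · simp only [State.setR_natMem, State.setN_natMem]
      rw [Function.update_of_ne (by omega), Function.update_of_ne (by omega)]
    · simp only [State.setR_realMem, State.setN_realMem]
      rw [Function.update_of_ne (by omega)]
  · intro i hi
    obtain ⟨h1, h2, h3⟩ := ht i hi
    simp only [State.setR_natMem, State.setN_natMem, State.setR_realMem, State.setN_realMem]
    rw [Function.update_of_ne (by omega), Function.update_of_ne (by omega),
      Function.update_of_ne (by omega), Function.update_of_ne (by omega),
      Function.update_of_ne (by omega)]
    exact ⟨h1, h2, h3⟩
  · intro i hi
    simp only [State.setR_natMem, State.setN_natMem, State.setR_realMem, State.setN_realMem]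
    rw [List.length_append, List.length_singleton] at hi
    rcases Nat.lt_succ_iff_lt_or_eq.1 hi with hi | hi
    · rw [Function.update_of_ne (by omega), Function.update_of_ne (by omega),
        Function.update_of_ne (by omega), Function.update_of_ne (by omega),
        Function.update_of_ne (by omega), List.getElem_append_left hi]
      exact ho.2 i hi
    · have hik : i = k := hi
      subst hik
      refine ⟨Y.u, Y.v, ?_, ?_, ?_, ?_, ?_⟩
      · rw [Function.update_of_ne (by omega), ← two_mul, Function.update_self]
      · rw [← two_mul, Function.update_self]
      · rcases hY with hY | hY
        exacts [.inl hY.1, .inr hY.1]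
      · rw [Function.update_self]
        exact ⟨hY.weak.nonneg, hY.weak.le_one⟩
      · rw [Function.update_self]
        simp [hk, Tri.pt]

/-- Consecutive points of a walk must be distinct, so a repeated point is suppressed. Both triples
are canonical, so comparing them compares the points. -/
theorem run_emit (h : OutInv G m δ t c p X T s) (hY : Y.Canon G)
    (hu : s.natReg 54 = Y.u) (hv : s.natReg 55 = Y.v) (ha : s.realReg 6 = Y.a)
    (hT : 2 * T.length + 2 ≤ space n m) (hXY : X.pt = Y.pt ∨ SameEdge G X.pt Y.pt) :
    ∃ T', OutInv G m δ t c p Y T' (emit.run s) ∧ T ⊆ T' ∧ len T' = len T + dist X.pt Y.pt ∧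
      T'.length ≤ T.length + 1 := by
  have hcond : BExp.Holds s (.and (.eqN (.var 56) (.var 54)) (.and (.eqN (.var 57) (.var 55))
      (.and (.leR (.var 6) (.var 7)) (.leR (.var 7) (.var 6))))) ↔
      X.u = Y.u ∧ X.v = Y.v ∧ X.a = Y.a := by
    simp only [BExp.Holds, BExp.holds_eqN, NExp.eval, RExp.eval, hu, hv, ha, h.u, h.v, h.a,
      Fin.ext_iff]
    exact and_congr Iff.rfl (and_congr Iff.rfl ⟨fun h => le_antisymm h.2 h.1,
      fun h => ⟨h.ge, h.le⟩⟩)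
  by_cases hc : X.u = Y.u ∧ X.v = Y.v ∧ X.a = Y.a
  · rw [emit, run_ite_true (hcond.2 hc), run_skip]
    have hXY : X = Y := by
      cases X
      cases Y
      simp_all
    subst hXY
    exact ⟨T, h, fun _ h => h, by simp, by omega⟩
  · rw [emit, run_ite_false fun h => hc (hcond.1 h)]
    have hne : X.pt ≠ Y.pt := fun he => hc (by
      rw [h.canon.eq_of_pt_eq hY he]
      exact ⟨rfl, rfl, rfl⟩)
    obtain ⟨w1, w2⟩ := h.walk.snoc hne (hXY.resolve_left hne)
    exact ⟨_, run_put h.ctx h.tup h.out hY hu hv ha hT w1, fun _ h => List.mem_append_left _ h, w2,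
      by simp⟩

/-- Output the vertex in register `50`. -/
def emitVertex : Stmt :=
  seq (setN 54 (.var 50)) (seq (setN 55 (.var 50)) (seq (setR 6 (.const 0)) emit))

/-- A vertex as a triple. -/
def vtri (x : Fin n) : Tri n := ⟨x, x, 0⟩

theorem vtri_canon (G : SimpleGraph (Fin n)) (x : Fin n) : (vtri x).Canon G := .inr ⟨rfl, rfl⟩

theorem vtri_pt (x : Fin n) : (vtri x).pt = vertexPt x := edgePt_self x 0

theorem run_emitVertex (h : OutInv G m δ t c p X T s) {x : Fin n} (hx : s.natReg 50 = x)
    (hT : 2 * T.length + 2 ≤ space n m)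
    (hX : X.pt = vertexPt x ∨ SameEdge G X.pt (vertexPt x)) :
    ∃ T', OutInv G m δ t c p (vtri x) T' (emitVertex.run s) ∧ T ⊆ T' ∧
      len T' = len T + dist X.pt (vertexPt x) ∧ T'.length ≤ T.length + 1 := by
  rw [emitVertex, run_seq, run_setN, run_seq, run_setN, run_seq, run_setR, ← vtri_pt x]
  exact run_emit (((h.setN (by decide) _).setN (by decide) _).setR (by decide) _)
    (vtri_canon G x) (by simp [NExp.eval, hx, vtri]) (by simp [NExp.eval, hx, vtri])
    (by simp [RExp.eval, vtri]) hT (by rwa [vtri_pt])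

/-- Find the next vertex of a shortest path. -/
def hopLoop : Stmt :=
  loop 53 1 (ite (.and (.leR (dst (.var 50) (.var 53)) (.const 1))
    (.leR (.add (dst (.var 53) (.var 42)) (.const 1)) (dst (.var 50) (.var 42))))
    (setN 51 (.var 53)) skip)

/-- Go to the next vertex of a shortest path, unless the end has been reached. -/
def hop : Stmt := seq (setN 51 (.var 50)) (seq hopLoop (seq (setN 50 (.var 51)) emitVertex))

/-- Any neighbour that is closer to `y` continues a shortest path. There is one unless `x = y`, in
which case register `51` keeps its initial value `x`. -/
theorem run_hopLoop (hG : G.Connected) (h : Ctx G m δ s) {x y : Fin n} (hx : s.natReg 50 = x)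
    (hx' : s.natReg 51 = x) (hy : s.natReg 42 = y) :
    ∃ z : Fin n, (hopLoop.run s).natReg 51 = z ∧
      ((z = x ∧ x = y) ∨ (G.Adj x z ∧ G.dist z y + 1 = G.dist x y)) := by
  have key : (∃ z : Fin n, (hopLoop.run s).natReg 51 = z ∧ G.Adj x z ∧
        G.dist z y + 1 ≤ G.dist x y) ∨ ((hopLoop.run s).natReg 51 = x ∧
          ∀ z : Fin n, (z : ℕ) < s.natReg 1 → ¬ (G.Adj x z ∧ G.dist z y + 1 ≤ G.dist x y)) := by
    refine run_loop_inv (fun j st => (∃ z : Fin n, st.natReg 51 = z ∧ G.Adj x z ∧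
        G.dist z y + 1 ≤ G.dist x y) ∨ (st.natReg 51 = x ∧
          ∀ z : Fin n, (z : ℕ) < j → ¬ (G.Adj x z ∧ G.dist z y + 1 ≤ G.dist x y)))
      (.inr ⟨by simpa using hx', by simp⟩) ?_
    intro j st hj hj' hf hi
    rw [h.reg_n] at hj
    have c := h.frame hf (by decide)
    have ex : (NExp.var 50).eval st = x := (hf.n 50 (by decide)).trans hx
    have ey : (NExp.var 42).eval st = y := (hf.n 42 (by decide)).trans hy
    have ez : (NExp.var 53).eval st = ((⟨j, hj⟩ : Fin n) : ℕ) := hj'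
    have hcond : BExp.Holds st (.and (.leR (dst (.var 50) (.var 53)) (.const 1))
        (.leR (.add (dst (.var 53) (.var 42)) (.const 1)) (dst (.var 50) (.var 42)))) ↔
        G.Adj x ⟨j, hj⟩ ∧ G.dist ⟨j, hj⟩ y + 1 ≤ G.dist x y := by
      simp only [BExp.Holds, RExp.eval, c.eval_dst ex ez, c.eval_dst ez ey, c.eval_dst ex ey,
        Rat.cast_one]
      rw [← SimpleGraph.dist_eq_one_iff_adj]
      norm_cast
      refine and_congr_left fun hle => ⟨fun h1 => ?_, fun h1 => h1.le⟩
      have : x ≠ ⟨j, hj⟩ := by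
        intro he
        rw [← he] at hle
        omega
      have := hG.pos_dist_of_ne this
      omega
    by_cases hz : G.Adj x ⟨j, hj⟩ ∧ G.dist ⟨j, hj⟩ y + 1 ≤ G.dist x y
    · rw [run_ite_true (hcond.2 hz)]
      exact .inl ⟨⟨j, hj⟩, by simp [run_setN, NExp.eval, hj'], hz⟩
    · rw [run_ite_false fun h => hz (hcond.1 h), run_skip]
      refine hi.imp (fun ⟨z, h1, h2⟩ => ⟨z, by simpa using h1, h2⟩) fun ⟨h1, h2⟩ =>
        ⟨by simpa using h1, fun z hzj => ?_⟩
      rcases Nat.lt_succ_iff_lt_or_eq.1 hzj with hzj | hzj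
      · exact h2 z hzj
      · rwa [show z = ⟨j, hj⟩ from Fin.ext hzj]
  rcases key with ⟨z, h1, h2, h3⟩ | ⟨h1, h2⟩
  · refine ⟨z, h1, .inr ⟨h2, le_antisymm h3 ?_⟩⟩
    have := hG.dist_triangle (u := x) (v := z) (w := y)
    rw [SimpleGraph.dist_eq_one_iff_adj.2 h2] at this
    omega
  · refine ⟨x, h1, .inl ⟨rfl, ?_⟩⟩
    by_contra hne
    have hpos := hG.pos_dist_of_ne hne
    obtain ⟨z, hz1, hz2⟩ := exists_vertex_between hG (u := x) (v := y) (i := 1) hpos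
    refine h2 z (by rw [h.reg_n]; exact z.2) ⟨SimpleGraph.dist_eq_one_iff_adj.1 hz1, by omega⟩

theorem run_hop (hG : G.Connected) {x y : Fin n} (h : OutInv G m δ t c p (vtri x) T s)
    (hx : s.natReg 50 = x) (hy : s.natReg 42 = y) (hT : 2 * T.length + 2 ≤ space n m) :
    ∃ (T' : List (Fin n → ℝ)) (z : Fin n), OutInv G m δ t c p (vtri z) T' (hop.run s) ∧
      (hop.run s).natReg 50 = z ∧ T ⊆ T' ∧ len T' + G.dist z y = len T + G.dist x y ∧
      T'.length ≤ T.length + 1 ∧ (z = y ∨ G.dist z y + 1 = G.dist x y) := by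
  rw [hop, run_seq, run_setN, run_seq, run_seq, run_setN]
  set s₁ := s.setN 51 ((NExp.var 50).eval s) with hs₁
  have o₁ : OutInv G m δ t c p (vtri x) T s₁ := h.setN (by decide) _
  obtain ⟨z, hz, hzz⟩ := run_hopLoop hG o₁.ctx (x := x) (y := y) hx (by simp [hs₁, NExp.eval, hx])
    hy
  have o₂ := o₁.frame (hopLoop.run_frame s₁) (by decide) (by decide) (by decide)
  set s₂ := hopLoop.run s₁
  have o₃ : OutInv G m δ t c p (vtri x) T (s₂.setN 50 ((NExp.var 51).eval s₂)) :=
    o₂.setN (by decide) _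
  set s₃ := s₂.setN 50 ((NExp.var 51).eval s₂) with hs₃
  have hz₃ : s₃.natReg 50 = z := by simp [hs₃, NExp.eval, hz]
  have hz₄ : (emitVertex.run s₃).natReg 50 = z :=
    ((emitVertex.run_frame s₃).n 50 (by decide)).trans hz₃
  rcases hzz with ⟨rfl, rfl⟩ | ⟨hadj, hd⟩
  · obtain ⟨T', o, h1, h2, h3⟩ := run_emitVertex o₃ hz₃ hT (.inl (vtri_pt _))
    refine ⟨T', z, o, hz₄, h1, ?_, h3, .inl rfl⟩
    rw [h2, vtri_pt, dist_self, add_zero]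
  · obtain ⟨e1, e2⟩ := sameEdge_vertexPt hadj
    obtain ⟨T', o, h1, h2, h3⟩ := run_emitVertex o₃ hz₃ hT (.inr (by rwa [vtri_pt]))
    refine ⟨T', z, o, hz₄, h1, ?_, h3, .inr hd⟩
    rw [h2, vtri_pt, e2, ← hd]
    push_cast
    ring

/-- Output a shortest path between the vertices in registers `41` and `42`. -/
def walkVia : Stmt := seq (setN 50 (.var 41)) (seq emitVertex (loop 52 1 hop))

theorem dist_lt_card (hG : G.Connected) (x y : Fin n) : G.dist x y < n := by
  obtain ⟨w, hw, hl⟩ := hG.exists_path_of_dist x y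
  have := hw.length_lt
  rwa [hl, Fintype.card_fin] at this

/-- Each hop extends the walk by as much as the remaining distance drops, so their sum is invariant.
The `n` rounds exceed the distance; once `y` is reached, further rounds output `y` again, which is
suppressed. -/
theorem run_walkVia (hG : G.Connected) (h : OutInv G m δ t c p X T s) {x y : Fin n}
    (hx : s.natReg 41 = x) (hy : s.natReg 42 = y) (hT : 2 * (T.length + n + 1) + 2 ≤ space n m)
    (hX : X.pt = vertexPt x ∨ SameEdge G X.pt (vertexPt x)) :
    ∃ T', OutInv G m δ t c p (vtri y) T' (walkVia.run s) ∧ T ⊆ T' ∧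
      len T' = len T + dist X.pt (vertexPt x) + G.dist x y ∧ T'.length ≤ T.length + n + 1 := by
  rw [walkVia, run_seq, run_setN, run_seq]
  set s₁ := s.setN 50 ((NExp.var 41).eval s) with hs₁
  have o₁ : OutInv G m δ t c p X T s₁ := h.setN (by decide) _
  have hx₁ : s₁.natReg 50 = x := by simp [hs₁, NExp.eval, hx]
  obtain ⟨T₂, o₂, i₂, l₂, k₂⟩ := run_emitVertex o₁ hx₁ (by omega) hX
  have f₂ := emitVertex.run_frame s₁
  set s₂ := emitVertex.run s₁
  have hx₂ : s₂.natReg 50 = x := (f₂.n 50 (by decide)).trans hx₁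
  have hy₂ : s₂.natReg 42 = y := (f₂.n 42 (by decide)).trans hy
  have key : ∃ (T' : List (Fin n → ℝ)) (z : Fin n),
      OutInv G m δ t c p (vtri z) T' ((loop 52 1 hop).run s₂) ∧
      ((loop 52 1 hop).run s₂).natReg 50 = z ∧ T ⊆ T' ∧
      len T' + G.dist z y = len T₂ + G.dist x y ∧ T'.length ≤ T.length + 1 + s₂.natReg 1 ∧
      (z = y ∨ G.dist z y + s₂.natReg 1 = G.dist x y) := by
    refine run_loop_inv (fun j st => ∃ (T' : List (Fin n → ℝ)) (z : Fin n),
      OutInv G m δ t c p (vtri z) T' st ∧ st.natReg 50 = z ∧ T ⊆ T' ∧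
      len T' + G.dist z y = len T₂ + G.dist x y ∧ T'.length ≤ T.length + 1 + j ∧
      (z = y ∨ G.dist z y + j = G.dist x y))
      ⟨T₂, x, o₂.setN (by decide) _, by simpa using hx₂, i₂, rfl, by omega, .inr rfl⟩ ?_
    rintro j st hj hj' hf ⟨T', z, o, r1, r2, r3, r4, r5⟩
    rw [o₂.ctx.reg_n] at hj
    obtain ⟨T'', z', o', q1, q2, q3, q4, q5⟩ := run_hop hG o r1 ((hf.n 42 (by decide)).trans hy₂)
      (by omega)
    refine ⟨T'', z', o'.setN (by decide) _, by simpa using q1, fun _ h => q2 (r2 h), by linarith,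
      by omega, ?_⟩
    rcases q5 with q5 | q5
    · exact .inl q5
    · rcases r5 with rfl | r5
      · rw [SimpleGraph.dist_self] at q5
        omega
      · exact .inr (by omega)
  rw [o₂.ctx.reg_n] at key
  obtain ⟨T', z, o, -, r2, r3, r4, r5⟩ := key
  -- Otherwise the distance would have dropped in all `n` rounds, but it is less than `n` at the
  -- start.
  have hzy : z = y := by
    have := dist_lt_card hG x y
    rcases r5 with r5 | r5
    · exact r5
    · omega
  subst hzy
  rw [SimpleGraph.dist_self] at r3
  push_cast at r3
  exact ⟨T', o, r2, by linarith, by omega⟩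

/-- Output the next point of the tuple. -/
def emitNext : Stmt :=
  seq (setN 54 (tu next)) (seq (setN 55 (tv next)) (seq (setR 6 (ta next)) emit))

theorem run_emitNext (h : OutInv G m δ t c p X T s) {i : ℕ} (hi : s.natReg 40 = i) (hic : i + 1 < c)
    (hY : (t (i + 1)).Canon G) (hT : 2 * T.length + 2 ≤ space n m)
    (hX : X.pt = (t (i + 1)).pt ∨ SameEdge G X.pt (t (i + 1)).pt) :
    ∃ T', OutInv G m δ t c p (t (i + 1)) T' (emitNext.run s) ∧ T ⊆ T' ∧
      len T' = len T + dist X.pt (t (i + 1)).pt ∧ T'.length ≤ T.length + 1 := by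
  have en : ∀ s' : State, s'.natReg 40 = i → next.eval s' = i + 1 := fun s' h => by
    simp [next, NExp.eval, h]
  rw [emitNext, run_seq, run_setN, run_seq, run_setN, run_seq, run_setR]
  rw [h.ctx.eval_tu h.tup (en s hi) hic]
  have o₁ : OutInv G m δ t c p X T (s.setN 54 (t (i + 1)).u) := h.setN (by decide) _
  rw [o₁.ctx.eval_tv o₁.tup (en _ (by simpa using hi)) hic]
  have o₂ := o₁.setN (i := 55) (by decide) (t (i + 1)).v
  rw [o₂.ctx.eval_ta o₂.tup (en _ (by simpa using hi)) hic]
  exact run_emit (o₂.setR (by decide) _) hY (by simp) (by simp) (by simp) hT hX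

/-- Output a shortest walk from point number `40` of the tuple to the next one. -/
def connect : Stmt := seq route (seq (ite (.leN (.var 43) (.const 0)) walkVia skip) emitNext)

/-- The route passes at most `n + 1` output vertices and the next point, whence `n + 2`. The length
is only bounded from above; equality is not needed for the output to be shortest. -/
theorem run_connect (hG : G.Connected) {i : ℕ} (h : OutInv G m δ t c p (t i) T s)
    (hi : s.natReg 40 = i) (hic : i + 1 < c) (hY : (t (i + 1)).Canon G)
    (hT : 2 * (T.length + n + 2) + 2 ≤ space n m) :
    ∃ T', OutInv G m δ t c p (t (i + 1)) T' (connect.run s) ∧ T ⊆ T' ∧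
      len T' ≤ len T + td G (t i) (t (i + 1)) ∧ T'.length ≤ T.length + n + 2 := by
  obtain ⟨-, hr⟩ := run_route h.ctx h.tup hi hic
  rw [connect, run_seq, run_seq]
  have f₁ := route.run_frame s
  have o₁ := h.frame f₁ (by decide) (by decide) (by decide)
  have hi₁ := (f₁.n 40 (by decide)).trans hi
  set s₁ := route.run s
  rcases hr with ⟨h0, x, y, hx, hy, cx, cy, hcx, hcy, he⟩ | ⟨h1, h2, h3, h4⟩
  · rw [run_ite_true (by simp [BExp.Holds, NExp.eval, h0])]
    obtain ⟨a1, a2⟩ := h.canon.weak.end_of_edge hcx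
    obtain ⟨b1, b2⟩ := hY.weak.end_of_edge hcy
    obtain ⟨T₂, o₂, i₂, l₂, k₂⟩ := run_walkVia hG o₁ hx hy (by omega) a1
    have hi₂ := ((walkVia.run_frame s₁).n 40 (by decide)).trans hi₁
    set s₂ := walkVia.run s₁
    obtain ⟨T₃, o₃, i₃, l₃, k₃⟩ := run_emitNext o₂ hi₂ hic hY (by omega) (by
      rw [vtri_pt]
      exact b1.imp Eq.symm SameEdge.symm)
    refine ⟨T₃, o₃, fun _ h => i₃ (i₂ h), ?_, by omega⟩
    rw [l₃, l₂, he, vtri_pt, dist_comm (vertexPt y), G.dist_comm]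
    linarith
  · rw [run_ite_false (by simp [BExp.Holds, NExp.eval, h1]), run_skip]
    obtain ⟨d1, d2⟩ := dist_pt_of_same h.canon.weak hY.weak ⟨h2, h3⟩
    obtain ⟨T₃, o₃, i₃, l₃, k₃⟩ := run_emitNext o₁ hi₁ hic hY (by omega) d2
    exact ⟨T₃, o₃, i₃, by rw [l₃, d1, h4], by omega⟩

/-- Output a shortest closed walk along the tuple. -/
def output : Stmt :=
  seq (setN 0 (.const 0)) (seq (setN 54 (tu (.const 0))) (seq (setN 55 (tv (.const 0)))
    (seq (setR 6 (ta (.const 0))) (seq put (loop 40 3 connect)))))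

theorem run_output (hG : G.Connected) (h : Ctx G m δ s) (ht : Tup m t (m + 1) s)
    (hc : ∀ i, (t i).Canon G) (hs : 2 * (m * (n + 2) + 1) + 2 ≤ space n m) :
    ∃ T, Outputs G (output.run s) T ∧ IsWalkFromTo G (t 0).pt (t m).pt T ∧
      (∀ i ≤ m, (t i).pt ∈ T) ∧ len T ≤ ∑ i ∈ Finset.range m, td G (t i) (t (i + 1)) := by
  rw [output, run_seq, run_setN, run_seq, run_setN, run_seq, run_setN, run_seq, run_setR, run_seq]
  have e0 : ∀ s', (NExp.const 0).eval s' = 0 := fun _ => rfl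
  have c₁ : Ctx G m δ (s.setN 0 0) := Ctx.setN h (by decide) _
  have t₁ : Tup m t (m + 1) (s.setN 0 0) := ht.setN _ _
  rw [e0, c₁.eval_tu t₁ (e0 _) (by omega)]
  have c₂ := c₁.setN (i := 54) (by decide) (t 0).u
  have t₂ := t₁.setN 54 (t 0).u
  rw [c₂.eval_tv t₂ (e0 _) (by omega)]
  have c₃ := c₂.setN (i := 55) (by decide) (t 0).v
  have t₃ := t₂.setN 55 (t 0).v
  rw [c₃.eval_ta t₃ (e0 _) (by omega)]
  have c₄ := c₃.setR (i := 6) (by decide) (t 0).a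
  have t₄ := t₃.setR 6 (t 0).a
  have o₅ := run_put (T := []) (p := (t 0).pt) (Y := t 0) c₄ t₄ ⟨by simp, by simp⟩ (hc 0)
    (by simp) (by simp) (by simp) (by simp; omega)
    (IsWalkFromTo.singleton (hc 0).weak.pt_mem)
  set s₅ := put.run _
  have key : ∃ T, OutInv G m δ t (m + 1) (t 0).pt (t (s₅.natReg 3)) T
      ((loop 40 3 connect).run s₅) ∧ (∀ i ≤ s₅.natReg 3, (t i).pt ∈ T) ∧
      len T ≤ ∑ i ∈ Finset.range (s₅.natReg 3), td G (t i) (t (i + 1)) ∧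
      T.length ≤ s₅.natReg 3 * (n + 2) + 1 := by
    refine run_loop_inv (fun j st => ∃ T, OutInv G m δ t (m + 1) (t 0).pt (t j) T st ∧
      (∀ i ≤ j, (t i).pt ∈ T) ∧ len T ≤ ∑ i ∈ Finset.range j, td G (t i) (t (i + 1)) ∧
      T.length ≤ j * (n + 2) + 1)
      ⟨_, o₅.setN (by decide) _, by simp, by simp [len], by simp⟩ ?_
    rintro j st hj hj' hf ⟨T, o, r1, r2, r3⟩
    rw [o₅.ctx.reg_m] at hj
    have hjm : j * (n + 2) + (n + 2) ≤ m * (n + 2) := by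
      rw [← Nat.succ_mul]
      exact Nat.mul_le_mul_right _ hj
    obtain ⟨T', o', q1, q2, q3⟩ := run_connect hG o hj' (by omega) (hc _) (by omega)
    refine ⟨T', o'.setN (by decide) _, fun i hi => ?_, ?_, by rw [add_mul]; omega⟩
    · rcases Nat.le_succ_iff.1 hi with hi | rfl
      · exact q1 (r1 i hi)
      · exact List.mem_of_getLast? o'.walk.2.2
    · rw [Finset.sum_range_succ]
      linarith
  rw [o₅.ctx.reg_m] at key
  obtain ⟨T, o, r1, r2, -⟩ := key
  exact ⟨T, o.out, o.walk, r1, r2⟩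

end

end Stmt

end DeltaTour

/-! ## Subprograms: the parameters and the distance matrix -/

namespace DeltaTour

variable {n : ℕ}

/-- The integer memory holds the adjacency matrix, and real registers `0` and `9` hold `δ` and `n`. -/
structure Input (G : SimpleGraph (Fin n)) (δ : ℝ) (s : State) : Prop where
  adj : ∀ u v : Fin n, s.natMem (u * n + v) = 1 ↔ G.Adj u v
  d : s.realReg 0 = δ
  n : s.realReg 9 = n

section

variable {G : SimpleGraph (Fin n)} {m : ℕ} {δ : ℝ} {s s' : State}

theorem Input.frame {S : Stmt} (h : Input G δ s) (hf : S.Frame s s') (hp : S.pureN = true)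
    (h0 : 0 ∉ S.writesR) (h9 : 9 ∉ S.writesR) : Input G δ s' :=
  ⟨fun u v => by rw [hf.mn hp]; exact h.adj u v, (hf.r 0 h0).trans h.d, (hf.r 9 h9).trans h.n⟩

theorem Params.frame {S : Stmt} (h : Params n m δ s) (hf : S.Frame s s')
    (hn : ∀ r ∈ [1, 3, 4, 5], r ∉ S.writesN) (hr : ∀ r ∈ [0, 1], r ∉ S.writesR) :
    Params n m δ s' :=
  ⟨(hf.n 1 (hn 1 (by simp))).trans h.reg_n, (hf.n 3 (hn 3 (by simp))).trans h.reg_m,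
    (hf.n 4 (hn 4 (by simp))).trans h.reg_q, (hf.n 5 (hn 5 (by simp))).trans h.reg_r,
    (hf.r 0 (hr 0 (by simp))).trans h.reg_d, (hf.r 1 (hr 1 (by simp))).trans h.reg_off⟩

theorem Rows.frame {S : Stmt} (h : Rows n m δ s) (hf : S.Frame s s') (hp : S.pureN = true)
    (hn : ∀ r ∈ [1, 3, 4, 5], r ∉ S.writesN) (hr : ∀ r ∈ [0, 1], r ∉ S.writesR) :
    Rows n m δ s' := ⟨h.toParams.frame hf hn hr, fun u hu => by rw [hf.mn hp, h.row u hu]⟩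

theorem mul_add_inj {Q u v u' v' : ℕ} (hv : v < Q) (hv' : v' < Q) (h : u * Q + v = u' * Q + v') :
    u = u' ∧ v = v' := by
  have h1 := congrArg (· / Q) h
  have h2 := congrArg (· % Q) h
  rw [mul_comm, mul_comm u', Nat.mul_add_div (by omega), Nat.mul_add_div (by omega),
    Nat.div_eq_of_lt hv, Nat.div_eq_of_lt hv'] at h1
  rw [mul_comm, mul_comm u', Nat.mul_add_mod, Nat.mul_add_mod, Nat.mod_eq_of_lt hv,
    Nat.mod_eq_of_lt hv'] at h2
  exact ⟨by simpa using h1, h2⟩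

theorem input_inputState (G : SimpleGraph (Fin n)) (δ : ℝ) (u v : Fin n) :
    (inputState G δ).natMem (u * n + v) = 1 ↔ G.Adj u v := by
  simp only [inputState]
  split_ifs with h
  · obtain ⟨u', v', ha, he⟩ := h
    obtain ⟨h1, h2⟩ := mul_add_inj v.2 v'.2 he
    rw [Fin.ext h1, Fin.ext h2]
    simpa using ha
  · simp only [false_iff]
    exact fun ha => h ⟨u, v, ha, rfl⟩

end

/-! ### Computing the parameters. -/

namespace Stmt

/-- Copy `n` to register `1` and to real register `9`. -/
def copyInput : Stmt :=
  seq (setN 1 (.var 0)) (seq (setN 12 (.const 700)) (seq (setR 9 (.const 0))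
    (loop 6 0 (setR 9 (.add (.var 9) (.const 1))))))

/-- The machine has no conversion of integers to reals, so `n` is counted up as a real number. The
constant `700` is put into a register because it bounds a loop later. -/
theorem run_copyInput (G : SimpleGraph (Fin n)) (δ : ℝ) :
    Input G δ (copyInput.run (inputState G δ)) ∧
      (copyInput.run (inputState G δ)).natReg 1 = n ∧
      (copyInput.run (inputState G δ)).natReg 2 = 0 ∧
      (copyInput.run (inputState G δ)).natReg 12 = 700 ∧
      (copyInput.run (inputState G δ)).realReg 8 = 0 := by
  have f := copyInput.run_frame (inputState G δ)
  have hmn := f.mn (by decide)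
  have h0 := f.r 0 (by decide)
  have h8 := f.r 8 (by decide)
  have h2 := f.n 2 (by decide)
  rw [copyInput, run_seq, run_setN, run_seq, run_setN, run_seq, run_setR] at *
  set s₁ := (((inputState G δ).setN 1 ((NExp.var 0).eval (inputState G δ))).setN 12
    ((NExp.const 700).eval ((inputState G δ).setN 1 ((NExp.var 0).eval (inputState G δ))))).setR 9
    ((RExp.const 0).eval (((inputState G δ).setN 1 ((NExp.var 0).eval (inputState G δ))).setN 12
      ((NExp.const 700).eval ((inputState G δ).setN 1 ((NExp.var 0).eval (inputState G δ)))))) with hs₁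
  have key : ((loop 6 0 (setR 9 (.add (.var 9) (.const 1)))).run s₁).realReg 9 = s₁.natReg 0 := by
    refine run_loop_inv (fun j st => st.realReg 9 = j) (by simp [hs₁, RExp.eval]) ?_
    intro j st _ _ _ hi
    simp [run_setR, RExp.eval, hi]
  have f' := (loop 6 0 (setR 9 (.add (.var 9) (.const 1)))).run_frame s₁
  have e0 : s₁.natReg 0 = n := by simp [hs₁, inputState]
  have e1 : s₁.natReg 1 = n := by simp [hs₁, inputState, NExp.eval]
  have e12 : s₁.natReg 12 = 700 := by simp [hs₁, NExp.eval]
  rw [e0] at key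
  refine ⟨⟨fun u v => ?_, h0, key⟩, (f'.n 1 (by decide)).trans e1, h2,
    (f'.n 12 (by decide)).trans e12, h8⟩
  rw [hmn]
  exact input_inputState G δ u v

/-- Add `e` for each unit of register `r` to register `x`. -/
def addLoop (x r : ℕ) (e : NExp) : Stmt := loop 6 r (setN x (.add (.var x) e))

theorem run_addLoop {x r : ℕ} {e : NExp} {s : State} {b : ℕ} (hx : x ≠ 6)
    (he : ∀ s', (addLoop x r e).Frame s s' → e.eval s' = b) :
    ((addLoop x r e).run s).natReg x = s.natReg x + s.natReg r * b := by
  refine run_loop_inv (fun j st => st.natReg x = s.natReg x + j * b) (by simp [hx]) ?_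
  intro j st _ _ hf hi
  simp only [run_setN, NExp.eval, State.setN_natReg, hx, if_false, if_true, hi, he st hf]
  ring

/-- Eight times an expression. -/
def eight (e : NExp) : NExp :=
  .add (.add (.add e e) (.add e e)) (.add (.add e e) (.add e e))

theorem eval_eight (s : State) (e : NExp) : (eight e).eval s = 8 * e.eval s := by
  simp only [eight, NExp.eval]
  ring

/-- Compute the number of points of the tuples, in register `3`. -/
def countPoints : Stmt :=
  seq (setN 10 (.const 0)) (seq (addLoop 10 2 (.var 2))
    (seq (ite (.leN (.var 1) (eight (.var 2))) skip (setN 10 (.const 1)))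
      (seq (setN 11 (.const 0)) (seq (addLoop 11 2 (.var 10))
        (seq (setN 3 (.const 0)) (addLoop 3 12 (.var 11)))))))

theorem run_countPoints {s : State} {k : ℕ} (h1 : s.natReg 1 = n) (h2 : s.natReg 2 = k)
    (h12 : s.natReg 12 = 700) : (countPoints.run s).natReg 3 = fewPts n k := by
  rw [countPoints, run_seq, run_setN, run_seq, run_seq, run_seq, run_setN, run_seq, run_seq,
    run_setN]
  set s₁ := s.setN 10 ((NExp.const 0).eval s) with hs₁
  have r₂ := run_addLoop (x := 10) (r := 2) (e := .var 2) (s := s₁) (b := k) (by decide)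
    fun s' hf => (hf.n 2 (by decide)).trans (by simp [hs₁, h2])
  have f₂ := (addLoop 10 2 (.var 2)).run_frame s₁
  set s₂ := (addLoop 10 2 (.var 2)).run s₁
  have a₂ : s₂.natReg 10 = k * k := by rw [r₂]; simp [hs₁, h2, NExp.eval]
  have b₂ : s₂.natReg 1 = n := (f₂.n 1 (by decide)).trans (by simp [hs₁, h1])
  have c₂ : s₂.natReg 2 = k := (f₂.n 2 (by decide)).trans (by simp [hs₁, h2])
  have d₂ : s₂.natReg 12 = 700 := (f₂.n 12 (by decide)).trans (by simp [hs₁, h12])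
  set s₃ := (ite (.leN (.var 1) (eight (.var 2))) skip (setN 10 (.const 1))).run s₂ with hs₃
  have f₃ : (ite (.leN (.var 1) (eight (.var 2))) skip (setN 10 (.const 1))).Frame s₂ s₃ :=
    run_frame _ s₂
  have a₃ : s₃.natReg 10 = if n ≤ 8 * k then k * k else 1 := by
    rw [hs₃]
    split_ifs with h
    · rw [run_ite_true (by simpa [BExp.Holds, eval_eight, NExp.eval, b₂, c₂] using h), run_skip, a₂]
    · rw [run_ite_false (by simpa [BExp.Holds, eval_eight, NExp.eval, b₂, c₂] using h)]
      simp [run_setN, NExp.eval]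
  have c₃ : s₃.natReg 2 = k := (f₃.n 2 (by decide)).trans c₂
  have d₃ : s₃.natReg 12 = 700 := (f₃.n 12 (by decide)).trans d₂
  set s₄ := s₃.setN 11 ((NExp.const 0).eval s₃) with hs₄
  have r₅ := run_addLoop (x := 11) (r := 2) (e := .var 10) (s := s₄)
    (b := if n ≤ 8 * k then k * k else 1) (by decide)
    fun s' hf => (hf.n 10 (by decide)).trans (by simp [hs₄, a₃])
  have f₅ := (addLoop 11 2 (.var 10)).run_frame s₄
  set s₅ := (addLoop 11 2 (.var 10)).run s₄
  have a₅ : s₅.natReg 11 = k * if n ≤ 8 * k then k * k else 1 := by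
    rw [r₅]
    simp [hs₄, c₃, NExp.eval]
  have d₅ : s₅.natReg 12 = 700 := (f₅.n 12 (by decide)).trans (by simp [hs₄, d₃])
  set s₆ := s₅.setN 3 ((NExp.const 0).eval s₅) with hs₆
  rw [run_addLoop (x := 3) (r := 12) (e := .var 11) (s := s₆)
    (b := k * if n ≤ 8 * k then k * k else 1) (by decide)
    fun s' hf => (hf.n 11 (by decide)).trans (by simp [hs₆, a₅])]
  simp only [hs₆, State.setN_natReg, if_true, show (12 : ℕ) ≠ 3 by decide, if_false, d₅, NExp.eval,
    fewPts, zero_add, mul_assoc]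

/-- Compute the base of the encoding, in register `4`. -/
def computeBase : Stmt :=
  seq (setN 13 (.add (.var 1) (.const 1))) (seq (addLoop 13 3 (.add (.var 1) (.const 1)))
    (setN 4 (eight (.var 13))))

theorem run_computeBase {s : State} {m : ℕ} (h1 : s.natReg 1 = n) (h3 : s.natReg 3 = m) :
    (computeBase.run s).natReg 4 = base n m := by
  rw [computeBase, run_seq, run_setN, run_seq, run_setN]
  set s₁ := s.setN 13 ((NExp.add (.var 1) (.const 1)).eval s) with hs₁
  have r₂ := run_addLoop (x := 13) (r := 3) (e := .add (.var 1) (.const 1)) (s := s₁) (b := n + 1)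
    (by decide) fun s' hf => by
      simp only [NExp.eval, hf.n 1 (by decide)]
      simp [hs₁, h1]
  have a₁ : s₁.natReg 13 = n + 1 := by simp [hs₁, NExp.eval, h1]
  have b₁ : s₁.natReg 3 = m := by simp [hs₁, h3]
  rw [a₁, b₁] at r₂
  simp only [State.setN_natReg, if_true, eval_eight, NExp.eval, r₂, base]
  ring

/-- Multiply register `5` by register `4`. -/
def mulBase : Stmt :=
  seq (setN 14 (.const 0)) (seq (addLoop 14 4 (.var 5)) (setN 5 (.var 14)))

theorem run_mulBase (s : State) : (mulBase.run s).natReg 5 = s.natReg 4 * s.natReg 5 := by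
  rw [mulBase, run_seq, run_setN, run_seq, run_setN]
  simp only [State.setN_natReg, if_true, NExp.eval]
  rw [run_addLoop (b := s.natReg 5) (by decide) fun s' hf => ?_]
  · simp
  · simp only [NExp.eval, hf.n 5 (by decide)]
    simp

/-- Compute the size of the search space, in register `5`. -/
def computeSpace : Stmt :=
  seq (setN 5 (.const 1)) (loop 15 3 (seq mulBase (seq mulBase (seq mulBase mulBase))))

theorem run_computeSpace {s : State} {m : ℕ} (h3 : s.natReg 3 = m) (h4 : s.natReg 4 = base n m) :
    (computeSpace.run s).natReg 5 = space n m := by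
  rw [computeSpace, run_seq, run_setN]
  set s₁ := s.setN 5 ((NExp.const 1).eval s) with hs₁
  have key : ((loop 15 3 (seq mulBase (seq mulBase (seq mulBase mulBase)))).run s₁).natReg 5 =
      (base n m ^ 4) ^ s₁.natReg 3 := by
    refine run_loop_inv (fun j st => st.natReg 5 = (base n m ^ 4) ^ j)
      (by simp [hs₁, NExp.eval]) ?_
    intro j st _ _ hf hi
    have e4 : st.natReg 4 = base n m := (hf.n 4 (by decide)).trans (by simp [hs₁, h4])
    have f : ∀ st : State, (mulBase.run st).natReg 4 = st.natReg 4 := fun st =>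
      (mulBase.run_frame st).n 4 (by decide)
    simp only [run_seq, State.setN_natReg, show (5 : ℕ) ≠ 15 by decide, if_false, run_mulBase, f,
      e4, hi]
    ring
  have e3 : s₁.natReg 3 = m := by simp [hs₁, h3]
  rw [key, e3, space]

/-- Compute the offset of the positions. -/
def computeOffset : Stmt :=
  seq (setR 1 (.const 1)) (loop 6 3 (setR 1 (.add (.var 1)
    (.add (.add (.var 0) (.var 0)) (.add (.var 9) (.var 9))))))

theorem run_computeOffset {s : State} {m : ℕ} {δ : ℝ} (h3 : s.natReg 3 = m) (h0 : s.realReg 0 = δ)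
    (h9 : s.realReg 9 = n) : (computeOffset.run s).realReg 1 = offset n m δ := by
  rw [computeOffset, run_seq, run_setR]
  set s₁ := s.setR 1 ((RExp.const 1).eval s) with hs₁
  have key : ((loop 6 3 (setR 1 (.add (.var 1)
      (.add (.add (.var 0) (.var 0)) (.add (.var 9) (.var 9)))))).run s₁).realReg 1 =
      offset n (s₁.natReg 3) δ := by
    refine run_loop_inv (fun j st => st.realReg 1 = offset n j δ)
      (by simp [hs₁, RExp.eval, offset]) ?_
    intro j st _ _ hf hi
    have e0 : st.realReg 0 = δ := (hf.r 0 (by decide)).trans (by simp [hs₁, h0])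
    have e9 : st.realReg 9 = n := (hf.r 9 (by decide)).trans (by simp [hs₁, h9])
    simp only [run_setR, RExp.eval, State.setN_realReg, State.setR_realReg, if_true, hi, e0, e9,
      offset]
    push_cast
    ring
  rw [key]
  exact congrArg (offset n · δ) h3

/-- Store the row pointers. -/
def storeRows : Stmt :=
  seq (setN 7 (.var 5)) (loop 8 1 (seq (stN (.add (.add (.var 5) (.var 5)) (.var 8)) (.var 7))
    (setN 7 (.add (.var 7) (.var 4)))))

/-- The addresses of the matrix rows are stored once, so that an entry can be accessed without a
multiplication. They are written from `2 * space n m` on and spare the adjacency matrix, which lies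
below `space n m`. -/
theorem run_storeRows {G : SimpleGraph (Fin n)} {m : ℕ} (hm : 0 < m) {δ : ℝ} {s : State}
    (h : Params n m δ s) (hI : Input G δ s) :
    Rows n m δ (storeRows.run s) ∧ Input G δ (storeRows.run s) := by
  have f := storeRows.run_frame s
  have hp := h.frame f (by decide) (by decide)
  have hd := (f.r 0 (by decide)).trans hI.d
  have hn := (f.r 9 (by decide)).trans hI.n
  rw [storeRows, run_seq, run_setN] at *
  set s₁ := s.setN 7 ((NExp.var 5).eval s) with hs₁
  set L := loop 8 1 (seq (stN (.add (.add (.var 5) (.var 5)) (.var 8)) (.var 7))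
    (setN 7 (.add (.var 7) (.var 4)))) with hL
  have hs := base_sq_le n hm
  have hq : n ≤ base n m := by rw [base_eq]; omega
  have e1 : s₁.natReg 1 = n := by simp [hs₁, h.reg_n]
  have e4 : s₁.natReg 4 = base n m := by simp [hs₁, h.reg_q]
  have e5 : s₁.natReg 5 = space n m := by simp [hs₁, h.reg_r]
  have e7 : s₁.natReg 7 = space n m := by simp [hs₁, h.reg_r, NExp.eval]
  have key : (L.run s₁).natReg 7 = space n m + s₁.natReg 1 * base n m ∧
      (∀ u < s₁.natReg 1, (L.run s₁).natMem (space n m + space n m + u) =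
        space n m + u * base n m) ∧
      ∀ a < space n m, (L.run s₁).natMem a = s.natMem a := by
    refine run_loop_inv (fun j st => st.natReg 7 = space n m + j * base n m ∧
      (∀ u < j, st.natMem (space n m + space n m + u) = space n m + u * base n m) ∧
      ∀ a < space n m, st.natMem a = s.natMem a) ⟨by simp [e7], by simp, by simp [hs₁]⟩ ?_
    rintro j st hj hj' hf ⟨i1, i2, i3⟩
    have g4 := (hf.n 4 (by decide)).trans e4
    have g5 := (hf.n 5 (by decide)).trans e5
    have e : (seq (stN (.add (.add (.var 5) (.var 5)) (.var 8)) (.var 7))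
        (setN 7 (.add (.var 7) (.var 4)))).run st = ({ st with
        natMem := Function.update st.natMem (space n m + space n m + j)
          (space n m + j * base n m) } : State).setN 7 (space n m + j * base n m + base n m) := by
      simp only [run, NExp.eval, g5, hj', i1, g4]
    rw [e]
    refine ⟨by simp; ring, fun u hu => ?_, fun a ha => ?_⟩
    · simp only [State.setN_natMem]
      rcases Nat.lt_succ_iff_lt_or_eq.1 hu with hu | rfl
      · rw [Function.update_of_ne (by omega), i2 u hu]
      · rw [Function.update_self]
    · simp only [State.setN_natMem]
      rw [Function.update_of_ne (by omega), i3 a ha]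
  rw [e1] at key
  refine ⟨⟨hp, key.2.1⟩, ⟨fun u v => ?_, hd, hn⟩⟩
  rw [key.2.2]
  · exact hI.adj u v
  · have : ((u : ℕ) + 1) * n ≤ base n m * base n m :=
      Nat.mul_le_mul (u.2.trans_le hq) hq
    rw [add_mul] at this
    have := v.2
    omega

end Stmt

/-- The real memory holds the matrix `d`. -/
def Mat (n m : ℕ) (d : Fin n → Fin n → ℝ) (s : State) : Prop :=
  ∀ u v : Fin n, s.realMem (space n m + u * base n m + v) = d u v

theorem Mat.update {m : ℕ} {d : Fin n → Fin n → ℝ} {s : State} (h : Mat n m d s) (u v : Fin n)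
    (a : ℝ) : Mat n m (fun u' v' => if u' = u ∧ v' = v then a else d u' v')
      { s with realMem := Function.update s.realMem (space n m + u * base n m + v) a } := by
  intro u' v'
  have hq : n ≤ base n m := by rw [base_eq]; omega
  simp only
  split_ifs with he
  · rw [he.1, he.2, Function.update_self]
  · rw [Function.update_of_ne, h u' v']
    intro hc
    obtain ⟨h1, h2⟩ := mul_add_inj (Q := base n m) (v'.2.trans_le hq) (v.2.trans_le hq)
      (u := u') (u' := u) (by omega)
    exact he ⟨Fin.ext h1, Fin.ext h2⟩

/-- The matrix `d` is an upper bound on the distances, exact up to distance `r`, and the triples in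
`S` have been relaxed. -/
structure Relaxed (G : SimpleGraph (Fin n)) (r : ℕ) (S : Fin n → Fin n → Fin n → Prop)
    (d : Fin n → Fin n → ℝ) : Prop where
  le : ∀ u v, (G.dist u v : ℝ) ≤ d u v
  eq : ∀ u v, G.dist u v ≤ r → d u v = G.dist u v
  step : ∀ u v w, S u v w → G.dist u w ≤ r → G.Adj w v → d u v ≤ G.dist u w + 1

section

variable {G : SimpleGraph (Fin n)} {r : ℕ} {S S' : Fin n → Fin n → Fin n → Prop}
  {d : Fin n → Fin n → ℝ}

theorem Relaxed.mono (h : Relaxed G r S d) (hS : ∀ u v w, S' u v w → S u v w) :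
    Relaxed G r S' d := ⟨h.le, h.eq, fun u v w hs => h.step u v w (hS u v w hs)⟩

/-- Relaxing via `w` cannot fall below the true distance, by the triangle inequality. The condition
`1 ≤ r` makes the entry of an edge `wv` exact, so the relaxed entry is at most the distance to `w`
plus one. -/
theorem Relaxed.relax (hG : G.Connected) (hr : 1 ≤ r) (h : Relaxed G r S d) (u v w : Fin n)
    (hS : ∀ u' v' w', S' u' v' w' → S u' v' w' ∨ (u' = u ∧ v' = v ∧ w' = w)) :
    Relaxed G r S' fun u' v' => if u' = u ∧ v' = v then min (d u v) (d u w + d w v) else d u' v' := by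
  have hle : ∀ u' v', (if u' = u ∧ v' = v then min (d u v) (d u w + d w v) else d u' v') ≤
      d u' v' := by
    intro u' v'
    split_ifs with he
    · rw [he.1, he.2]
      exact min_le_left _ _
    · exact le_rfl
  have hge : ∀ u' v', (G.dist u' v' : ℝ) ≤
      if u' = u ∧ v' = v then min (d u v) (d u w + d w v) else d u' v' := by
    intro u' v'
    split_ifs with he
    · rw [he.1, he.2]
      refine le_min (h.le u v) ?_
      have := hG.dist_triangle (u := u) (v := w) (w := v)
      have : (G.dist u v : ℝ) ≤ G.dist u w + G.dist w v := by exact_mod_cast this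
      linarith [h.le u w, h.le w v]
    · exact h.le u' v'
  refine ⟨hge, fun u' v' hd => le_antisymm ((hle u' v').trans (h.eq u' v' hd).le) (hge u' v'), ?_⟩
  intro u' v' w' hs hd hadj
  rcases hS u' v' w' hs with hs | ⟨rfl, rfl, rfl⟩
  · exact (hle u' v').trans (h.step u' v' w' hs hd hadj)
  · rw [if_pos ⟨rfl, rfl⟩]
    have h1 := SimpleGraph.dist_eq_one_iff_adj.2 hadj
    have h2 := h.eq w' v' (by omega)
    rw [h1] at h2
    rw [h.eq u' w' hd, h2]
    simp

/-- A vertex at distance `r + 1` from `u` has a neighbour at distance `r`, for which the matrix was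
exact. Hence a complete sweep enlarges the radius of exactness by one. -/
theorem Relaxed.succ (hG : G.Connected) (h : Relaxed G r (fun _ _ _ => True) d) :
    Relaxed G (r + 1) (fun _ _ _ => False) d := by
  refine ⟨h.le, fun u v hd => ?_, fun _ _ _ hs => hs.elim⟩
  rcases Nat.le_succ_iff.1 hd with hd | hd
  · exact h.eq u v hd
  · obtain ⟨w, h1, h2⟩ := exists_vertex_between hG (u := u) (v := v) (i := r) (by omega)
    refine le_antisymm ?_ (h.le u v)
    have := h.step u v w trivial h1.le (SimpleGraph.dist_eq_one_iff_adj.1 (by omega))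
    rw [h1] at this
    rw [hd]
    push_cast
    exact this

end

namespace Stmt

/-- Relax the entry given by registers `13` and `14` via register `15`. -/
def relaxStep : Stmt :=
  ite (.leR (dst (.var 13) (.var 14)) (.add (dst (.var 13) (.var 15)) (dst (.var 15) (.var 14))))
    skip (stR (dstAddr (.var 13) (.var 14))
      (.add (dst (.var 13) (.var 15)) (dst (.var 15) (.var 14))))

/-- Relax all entries of the matrix repeatedly. -/
def relax : Stmt := loop 16 1 (loop 13 1 (loop 14 1 (loop 15 1 relaxStep)))

/-- The matrix in memory has been relaxed. -/
def RelaxInv (G : SimpleGraph (Fin n)) (m r : ℕ) (S : Fin n → Fin n → Fin n → Prop)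
    (s : State) : Prop := ∃ d, Mat n m d s ∧ Relaxed G r S d

theorem RelaxInv.mono {G : SimpleGraph (Fin n)} {m r : ℕ} {S S' : Fin n → Fin n → Fin n → Prop}
    {s : State} (h : RelaxInv G m r S s) (hS : ∀ u v w, S' u v w → S u v w) :
    RelaxInv G m r S' s := by
  obtain ⟨d, h1, h2⟩ := h
  exact ⟨d, h1, h2.mono hS⟩

theorem run_relaxStep {G : SimpleGraph (Fin n)} (hG : G.Connected) {m r : ℕ} (hr : 1 ≤ r) {δ : ℝ}
    {S S' : Fin n → Fin n → Fin n → Prop} {s : State} (hR : Rows n m δ s)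
    (h : RelaxInv G m r S s) {u v w : Fin n} (hu : s.natReg 13 = u) (hv : s.natReg 14 = v)
    (hw : s.natReg 15 = w)
    (hS : ∀ u' v' w', S' u' v' w' → S u' v' w' ∨ (u' = u ∧ v' = v ∧ w' = w)) :
    RelaxInv G m r S' (relaxStep.run s) := by
  obtain ⟨d, hM, hd⟩ := h
  have hd' := hd.relax hG hr u v w hS
  have eu : (NExp.var 13).eval s = u := hu
  have ev : (NExp.var 14).eval s = v := hv
  have ew : (NExp.var 15).eval s = w := hw
  have e : ∀ {a b : NExp} {x y : Fin n}, a.eval s = x → b.eval s = y →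
      (dst a b).eval s = d x y := by
    intro a b x y ha hb
    rw [dst, RExp.eval, hR.eval_dstAddr ha hb, hM x y]
  by_cases hle : d u v ≤ d u w + d w v
  · rw [relaxStep, run_ite_true (by
      simpa only [BExp.Holds, RExp.eval, e eu ev, e eu ew, e ew ev] using hle), run_skip]
    refine ⟨_, ?_, hd'⟩
    rw [min_eq_left hle]
    convert hM using 3
    split_ifs with h
    · rw [h.1, h.2]
    · rfl
  · rw [relaxStep, run_ite_false (by
      simpa only [BExp.Holds, RExp.eval, e eu ev, e eu ew, e ew ev] using hle)]
    refine ⟨_, ?_, hd'⟩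
    rw [min_eq_right (not_le.1 hle).le]
    simp only [run, RExp.eval, e eu ew, e ew ev, hR.eval_dstAddr eu ev]
    exact hM.update u v _

/-- After `n` sweeps the matrix is exact up to distance `n + 1`, which exceeds every distance.
Within a sweep, the set of relaxed triples grows in lexicographic order, and the invariants of the
nested loops record it. -/
theorem run_relax {G : SimpleGraph (Fin n)} (hG : G.Connected) {m : ℕ} {δ : ℝ} {s : State}
    (hR : Rows n m δ s) (h : RelaxInv G m 1 (fun _ _ _ => False) s) : Ctx G m δ (relax.run s) := by
  have fr : ∀ {L : Stmt} {s s' : State}, Rows n m δ s → L.Frame s s' → (L.pureN &&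
      [1, 3, 4, 5].all (fun r => !L.writesN.contains r) && [0, 1].all fun r => !L.writesR.contains r)
        = true → Rows n m δ s' := by
    intro L s s' h hf hk
    simp only [Bool.and_eq_true, List.all_eq_true, Bool.not_eq_true', List.contains_eq_mem,
      decide_eq_false_iff_not] at hk
    exact h.frame hf hk.1.1 hk.1.2 hk.2
  have fin_lt : ∀ {j : ℕ} (hj : j < n) {u : Fin n}, (u : ℕ) < j + 1 → (u : ℕ) < j ∨ u = ⟨j, hj⟩ := by
    intro j hj u hu
    rcases Nat.lt_succ_iff_lt_or_eq.1 hu with hu | hu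
    exacts [.inl hu, .inr (Fin.ext hu)]
  have key : RelaxInv G m (s.natReg 1 + 1) (fun _ _ _ => False) (relax.run s) := by
    refine run_loop_inv (fun j st => RelaxInv G m (j + 1) (fun _ _ _ => False) st) h ?_
    intro j st hj hj' hf hi
    have R₁ := fr hR hf (by decide)
    have k₁ : RelaxInv G m (j + 1) (fun u _ _ => (u : ℕ) < st.natReg 1)
        ((loop 13 1 (loop 14 1 (loop 15 1 relaxStep))).run st) := by
      refine run_loop_inv (fun a st => RelaxInv G m (j + 1) (fun u _ _ => (u : ℕ) < a) st)
        (hi.mono (by simp)) ?_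
      intro a st₁ ha ha' hf₁ hi₁
      rw [R₁.reg_n] at ha
      have R₂ := fr R₁ hf₁ (by decide)
      have k₂ : RelaxInv G m (j + 1) (fun u v _ => (u : ℕ) < a ∨ (u = ⟨a, ha⟩ ∧ (v : ℕ) < st₁.natReg 1))
          ((loop 14 1 (loop 15 1 relaxStep)).run st₁) := by
        refine run_loop_inv (fun b st => RelaxInv G m (j + 1)
          (fun u v _ => (u : ℕ) < a ∨ (u = ⟨a, ha⟩ ∧ (v : ℕ) < b)) st)
          (hi₁.mono (by simp)) ?_
        intro b st₂ hb hb' hf₂ hi₂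
        rw [R₂.reg_n] at hb
        have R₃ := fr R₂ hf₂ (by decide)
        have k₃ : RelaxInv G m (j + 1) (fun u v w => ((u : ℕ) < a ∨ (u = ⟨a, ha⟩ ∧ (v : ℕ) < b)) ∨
            (u = ⟨a, ha⟩ ∧ v = ⟨b, hb⟩ ∧ (w : ℕ) < st₂.natReg 1)) ((loop 15 1 relaxStep).run st₂) := by
          refine run_loop_inv (fun c st => RelaxInv G m (j + 1)
            (fun u v w => ((u : ℕ) < a ∨ (u = ⟨a, ha⟩ ∧ (v : ℕ) < b)) ∨
              (u = ⟨a, ha⟩ ∧ v = ⟨b, hb⟩ ∧ (w : ℕ) < c)) st)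
            (hi₂.mono (by simp)) ?_
          intro c st₃ hc hc' hf₃ hi₃
          rw [R₃.reg_n] at hc
          refine run_relaxStep hG (by omega) (fr R₃ hf₃ (by decide)) hi₃ (u := ⟨a, ha⟩)
            (v := ⟨b, hb⟩) (w := ⟨c, hc⟩) (((hf₃.n 13 (by decide)).trans
              ((hf₂.n 13 (by decide)).trans ha'))) ((hf₃.n 14 (by decide)).trans hb') hc' ?_
          rintro u v w (h | ⟨h1, h2, h3⟩)
          · exact .inl (.inl h)
          · rcases fin_lt hc h3 with h3 | h3
            exacts [.inl (.inr ⟨h1, h2, h3⟩), .inr ⟨h1, h2, h3⟩]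
        rw [R₃.reg_n] at k₃
        refine RelaxInv.mono (s := (loop 15 1 relaxStep).run st₂) k₃ ?_
        rintro u v w (h | ⟨h1, h2⟩)
        · exact .inl (.inl h)
        · rcases fin_lt hb h2 with h2 | h2
          exacts [.inl (.inr ⟨h1, h2⟩), .inr ⟨h1, h2, w.2⟩]
      rw [R₂.reg_n] at k₂
      refine RelaxInv.mono (s := (loop 14 1 (loop 15 1 relaxStep)).run st₁) k₂ ?_
      rintro u v w h
      rcases fin_lt ha h with h | h
      exacts [.inl h, .inr ⟨h, v.2⟩]
    rw [R₁.reg_n] at k₁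
    obtain ⟨d, h1, h2⟩ := k₁
    exact ⟨d, h1, (h2.mono fun u _ _ _ => u.2).succ hG⟩
  rw [hR.reg_n] at key
  obtain ⟨d, h1, h2⟩ := key
  refine ⟨fr hR (relax.run_frame s) (by decide), fun u v => ?_⟩
  rw [h1 u v, h2.eq u v ((dist_lt_card hG u v).le.trans (by omega))]

/-- Store `0` on the diagonal, `1` for the edges, and `n` elsewhere. -/
def initEntry : Stmt :=
  ite (.eqN (.var 10) (.var 11)) (stR (dstAddr (.var 10) (.var 11)) (.const 0))
    (ite (.eqN (.load (.add (.var 17) (.var 11))) (.const 1))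
      (stR (dstAddr (.var 10) (.var 11)) (.const 1))
      (stR (dstAddr (.var 10) (.var 11)) (.var 9)))

/-- Initialize the matrix. -/
def initMatrix : Stmt :=
  seq (setN 17 (.const 0)) (loop 10 1 (seq (loop 11 1 initEntry) (setN 17 (.add (.var 17) (.var 1)))))

open Classical in
/-- The initial matrix. -/
noncomputable def initial (G : SimpleGraph (Fin n)) (u v : Fin n) : ℝ :=
  if u = v then 0 else if G.Adj u v then 1 else n

/-- All distances are less than `n`, so `n` is a valid upper bound for pairs that are neither equal
nor adjacent. -/
theorem relaxed_initial {G : SimpleGraph (Fin n)} (hG : G.Connected) :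
    Relaxed G 1 (fun _ _ _ => False) (initial G) := by
  refine ⟨fun u v => ?_, fun u v hd => ?_, fun _ _ _ h => h.elim⟩
  · unfold initial
    split_ifs with h1 h2
    · simp [h1]
    · simp [SimpleGraph.dist_eq_one_iff_adj.2 h2]
    · exact_mod_cast (dist_lt_card hG u v).le
  · unfold initial
    split_ifs with h1 h2
    · simp [h1]
    · simp [SimpleGraph.dist_eq_one_iff_adj.2 h2]
    · have := hG.pos_dist_of_ne h1
      exact absurd (SimpleGraph.dist_eq_one_iff_adj.1 (by omega)) h2

theorem run_initEntry {G : SimpleGraph (Fin n)} {m : ℕ} {δ : ℝ} {s : State} (hR : Rows n m δ s)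
    (hI : Input G δ s) {u v : Fin n} (hu : s.natReg 10 = u) (hv : s.natReg 11 = v)
    (h17 : s.natReg 17 = u * n) : initEntry.run s = { s with
      realMem := Function.update s.realMem (space n m + u * base n m + v) (initial G u v) } := by
  have eu : (NExp.var 10).eval s = u := hu
  have ev : (NExp.var 11).eval s = v := hv
  have ea := hR.eval_dstAddr eu ev
  have c1 : BExp.Holds s (.eqN (.var 10) (.var 11)) ↔ u = v := by
    rw [BExp.holds_eqN, eu, ev, Fin.ext_iff]
  have c2 : BExp.Holds s (.eqN (.load (.add (.var 17) (.var 11))) (.const 1)) ↔ G.Adj u v := by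
    rw [BExp.holds_eqN]
    simp only [NExp.eval, h17, hv]
    exact hI.adj u v
  rw [initEntry]
  by_cases h1 : u = v
  · rw [run_ite_true (c1.2 h1)]
    simp [run, ea, RExp.eval, initial, h1]
  · rw [run_ite_false fun h => h1 (c1.1 h)]
    by_cases h2 : G.Adj u v
    · rw [run_ite_true (c2.2 h2)]
      simp [run, ea, RExp.eval, initial, h1, h2]
    · rw [run_ite_false fun h => h2 (c2.1 h)]
      simp [run, ea, RExp.eval, initial, h1, h2, hI.n]

theorem run_initMatrix {G : SimpleGraph (Fin n)} (hG : G.Connected) {m : ℕ} {δ : ℝ} {s : State}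
    (hR : Rows n m δ s) (hI : Input G δ s) :
    Rows n m δ (initMatrix.run s) ∧ RelaxInv G m 1 (fun _ _ _ => False) (initMatrix.run s) := by
  refine ⟨hR.frame (initMatrix.run_frame s) (by decide) (by decide) (by decide), initial G, ?_,
    relaxed_initial hG⟩
  have hq : n ≤ base n m := by rw [base_eq]; omega
  rw [initMatrix, run_seq, run_setN]
  set s₁ := s.setN 17 ((NExp.const 0).eval s) with hs₁
  set L := loop 10 1 (seq (loop 11 1 initEntry) (setN 17 (.add (.var 17) (.var 1)))) with hL
  have f₁ : (setN 17 (.const 0)).Frame s s₁ := run_frame _ s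
  have R₁ : Rows n m δ s₁ := hR.frame f₁ (by decide) (by decide) (by decide)
  have I₁ : Input G δ s₁ := hI.frame f₁ (by decide) (by decide) (by decide)
  have key : (L.run s₁).natReg 17 = s₁.natReg 1 * n ∧ ∀ u v : Fin n, (u : ℕ) < s₁.natReg 1 →
      (L.run s₁).realMem (space n m + u * base n m + v) = initial G u v := by
    refine run_loop_inv (fun j st => st.natReg 17 = j * n ∧ ∀ u v : Fin n, (u : ℕ) < j →
      st.realMem (space n m + u * base n m + v) = initial G u v)
      ⟨by simp [hs₁, NExp.eval], by simp⟩ ?_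
    rintro j st hj hj' hf ⟨i1, i2⟩
    rw [R₁.reg_n] at hj
    have R₂ := R₁.frame hf (by decide) (by decide) (by decide)
    have I₂ := I₁.frame hf (by decide) (by decide) (by decide)
    have inner : ∀ u v : Fin n, ((u : ℕ) < j ∨ (u : ℕ) = j ∧ (v : ℕ) < st.natReg 1) →
        ((loop 11 1 initEntry).run st).realMem (space n m + u * base n m + v) = initial G u v := by
      refine run_loop_inv (fun l st' => ∀ u v : Fin n, ((u : ℕ) < j ∨ (u : ℕ) = j ∧ (v : ℕ) < l) →
        st'.realMem (space n m + u * base n m + v) = initial G u v)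
        (fun u v h => i2 u v (by omega)) ?_
      intro l st' hl hl' hf' hi'
      rw [R₂.reg_n] at hl
      rw [run_initEntry (R₂.frame hf' (by decide) (by decide) (by decide))
        (I₂.frame hf' (by decide) (by decide) (by decide)) (u := ⟨j, hj⟩) (v := ⟨l, hl⟩)
        ((hf'.n 10 (by decide)).trans hj') hl' ((hf'.n 17 (by decide)).trans i1)]
      intro u v h
      simp only [State.setN_realMem]
      by_cases he : space n m + u * base n m + v = space n m + j * base n m + l
      · obtain ⟨h1, h2⟩ := mul_add_inj (Q := base n m) (v.2.trans_le hq) (hl.trans_le hq)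
          (u := u) (u' := j) (by omega)
        rw [he, Function.update_self, show u = ⟨j, hj⟩ from Fin.ext h1,
          show v = ⟨l, hl⟩ from Fin.ext h2]
      · rw [Function.update_of_ne he]
        refine hi' u v ?_
        rcases h with h | ⟨h1, h2⟩
        · exact .inl h
        · refine .inr ⟨h1, lt_of_le_of_ne (Nat.lt_succ_iff.1 h2) fun h3 => he ?_⟩
          rw [h1, h3]
    have f₃ := (loop 11 1 initEntry).run_frame st
    rw [R₂.reg_n] at inner
    rw [run_seq, run_setN]
    refine ⟨?_, fun u v hu => ?_⟩
    · simp only [State.setN_natReg, show (17 : ℕ) ≠ 10 by decide, if_false, if_true, NExp.eval,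
        f₃.n 17 (by decide), f₃.n 1 (by decide), i1, R₂.reg_n]
      ring
    · exact inner u v (by have := v.2; omega)
  rw [R₁.reg_n] at key
  exact fun u v => key.2 u v u.2

end Stmt

end DeltaTour

/-! ## The algorithm -/

namespace DeltaTour

namespace Stmt

/-- The main part of the algorithm. -/
def solve : Stmt :=
  seq computeOffset (seq storeRows (seq initMatrix (seq relax (seq search
    (seq (setN 20 (.var 61)) (seq decodeAll output))))))

/-- The output is at most as long as the best good code, which by `exists_goodCode` is at most as
long as any `δ`-tour. The output passes all points of its tuple and is therefore a `δ`-tour itself.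
-/
theorem run_solve {n : ℕ} {G : SimpleGraph (Fin n)} (hG : G.Connected) {δ : ℝ} (hδ : 0 < δ)
    {m : ℕ} (hm : m = fewPts n ⌈n / δ⌉₊) (hm0 : 0 < m) {s : State} (h1 : s.natReg 1 = n)
    (h3 : s.natReg 3 = m) (h4 : s.natReg 4 = base n m) (h5 : s.natReg 5 = space n m)
    (hI : Input G δ s) :
    ∃ T, Outputs G (solve.run s) T ∧ IsShortestDeltaTour G δ T := by
  have : NeZero n := ⟨by obtain ⟨u⟩ := hG.nonempty; have := u.2; omega⟩
  rw [solve, run_seq, run_seq, run_seq, run_seq, run_seq, run_seq, run_seq, run_setN]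
  have f₁ := computeOffset.run_frame s
  have r₁ := run_computeOffset h3 hI.d hI.n
  have I₁ := hI.frame f₁ (by decide) (by decide) (by decide)
  set s₁ := computeOffset.run s
  have p₁ : Params n m δ s₁ := ⟨(f₁.n 1 (by decide)).trans h1, (f₁.n 3 (by decide)).trans h3,
    (f₁.n 4 (by decide)).trans h4, (f₁.n 5 (by decide)).trans h5, I₁.d, r₁⟩
  obtain ⟨R₂, I₂⟩ := run_storeRows hm0 p₁ I₁
  obtain ⟨R₃, i₃⟩ := run_initMatrix hG R₂ I₂
  have c₄ := run_relax hG R₃ i₃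
  set s₄ := relax.run (initMatrix.run (storeRows.run s₁))
  obtain ⟨T₀, hT₀⟩ := exists_isDeltaTour hG hδ
  obtain ⟨x₀, hx₀, hgood₀, -⟩ := exists_goodCode hG hδ hT₀ hm
  obtain ⟨c₅, hx, hgood, hmin⟩ := run_search hG hm0 c₄ hx₀ hgood₀
  set s₅ := search.run s₄
  set x := s₅.natReg 61 with hxdef
  have c₆ : Ctx G m δ (s₅.setN 20 ((NExp.var 61).eval s₅)) := c₅.setN (by decide) _
  obtain ⟨c₇, t₇⟩ := run_decodeAll (x := x) hG hm0 c₆ (by simp [NExp.eval, hxdef]) hx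
  -- The walk has at most `m * (n + 2) + 1` points with two integer cells each; already `base n m`
  -- is large enough for them.
  have hs : 2 * (m * (n + 2) + 1) + 2 ≤ space n m := by
    refine le_trans ?_ (base_sq_le n hm0)
    have h := base_eq n m
    have : base n m ≤ base n m * base n m := Nat.le_mul_self _
    rw [mul_add m n 2]
    omega
  obtain ⟨T, hO, hw, hmem, hlen⟩ := run_output hG c₇ t₇ (cyc_canon G δ m x) hs
  rw [← codeLen_eq_sum_cyc] at hlen
  have he : cyc G δ m x m = cyc G δ m x 0 := by rw [cyc_self, cyc_of_lt G δ hm0]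
  rw [he] at hw
  refine ⟨T, hO, isDeltaTour_of_mem hG ⟨_, hw⟩ fun p hp => ?_, fun T' hT' => ?_⟩
  · obtain ⟨i, hi, hle⟩ := hgood.exists_le hG hδ hm0 hp
    refine ⟨_, hmem i hi.le, ?_⟩
    rwa [cyc_of_lt G δ hi]
  · obtain ⟨y, hy, hgy, hly⟩ := exists_goodCode hG hδ hT' hm
    exact hlen.trans ((hmin y hy hgy).trans hly)

end Stmt

/-- Compute the least natural number `k` with `n ≤ k * δ`, in register `2`. -/
def ceilDiv : Prog :=
  .loop (.realLt 8 9) (.seq (.instr (.realAdd 8 8 0))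
    (.seq (.instr (.natConst 100 1)) (.instr (.natAdd 2 2 100))))

/-- This loop is controlled by a comparison of reals, so it lies outside the language of bounded
loops and is analysed directly. It runs for exactly `⌈n / δ⌉₊` rounds of four steps each: the test,
two additions and a constant. -/
theorem exec_ceilDiv {n : ℕ} {δ : ℝ} (hδ : 0 < δ) {s₀ s : State} (hs : Upto 100 s₀ s)
    (h2 : s₀.natReg 2 = 0) (h0 : s₀.realReg 0 = δ) (h8 : s₀.realReg 8 = 0)
    (h9 : s₀.realReg 9 = n) : ∃ s', Exec ceilDiv s s' (4 * ⌈n / δ⌉₊ + 1) ∧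
      Upto 100 ((s₀.setN 2 ⌈n / δ⌉₊).setR 8 (⌈n / δ⌉₊ * δ)) s' := by
  have test : ∀ j : ℕ, (j : ℝ) * δ < n ↔ j < ⌈n / δ⌉₊ := fun j => by
    rw [Nat.lt_ceil, lt_div_iff₀ hδ]
  have main : ∀ d j s, j + d = ⌈n / δ⌉₊ → Upto 100 ((s₀.setN 2 j).setR 8 (j * δ)) s →
      ∃ s', Exec ceilDiv s s' (4 * d + 1) ∧
        Upto 100 ((s₀.setN 2 ⌈n / δ⌉₊).setR 8 (⌈n / δ⌉₊ * δ)) s' := by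
    intro d
    induction d with
    | zero =>
      intro j s hj hs
      obtain rfl : j = ⌈n / δ⌉₊ := by omega
      refine ⟨s, Exec.loopDone ?_, hs⟩
      rw [Test.Holds, ← hs.r 8 (by decide), ← hs.r 9 (by decide)]
      simp [h9, test]
    | succ d ih =>
      intro j s hj hs
      have e : Upto 100 ((s₀.setN 2 (j + 1)).setR 8 ((j + 1 : ℕ) * δ))
          (((s.setR 8 (s.realReg 8 + s.realReg 0)).setN 100 1).setN 2 (s.natReg 2 + 1)) := by
        have e2 : s.natReg 2 = j := by simp [← hs.n 2 (by decide)]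
        have e8 : s.realReg 8 + s.realReg 0 = (j + 1 : ℕ) * δ := by
          rw [← hs.r 8 (by decide), ← hs.r 0 (by decide)]
          simp [h0]
          ring
        rw [e2, e8]
        refine ⟨fun i hi => ?_, fun i hi => ?_, hs.mn, hs.mr⟩
        · have := hs.n i hi
          simp only [State.setN_natReg, State.setR_natReg, show i ≠ 100 by omega, if_false] at this ⊢
          split_ifs with h
          · rfl
          · rwa [if_neg h] at this
        · have := hs.r i hi
          simp only [State.setN_realReg, State.setR_realReg] at this ⊢
          split_ifs with h
          · rfl
          · rwa [if_neg h] at this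
      obtain ⟨s', h, u⟩ := ih (j + 1) _ (by omega) e
      refine ⟨s', ?_, u⟩
      rw [show 4 * (d + 1) + 1 = 1 + (1 + 1) + (4 * d + 1) + 1 by ring]
      refine Exec.loopStep ?_
        (Exec.seq (Exec.instr _ _) (Exec.seq (Exec.instr _ _) (Exec.instr _ _))) ?_
      · rw [Test.Holds, ← hs.r 8 (by decide), ← hs.r 9 (by decide)]
        simp [h9, test]
        omega
      · have e' : Instr.eval (Instr.eval (Instr.eval s (.realAdd 8 8 0)) (.natConst 100 1))
            (.natAdd 2 2 100) = ((s.setR 8 (s.realReg 8 + s.realReg 0)).setN 100 1).setN 2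
              (s.natReg 2 + 1) := by
          simp [Instr.eval, State.setN, State.setR]
        rw [e']
        exact h
  refine main ⌈n / δ⌉₊ 0 s (by omega) ?_
  refine ⟨fun i hi => ?_, fun i hi => ?_, hs.mn, hs.mr⟩
  · rw [← hs.n i hi]
    simp only [State.setN_natReg, State.setR_natReg]
    split_ifs with h
    · rw [h, h2]
    · rfl
  · rw [← hs.r i hi]
    simp only [State.setN_realReg, State.setR_realReg]
    split_ifs with h
    · rw [h, h8]
      simp
    · rfl

/-- The algorithm. -/
def algorithm : Prog :=
  .seq Stmt.copyInput.code (.seq ceilDiv (.seq Stmt.countPoints.code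
    (.seq Stmt.computeBase.code (.seq Stmt.computeSpace.code Stmt.solve.code))))

/-- The number of nested loops of the algorithm. -/
def loopDepth : ℕ :=
  Stmt.copyInput.depth + Stmt.countPoints.depth + Stmt.computeBase.depth +
    Stmt.computeSpace.depth + Stmt.solve.depth + 1

/-- The size of the algorithm. -/
def programSize : ℕ :=
  Stmt.copyInput.size + Stmt.countPoints.size + Stmt.computeBase.size +
    Stmt.computeSpace.size + Stmt.solve.size + 5

theorem Outputs.of_upto {n : ℕ} {G : SimpleGraph (Fin n)} {s s' : State} {T : List (Fin n → ℝ)}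
    (h : Outputs G s T) (hs : Upto 100 s s') : Outputs G s' T := by
  rw [Outputs, ← hs.n 0 (by decide), ← hs.mn, ← hs.mr]
  exact h

theorem exec_algorithm {n : ℕ} {G : SimpleGraph (Fin n)} (hG : G.Connected) {δ : ℝ} (hδ : 0 < δ)
    {m : ℕ} (hm : m = fewPts n ⌈n / δ⌉₊) :
    ∃ s t T, Exec algorithm (inputState G δ) s t ∧
      t ≤ programSize * (space n m + 2) ^ loopDepth ∧ Outputs G s T ∧
      IsShortestDeltaTour G δ T := by
  have hn : 0 < n := by obtain ⟨u⟩ := hG.nonempty; have := u.2; omega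
  set k := ⌈n / δ⌉₊ with hk
  have hk0 : 0 < k := Nat.ceil_pos.2 (by positivity)
  have hkm : 700 * k ≤ m := by
    rw [hm, fewPts]
    refine Nat.le_mul_of_pos_right _ ?_
    split_ifs <;> positivity
  have hm0 : 0 < m := by omega
  have hb := base_eq n m
  have hR : base n m ≤ space n m := (Nat.le_mul_self _).trans (base_sq_le n hm0)
  set R := space n m with hRdef
  obtain ⟨I₁, a₁, b₁, c₁, d₁⟩ := Stmt.run_copyInput G δ
  obtain ⟨s₁', t₁, x₁, u₁, l₁⟩ := Stmt.copyInput.exec_code (by decide) R (inputState G δ) _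
    (Upto.refl _ _) (by decide) (by
      intro r hr
      obtain rfl : r = 0 := by simpa [Stmt.copyInput, Stmt.bounds] using hr
      simp only [inputState, if_true]
      omega)
  set s₁ := Stmt.copyInput.run (inputState G δ)
  obtain ⟨s₂', x₂, u₂⟩ := exec_ceilDiv hδ u₁ b₁ I₁.d d₁ I₁.n
  rw [← hk] at x₂ u₂
  set s₂ := (s₁.setN 2 k).setR 8 (k * δ) with hs₂
  have I₂ : Input G δ s₂ := ⟨I₁.adj, by simpa [hs₂] using I₁.d, by simpa [hs₂] using I₁.n⟩
  have a₂ : s₂.natReg 1 = n := by simp [hs₂, a₁]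
  have b₂ : s₂.natReg 2 = k := by simp [hs₂]
  have c₂ : s₂.natReg 12 = 700 := by simp [hs₂, c₁]
  obtain ⟨s₃', t₃, x₃, u₃, l₃⟩ := Stmt.countPoints.exec_code (by decide) R s₂ s₂' u₂ (by decide) (by
      intro r hr
      obtain rfl | rfl : r = 2 ∨ r = 12 := by
        have : ∀ r ∈ Stmt.countPoints.bounds, r = 2 ∨ r = 12 := by decide
        exact this r hr
      all_goals omega)
  have f₃ := Stmt.countPoints.run_frame s₂
  have r₃ := Stmt.run_countPoints a₂ b₂ c₂
  set s₃ := Stmt.countPoints.run s₂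
  rw [← hm] at r₃
  have I₃ : Input G δ s₃ := I₂.frame f₃ (by decide) (by decide) (by decide)
  have a₃ : s₃.natReg 1 = n := (f₃.n 1 (by decide)).trans a₂
  obtain ⟨s₄', t₄, x₄, u₄, l₄⟩ := Stmt.computeBase.exec_code (by decide) R s₃ s₃' u₃ (by decide) (by
      intro r hr
      obtain rfl : r = 3 := by
        have : ∀ r ∈ Stmt.computeBase.bounds, r = 3 := by decide
        exact this r hr
      omega)
  have f₄ := Stmt.computeBase.run_frame s₃
  have r₄ := Stmt.run_computeBase a₃ r₃
  set s₄ := Stmt.computeBase.run s₃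
  have I₄ : Input G δ s₄ := I₃.frame f₄ (by decide) (by decide) (by decide)
  have a₄ : s₄.natReg 1 = n := (f₄.n 1 (by decide)).trans a₃
  have b₄ : s₄.natReg 3 = m := (f₄.n 3 (by decide)).trans r₃
  obtain ⟨s₅', t₅, x₅, u₅, l₅⟩ := Stmt.computeSpace.exec_code (by decide) R s₄ s₄' u₄ (by decide) (by
      intro r hr
      obtain rfl | rfl : r = 3 ∨ r = 4 := by
        have : ∀ r ∈ Stmt.computeSpace.bounds, r = 3 ∨ r = 4 := by decide
        exact this r hr
      all_goals omega)
  have f₅ := Stmt.computeSpace.run_frame s₄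
  have r₅ := Stmt.run_computeSpace b₄ r₄
  set s₅ := Stmt.computeSpace.run s₄
  have I₅ : Input G δ s₅ := I₄.frame f₅ (by decide) (by decide) (by decide)
  have a₅ : s₅.natReg 1 = n := (f₅.n 1 (by decide)).trans a₄
  have b₅ : s₅.natReg 3 = m := (f₅.n 3 (by decide)).trans b₄
  have c₅ : s₅.natReg 4 = base n m := (f₅.n 4 (by decide)).trans r₄
  obtain ⟨s₆', t₆, x₆, u₆, l₆⟩ := Stmt.solve.exec_code (by decide) R s₅ s₅' u₅ (by decide) (by
      intro r hr
      obtain rfl | rfl | rfl | rfl : r = 1 ∨ r = 3 ∨ r = 4 ∨ r = 5 := by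
        have : ∀ r ∈ Stmt.solve.bounds, r = 1 ∨ r = 3 ∨ r = 4 ∨ r = 5 := by decide
        exact this r hr
      all_goals omega)
  obtain ⟨T, hO, hT⟩ := Stmt.run_solve hG hδ hm hm0 a₅ b₅ c₅ r₅ I₅
  refine ⟨s₆', _, T, Exec.seq x₁ (Exec.seq x₂ (Exec.seq x₃ (Exec.seq x₄ (Exec.seq x₅ x₆)))), ?_,
    hO.of_upto u₆, hT⟩
  have mono : ∀ {d : ℕ}, d ≤ loopDepth → (R + 2) ^ d ≤ (R + 2) ^ loopDepth := fun hd =>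
    Nat.pow_le_pow_right (by omega) hd
  have bound : ∀ {a d t : ℕ}, t ≤ a * (R + 2) ^ d → d ≤ loopDepth →
      t ≤ a * (R + 2) ^ loopDepth := fun h hd => h.trans (Nat.mul_le_mul_left _ (mono hd))
  have h₁ := bound l₁ (by rw [loopDepth]; omega)
  have h₃ := bound l₃ (by rw [loopDepth]; omega)
  have h₄ := bound l₄ (by rw [loopDepth]; omega)
  have h₅ := bound l₅ (by rw [loopDepth]; omega)
  have h₆ := bound l₆ (by rw [loopDepth]; omega)
  -- The time for finding `k` is absorbed because `700 * k ≤ m ≤ base n m ≤ R`.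
  have h₂ : 4 * k + 1 ≤ 5 * (R + 2) ^ loopDepth :=
    bound (d := 1) (by rw [pow_one]; omega) (by rw [loopDepth]; omega)
  rw [programSize]
  simp only [add_mul]
  omega

/-- A bound on the base of the encoding divided by `n`. -/
def baseBound (k : ℕ) : ℕ := 16 * (700 * (k * (k * k)) + 1) * (8 * k + 1)

/-- The exponent `4 * m` is `2800 * k ^ 3` if `n ≤ 8 * k`, where the base is bounded in `k` as well,
and `2800 * k` otherwise, where the base is at most `baseBound k * n`. Thus `n` never gets an
exponent larger than `2800 * k`. -/
theorem space_fewPts_le {n k : ℕ} (hn : 0 < n) (hk : 0 < k) :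
    space n (fewPts n k) ≤ baseBound k ^ (2800 * (k * (k * k))) * n ^ (2800 * k) := by
  have hP : 0 < baseBound k := by unfold baseBound; positivity
  have hk3 : k ≤ k * (k * k) := Nat.le_mul_of_pos_right _ (by positivity)
  rw [space, ← pow_mul]
  by_cases h : n ≤ 8 * k
  · have hm : fewPts n k = 700 * (k * (k * k)) := by rw [fewPts, if_pos h]; ring
    have hb : base n (fewPts n k) ≤ baseBound k := by
      rw [hm, base, baseBound]
      have : (700 * (k * (k * k)) + 1) * (n + 1) ≤ (700 * (k * (k * k)) + 1) * (8 * k + 1) :=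
        Nat.mul_le_mul_left _ (by omega)
      rw [mul_assoc]
      omega
    rw [hm] at hb ⊢
    calc _ ≤ baseBound k ^ (4 * (700 * (k * (k * k)))) := Nat.pow_le_pow_left hb _
      _ = baseBound k ^ (2800 * (k * (k * k))) * 1 := by rw [mul_one]; congr 1; ring
      _ ≤ _ := Nat.mul_le_mul_left _ (Nat.one_le_pow _ _ hn)
  · have hm : fewPts n k = 700 * k := by rw [fewPts, if_neg h, mul_one]
    have hb : base n (fewPts n k) ≤ baseBound k * n := by
      rw [hm, base, baseBound]
      have h1 : (700 * k + 1) * (n + 1) ≤ (700 * (k * (k * k)) + 1) * (2 * n) :=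
        Nat.mul_le_mul (by omega) (by omega)
      have h2 : (700 * (k * (k * k)) + 1) * (2 * n) * 1 ≤
          (700 * (k * (k * k)) + 1) * (2 * n) * (8 * k + 1) := Nat.mul_le_mul_left _ (by omega)
      have h3 : 16 * (700 * (k * (k * k)) + 1) * (8 * k + 1) * n =
          8 * ((700 * (k * (k * k)) + 1) * (2 * n) * (8 * k + 1)) := by ring
      rw [h3]
      omega
    rw [hm] at hb ⊢
    calc _ ≤ (baseBound k * n) ^ (4 * (700 * k)) := Nat.pow_le_pow_left hb _
      _ = baseBound k ^ (2800 * k) * n ^ (2800 * k) := by rw [mul_pow]; ring_nf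
      _ ≤ _ := Nat.mul_le_mul_right _ (Nat.pow_le_pow_right hP (by omega))

/-- The factor of the running time that depends only on `k`. -/
def timeFactor (k : ℕ) : ℕ :=
  programSize * 3 ^ loopDepth * (baseBound k ^ (2800 * (k * (k * k)))) ^ loopDepth

theorem computable_timeFactor : Computable timeFactor := by
  have hpow : Primrec₂ ((· ^ ·) : ℕ → ℕ → ℕ) := Primrec₂.unpaired'.1 Nat.Primrec.pow
  have hmul := Primrec.nat_mul
  have hadd := Primrec.nat_add
  have hcube : Primrec fun k : ℕ => k * (k * k) :=
    hmul.comp Primrec.id (hmul.comp Primrec.id Primrec.id)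
  have hlin : ∀ a : ℕ, Primrec fun k : ℕ => a * k := fun a =>
    hmul.comp (Primrec.const a) Primrec.id
  have hbase : Primrec baseBound :=
    hmul.comp (hmul.comp (Primrec.const 16)
      (Primrec.succ.comp ((hlin 700).comp hcube))) (Primrec.succ.comp (hlin 8))
  exact Primrec.to_comp (hmul.comp (Primrec.const (programSize * 3 ^ loopDepth))
    (hpow.comp (hpow.comp hbase ((hlin 2800).comp hcube)) (Primrec.const loopDepth)))

/-- As `R ≥ 1`, the summand `2` is absorbed by `R + 2 ≤ 3 * R`. The constant nesting depth only
multiplies the exponent of `n`. -/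
theorem time_le {n k t : ℕ} (hn : 0 < n) (hk : 0 < k)
    (ht : t ≤ programSize * (space n (fewPts n k) + 2) ^ loopDepth) :
    t ≤ timeFactor k * n ^ (2800 * loopDepth * k) := by
  set R := space n (fewPts n k) with hR
  have hR1 : 1 ≤ R := by
    refine Nat.one_le_pow _ _ (Nat.pow_pos ?_)
    rw [base_eq]
    omega
  calc t ≤ programSize * (3 * R) ^ loopDepth :=
        ht.trans (Nat.mul_le_mul_left _ (Nat.pow_le_pow_left (by omega) _))
    _ ≤ programSize * (3 * (baseBound k ^ (2800 * (k * (k * k))) * n ^ (2800 * k))) ^ loopDepth :=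
        Nat.mul_le_mul_left _ (Nat.pow_le_pow_left
          (Nat.mul_le_mul_left _ (space_fewPts_le hn hk)) _)
    _ = _ := by
        rw [timeFactor, mul_pow, mul_pow, ← pow_mul n, mul_right_comm 2800 k]
        ring

end DeltaTour

theorem mainTheorem6 :
    ∃ (A : DeltaTour.Prog) (f : ℕ → ℕ) (c : ℕ), Computable f ∧
      ∀ (n : ℕ) (G : SimpleGraph (Fin n)), G.Connected → ∀ δ : ℝ, 0 < δ →
        ∃ (s : DeltaTour.State) (t : ℕ) (T : List (Fin n → ℝ)),
          DeltaTour.Exec A (DeltaTour.inputState G δ) s t ∧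
          t ≤ f ⌈(n : ℝ) / δ⌉₊ * n ^ (c * ⌈(n : ℝ) / δ⌉₊) ∧
          DeltaTour.Outputs G s T ∧
          DeltaTour.IsShortestDeltaTour G δ T := by
  refine ⟨DeltaTour.algorithm, DeltaTour.timeFactor, 2800 * DeltaTour.loopDepth,
    DeltaTour.computable_timeFactor, fun n G hG δ hδ => ?_⟩
  have hn : 0 < n := by obtain ⟨u⟩ := hG.nonempty; have := u.2; omega
  obtain ⟨s, t, T, hx, ht, hO, hT⟩ := DeltaTour.exec_algorithm hG hδ rfl
  exact ⟨s, t, T, hx, DeltaTour.time_le hn (Nat.ceil_pos.2 (by positivity)) ht, hO, hT⟩
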